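/- **Setting.** Let $\Sigma$ be a smooth (Hausdorff, second countable) manifold. For each $t\in\mathbb R$ let $\tilde g(t)$ be a Riemannian metric on $\Sigma$ with inverse $\tilde g^{ij}(t)$, such that $\tilde g^{ij}(t)$ and $\tilde g_{ij}(t)$ are measurable and locally bounded; let $\gamma(t)>0$ be a density, differentiable in $t$, with $\log\gamma(t)\in L^1_{\rm loc}$ and $\gamma(t)^{-1}\mathrm d\gamma(t)=\mathrm d\log\gamma(t)\in L^2_{\rm loc}$; let $A(t)\in L^2_{\rm loc}$ be a real $1$-form, $\tilde Y(t)\in L^1_{\rm loc}$ a real function bounded from below, $\beta(t)$ a vector field and $V(t)$ a real function. With $D=-\mathrm i\partial$ and $D^{A,\gamma}(t)=\gamma(t)^{1/2}(D-A(t))\gamma(t)^{-1/2}$ let $$l_t[u,v]=\int_\Sigma\Bigl(\overline{D_i^{A,\gamma}(t)u}\;\tilde g^{ij}(t)\,D_j^{A,\gamma}(t)v+\overline u\,\tilde Y(t)\,v\Bigr)$$ on its maximal domain $\operatorname{dom} l_t$ in the space $L^2(\Omega^{1/2}\Sigma)$ of square-integrable half-densities (all $u\in L^2$ with $\int\tilde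 g^{ij}(t)\,\overline{D_i^{A,\gamma}(t)u}\,D_j^{A,\gamma}(t)u<\infty$ and $\tilde Y(t)|u|^2\in L^1$, derivatives in the weak sense), let $L(t)$ be the self-adjoint operator defined by this form, and let $$W(t)=-\beta(t)^iD_i+V(t)-\tfrac12\gamma(t)^{-1}\bigl(D_t\gamma(t)-\beta(t)^iD_i\gamma(t)\bigr),\qquad D_t=-\mathrm i\partial_t .$$ Assume that for every $t$ the operator $L(t)$ is positive and has a bounded inverse. For half-densitized $1$-forms put $\|X\|_t=\bigl(\int_\Sigma\tilde g^{ij}(t)\overline{X_i}X_j\bigr)^{1/2}$. **Time derivatives.** Assume that $\tilde Y$, $A$, $\gamma^{-1}\mathrm d\gamma$, $\tilde g^{ij}$ and the coefficients of $W$ (the components of $\beta$ and the zeroth-order coefficient) are absolutely continuous in time at almost every point of $\Sigma$, with jointly measurable derivatives $\partial_s\tilde Y(s)$, $\partial_sA(s)$, etc.; $\partial_sW(s)$ is the first-order operator whose coefficients are the time derivatives of those of $W(s)$. Assume moreover that for every $t$ the form of $\partial_s\tilde Y$ is densely defined relative to $L(t)$: the set $\mathcal D_t$ of those $v\in L^2(\Omega^{1/2}\Sigma)$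 for which $\partial_s\tilde Y(s)\,|L(t)^{-1/2}v|^2$ is integrable over $(s,x)\in[t-1,t+1]\times\Sigma$ is dense in $L^2(\Omega^{1/2}\Sigma)$. **Proposition.** Suppose that there are non-negative $C_Y,C_g,C_W\in L^1_{\rm loc}(\mathbb R)$ and $C_A,C_\gamma\in L^2_{\rm loc}(\mathbb R)$ such that for all $t$ and almost all $s$ with $|t-s|\le1$ $$\begin{aligned} \bigl\|L(t)^{-1/2}\,\partial_s\tilde Y(s)\,L(t)^{-1/2}\bigr\|&\le C_Y(s),\\ \bigl\|\partial_sW(s)\,L(t)^{-1/2}\bigr\|&\le C_W(s),\\ \bigl\|\partial_sA(s)\,L(t)^{-1/2}\bigr\|_t&\le C_A(s),\\ \bigl\|\partial_s\bigl(\gamma(s)^{-1}\mathrm d\gamma(s)\bigr)L(t)^{-1/2}\bigr\|_t&\le C_\gamma(s),\\ \bigl|\partial_s\tilde g^{ij}(s)X_iX_j\bigr|&\le C_g(s)\,\tilde g^{ij}(t)X_iX_j\quad\text{for all real covectors }X\text{ at almost every point of }\Sigma, \end{aligned}$$ where the first bound means that for all $v,w\in\mathcal D_t$, for almost all such $s$,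 $\bigl|\int_\Sigma\overline{L(t)^{-1/2}v}\;\partial_s\tilde Y(s)\,L(t)^{-1/2}w\bigr|\le C_Y(s)\|v\|\,\|w\|$. Then there is a positive $C\in L^1_{\rm loc}(\mathbb R)$ such that for all $t,s$ with $|t-s|\le1$ $$\bigl\|L(t)^{-1/2}\bigl(L(t)-L(s)\bigr)L(t)^{-1/2}\bigr\|+2\,\bigl\|\bigl(W(t)-W(s)\bigr)L(t)^{-1/2}\bigr\|\le\Bigl|\int_s^tC(r)\,\mathrm dr\Bigr| ,$$ where $L(t)-L(s)$ is understood as the difference of the forms $l_t-l_s$ (in particular $\operatorname{Ran}L(t)^{-1/2}\subset\operatorname{dom} l_s$), and both operators on the left are bounded. -/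

import Mathlib

open MeasureTheory Set
open scoped Manifold ContDiff ENNReal

noncomputable section

/-- The model space `ℝⁿ` of the spatial manifold. -/
abbrev Spc (n : ℕ) : Type := EuclideanSpace ℝ (Fin n)

/-- `F`-valued one-forms on a manifold `S` modelled on `ℝⁿ` (arbitrary, possibly discontinuous,
sections of the cotangent bundle with values in `F`). -/
abbrev OneForm (n : ℕ) (S : Type*) [TopologicalSpace S] [ChartedSpace (Spc n) S]
    (F : Type*) [NormedAddCommGroup F] [NormedSpace ℝ F] : Type _ :=
  ∀ x : S, TangentSpace 𝓘(ℝ, Spc n) x →L[ℝ] F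

/-- Vector fields (arbitrary sections of the tangent bundle). -/
abbrev VecField (n : ℕ) (S : Type*) [TopologicalSpace S] [ChartedSpace (Spc n) S] : Type _ :=
  ∀ x : S, TangentSpace 𝓘(ℝ, Spc n) x

/-- Fields of real bilinear forms on the cotangent spaces, `(ξ, η) ↦ gⁱʲ ξᵢ ηⱼ`. -/
abbrev CoMetric (n : ℕ) (S : Type*) [TopologicalSpace S] [ChartedSpace (Spc n) S] : Type _ :=
  ∀ x : S, LinearMap.BilinForm ℝ (TangentSpace 𝓘(ℝ, Spc n) x →L[ℝ] ℝ)

section Coordinates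

variable {n : ℕ} {S : Type*} [TopologicalSpace S] [ChartedSpace (Spc n) S]
  {F : Type*} [NormedAddCommGroup F] [NormedSpace ℝ F]

/-- The component of a one-form in the chart `e` in the constant coordinate direction `v`,
as a function of the coordinates. -/
def formComp (e : OpenPartialHomeomorph S (Spc n)) (τ : OneForm n S F) (v : Spc n) :
    Spc n → F :=
  fun y => τ (e.symm y) (mfderiv 𝓘(ℝ, Spc n) 𝓘(ℝ, Spc n) e.symm y v)

/-- The covector at `x` which has the constant coordinates `η` in the chart `e`. -/
def coordCovector (e : OpenPartialHomeomorph S (Spc n)) (η : Spc n →L[ℝ] ℝ) (x : S) :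
    TangentSpace 𝓘(ℝ, Spc n) x →L[ℝ] ℝ :=
  η.comp (mfderiv 𝓘(ℝ, Spc n) 𝓘(ℝ, Spc n) e x)

/-- The component of a vector field in the chart `e` along the constant covector `η`. -/
def vecComp (e : OpenPartialHomeomorph S (Spc n)) (β : VecField n S) (η : Spc n →L[ℝ] ℝ) :
    Spc n → ℝ :=
  fun y => coordCovector e η (e.symm y) (β (e.symm y))

/-- The components of a field of bilinear forms on covectors in the chart `e`. -/
def metComp (e : OpenPartialHomeomorph S (Spc n)) (g : CoMetric n S) (η ζ : Spc n →L[ℝ] ℝ) :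
    Spc n → ℝ :=
  fun y => g (e.symm y) (coordCovector e η (e.symm y)) (coordCovector e ζ (e.symm y))

/-- `μ` is a smooth positive density on the manifold. -/
def IsSmoothDensity [MeasurableSpace S] (μ : Measure S) : Prop :=
  ∀ e ∈ atlas (Spc n) S, ∃ m : Spc n → ℝ,
    ContDiffOn ℝ ∞ m e.target ∧ (∀ y ∈ e.target, 0 < m y) ∧
    (μ.restrict e.source).map e =
      (volume.restrict e.target).withDensity (fun y => ENNReal.ofReal (m y))

/-- `τ` is the weak (distributional) differential of `f`; both are locally integrable. -/
structure HasWeakDiff (f : S → F) (τ : OneForm n S F) : Prop where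
  locInt : ∀ e ∈ atlas (Spc n) S, LocallyIntegrableOn (fun y => f (e.symm y)) e.target
  locInt_diff : ∀ e ∈ atlas (Spc n) S, ∀ v : Spc n,
    LocallyIntegrableOn (formComp e τ v) e.target
  integral_eq : ∀ e ∈ atlas (Spc n) S, ∀ v : Spc n, ∀ φ : Spc n → ℝ,
    ContDiff ℝ ∞ φ → HasCompactSupport φ → tsupport φ ⊆ e.target →
      ∫ y in e.target, (fderiv ℝ φ y v) • f (e.symm y) =
        - ∫ y in e.target, φ y • formComp e τ v y

open Classical in
/-- The weak differential of `f` (unique almost everywhere when it exists). -/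
def weakDiff (f : S → F) : OneForm n S F :=
  if h : ∃ τ : OneForm n S F, HasWeakDiff f τ then h.choose else fun _ => 0

/-- A real one-form is in `L²_loc`. -/
def FormL2Loc (τ : OneForm n S ℝ) : Prop :=
  ∀ e ∈ atlas (Spc n) S, ∀ v : Spc n,
    AEStronglyMeasurable (formComp e τ v) (volume.restrict e.target) ∧
    LocallyIntegrableOn (fun y => (formComp e τ v y) ^ 2) e.target

end Coordinates

/-- The sesquilinear extension `(X, Z) ↦ gⁱʲ X̄ᵢ Zⱼ` to complex covectors. -/
def cForm {V : Type*} [AddCommGroup V] [Module ℝ V] [TopologicalSpace V]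
    (g : LinearMap.BilinForm ℝ (V →L[ℝ] ℝ)) (X Z : V →L[ℝ] ℂ) : ℂ :=
  ((g (Complex.reCLM.comp X) (Complex.reCLM.comp Z)
      + g (Complex.imCLM.comp X) (Complex.imCLM.comp Z) : ℝ) : ℂ)
    + Complex.I * ((g (Complex.reCLM.comp X) (Complex.imCLM.comp Z)
      - g (Complex.imCLM.comp X) (Complex.reCLM.comp Z) : ℝ) : ℂ)

/-- The positive square root of a bounded positive operator on a Hilbert space. -/
def opSqrt {H : Type*} [NormedAddCommGroup H] [InnerProductSpace ℂ H] [CompleteSpace H]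
    (R : H →L[ℂ] H) : H →L[ℂ] H := CFC.sqrt R

/-- `df` is the time derivative of the time-dependent function `f`: `f` is absolutely continuous in
time, for almost every point, with derivative `df`. -/
def IsTimeDeriv {X F : Type*} [MeasurableSpace X] [NormedAddCommGroup F] [NormedSpace ℝ F]
    (ν : Measure X) (f df : ℝ → X → F) : Prop :=
  AEStronglyMeasurable (fun p : ℝ × X => df p.1 p.2) ((volume : Measure ℝ).prod ν) ∧
  ∀ s t : ℝ, ∀ᵐ x ∂ν, IntervalIntegrable (fun r => df r x) volume s t ∧
    f t x - f s x = ∫ r in s..t, df r x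

section TensorTimeDeriv

variable {n : ℕ} {S : Type*} [TopologicalSpace S] [ChartedSpace (Spc n) S]

/-- Time derivative of a time-dependent real one-form. -/
def IsFormTimeDeriv (τ dτ : ℝ → OneForm n S ℝ) : Prop :=
  ∀ e ∈ atlas (Spc n) S, ∀ v : Spc n,
    IsTimeDeriv (volume.restrict e.target)
      (fun r => formComp e (τ r) v) (fun r => formComp e (dτ r) v)

/-- Time derivative of a time-dependent vector field. -/
def IsVecTimeDeriv (β dβ : ℝ → VecField n S) : Prop :=
  ∀ e ∈ atlas (Spc n) S, ∀ η : Spc n →L[ℝ] ℝ,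
    IsTimeDeriv (volume.restrict e.target)
      (fun r => vecComp e (β r) η) (fun r => vecComp e (dβ r) η)

/-- Time derivative of a time-dependent field of bilinear forms on covectors. -/
def IsMetTimeDeriv (g dg : ℝ → CoMetric n S) : Prop :=
  ∀ e ∈ atlas (Spc n) S, ∀ η ζ : Spc n →L[ℝ] ℝ,
    IsTimeDeriv (volume.restrict e.target)
      (fun r => metComp e (g r) η ζ) (fun r => metComp e (dg r) η ζ)

end TensorTimeDeriv

/-- The time-dependent coefficients of the operators `L(t)` and `W(t)` on a manifold `S`.
A smooth positive density `μ` on `S` is used to trivialize densities and half-densities: the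
density is `γ(t) μ` with a positive function `γ(t)`, and the half-density `f μ^{1/2}` is
represented by the function `f`. Thus `L²(Ω^{1/2} S)` is `L²(S, μ)`. -/
structure KGCoeffs (n : ℕ) (S : Type*) [TopologicalSpace S] [ChartedSpace (Spc n) S]
    [MeasurableSpace S] (μ : Measure S) where
  /-- the inverse metric `g̃ⁱʲ(t)` -/
  g : ℝ → CoMetric n S
  /-- the density `γ(t)`, relative to `μ` -/
  γ : ℝ → S → ℝ
  /-- the one-form `γ(t)⁻¹ dγ(t)` -/
  θ : ℝ → OneForm n S ℝ
  /-- the vector potential `A(t)` -/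
  A : ℝ → OneForm n S ℝ
  /-- the scalar potential `Ỹ(t)` -/
  Y : ℝ → S → ℝ
  /-- the shift vector `β(t)` -/
  β : ℝ → VecField n S
  /-- the electric potential `V(t)` -/
  V : ℝ → S → ℝ
  g_symm : ∀ t x ξ η, g t x ξ η = g t x η ξ
  g_pos : ∀ t x ξ, ξ ≠ 0 → 0 < g t x ξ ξ
  g_meas : ∀ t, ∀ e ∈ atlas (Spc n) S, ∀ η ζ : Spc n →L[ℝ] ℝ,
    AEStronglyMeasurable (metComp e (g t) η ζ) (volume.restrict e.target)
  /-- the metric and its inverse are locally bounded -/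
  g_locBdd : ∀ t, ∀ e ∈ atlas (Spc n) S, ∀ K : Set (Spc n), IsCompact K → K ⊆ e.target →
    ∃ c C : ℝ, 0 < c ∧ ∀ᵐ y ∂(volume.restrict K), ∀ η : Spc n →L[ℝ] ℝ,
      c * ‖η‖ ^ 2 ≤ metComp e (g t) η η y ∧ metComp e (g t) η η y ≤ C * ‖η‖ ^ 2
  γ_pos : ∀ t x, 0 < γ t x
  γ_diff : ∀ t, ∀ᵐ x ∂μ, DifferentiableAt ℝ (fun r => γ r x) t
  θ_weak : ∀ t, HasWeakDiff (fun x => Real.log (γ t x)) (θ t)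
  θ_locL2 : ∀ t, FormL2Loc (θ t)
  A_locL2 : ∀ t, FormL2Loc (A t)
  Y_locInt : ∀ t, LocallyIntegrable (Y t) μ
  Y_bddBelow : ∀ t, ∃ K : ℝ, ∀ᵐ x ∂μ, K ≤ Y t x

namespace KGCoeffs

variable {n : ℕ} {S : Type*} [TopologicalSpace S] [ChartedSpace (Spc n) S]
  [MeasurableSpace S] {μ : Measure S} (c : KGCoeffs n S μ)

/-- `D^{A,γ}(t) u = γ^{1/2} (D - A) γ^{-1/2} u = -i du - A u + (i/2) γ⁻¹ dγ u`, `D = -i ∂`. -/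
def covD (t : ℝ) (u : S → ℂ) : OneForm n S ℂ := fun x =>
  (-Complex.I) • weakDiff (n := n) u x - u x • Complex.ofRealCLM.comp (c.A t x)
    + (Complex.I / 2 * u x) • Complex.ofRealCLM.comp (c.θ t x)

/-- The domain of the maximal form of `L(t)`. -/
def formDom (t : ℝ) : Set (Lp ℂ 2 μ) :=
  {u | (∃ τ : OneForm n S ℂ, HasWeakDiff (u : S → ℂ) τ) ∧
    Integrable (fun x => cForm (c.g t x) (c.covD t u x) (c.covD t u x)) μ ∧
    Integrable (fun x => c.Y t x * ‖u x‖ ^ 2) μ}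

/-- The maximal form of `L(t)`. -/
def form (t : ℝ) (u v : Lp ℂ 2 μ) : ℂ :=
  ∫ x, (cForm (c.g t x) (c.covD t u x) (c.covD t v x)
    + (starRingEnd ℂ) (u x) * (c.Y t x : ℂ) * v x) ∂μ

/-- The graph of the operator `L(t)` defined by the maximal form: `v ∈ Dom L(t)` and
`L(t) v = f`. -/
def IsL (t : ℝ) (v f : Lp ℂ 2 μ) : Prop :=
  v ∈ c.formDom t ∧ ∀ u ∈ c.formDom t, inner ℂ u f = c.form t u v

/-- `R` is the (bounded, everywhere defined) inverse of `L(t)`. -/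
def IsInverse (t : ℝ) (R : Lp ℂ 2 μ →L[ℂ] Lp ℂ 2 μ) : Prop :=
  ∀ v f : Lp ℂ 2 μ, c.IsL t v f ↔ v = R f

/-- `L(t)` is positive and invertible (with bounded inverse). -/
def PositiveInvertible (t : ℝ) : Prop :=
  (∀ v f : Lp ℂ 2 μ, c.IsL t v f → 0 ≤ (inner ℂ v f : ℂ).re) ∧ ∃ R, c.IsInverse t R

open Classical in
/-- `L(t)⁻¹`. -/
def Linv (t : ℝ) : Lp ℂ 2 μ →L[ℂ] Lp ℂ 2 μ :=
  if h : ∃ R, c.IsInverse t R then h.choose else 0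

/-- `L(t)^{-1/2}`. -/
def LinvSqrt (t : ℝ) : Lp ℂ 2 μ →L[ℂ] Lp ℂ 2 μ :=
  opSqrt (c.Linv t)

/-- The first-order differential operator `-bⁱ Dᵢ + w`, applied to `u`. -/
def firstOrder (b : VecField n S) (w : S → ℂ) (u : S → ℂ) : S → ℂ := fun x =>
  Complex.I * weakDiff (n := n) u x (b x) + w x * u x

/-- The zeroth-order coefficient `V - (1/2) γ⁻¹ (D_t γ - βⁱ Dᵢ γ)` of `W(t)`, where
`D_t = -i ∂_t` and `Dᵢ = -i ∂ᵢ`. -/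
def wCoeff (t : ℝ) (x : S) : ℂ :=
  (c.V t x : ℂ) +
    Complex.I / 2 * ((deriv (fun r => c.γ r x) t / c.γ t x - c.θ t x (c.β t x) : ℝ) : ℂ)

/-- `W(t) u`, where `W = -βⁱ Dᵢ + V - (1/2) γ⁻¹ (D_t γ - βⁱ Dᵢ γ)`. -/
def W (t : ℝ) (u : S → ℂ) : S → ℂ := firstOrder (c.β t) (c.wCoeff t) u

/-- The norm `‖X‖_t = (∫ g̃ⁱʲ(t) X̄ᵢ Xⱼ)^{1/2}` on half-densitized one-forms. -/
def formNorm (t : ℝ) (X : OneForm n S ℂ) : ℝ≥0∞ :=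
  (∫⁻ x, ENNReal.ofReal (cForm (c.g t x) (X x) (X x)).re ∂μ) ^ (1 / 2 : ℝ)

/-- `‖τ L(t)^{-1/2}‖_t ≤ C` for multiplication by a real one-form `τ`. -/
def FormMulBound (t : ℝ) (τ : OneForm n S ℝ) (C : ℝ) : Prop :=
  ∀ v : Lp ℂ 2 μ,
    c.formNorm t (fun x => (c.LinvSqrt t v x) • Complex.ofRealCLM.comp (τ x)) ≤
      ENNReal.ofReal (C * ‖v‖)

/-- The vectors `v` for which `dY |L(t)^{-1/2} v|²` is integrable on `[t-1,t+1] × S`. -/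
def potDom (dY : ℝ → S → ℝ) (t : ℝ) : Set (Lp ℂ 2 μ) :=
  {v | Integrable (fun p : ℝ × S => dY p.1 p.2 * ‖c.LinvSqrt t v p.2‖ ^ 2)
    (((volume : Measure ℝ).restrict (Icc (t - 1) (t + 1))).prod μ)}

/-- There is a positive `C ∈ L¹_loc(ℝ)` such that, for `|t - s| ≤ 1`,
`‖L(t)^{-1/2} (L(t) - L(s)) L(t)^{-1/2}‖ + 2 ‖(W(t) - W(s)) L(t)^{-1/2}‖ ≤ |∫ₛᵗ C|`.
The first operator is defined through the forms of `L(t)` and `L(s)`; it is part of the claim that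
`Ran L(t)^{-1/2}` is contained in the form domain of `L(s)`, and that both operators are bounded. -/
def LWGrowthLoc : Prop :=
  ∃ C : ℝ → ℝ, LocallyIntegrable C ∧ (∀ r, 0 < C r) ∧
    ∀ t s : ℝ, |t - s| ≤ 1 →
      (∀ v, c.LinvSqrt t v ∈ c.formDom t ∧ c.LinvSqrt t v ∈ c.formDom s) ∧
      ∃ T B : Lp ℂ 2 μ →L[ℂ] Lp ℂ 2 μ,
        (∀ v w, inner ℂ v (T w) = c.form t (c.LinvSqrt t v) (c.LinvSqrt t w)
          - c.form s (c.LinvSqrt t v) (c.LinvSqrt t w)) ∧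
        (∀ v, (B v : S → ℂ) =ᵐ[μ]
          fun x => c.W t (c.LinvSqrt t v) x - c.W s (c.LinvSqrt t v) x) ∧
        ‖T‖ + 2 * ‖B‖ ≤ |∫ r in s..t, C r|

end KGCoeffs

end

open MeasureTheory Set
open scoped Manifold ContDiff ENNReal

set_option linter.unusedSectionVars false
set_option linter.unusedSimpArgs false

noncomputable section

/-! Write u = L(t)^{-1/2} v, put D = 1 + C_Y + C_g + C_W + C_A + C_γ, and let J be the integral of D
between s and t. The goal is to bound both operators by a constant times J, with a constant that is
locally uniform in t.

The increment of W u is the time integral of (∂W) u, so a Minkowski-type inequality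
(`lintegral_weighted_le`) bounds it by J‖v‖; this is `exists_W_sub`. The same inequality bounds the
increments of A and of γ⁻¹dγ, multiplied by u, by J‖v‖ in the norm ‖·‖_t. Hence D^{A,γ}(s) u =
D^{A,γ}(t) u + Z with ‖Z‖_t² ≤ 2J²‖v‖². Young's inequality with parameter J turns the cross term
into J times the energy E of u at time t, plus a multiple of ‖v‖² that is still O(J). The metric
adds J times the g(t)-energy of D^{A,γ}(s) u. Together this gives `lintegral_dens_sub_le`.

For the potential, Fubini on the dense set `potDom` gives J‖v‖² (`pot_sub_le`). Fatou, applied to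
Ỹ(s) plus a constant, then puts all of Ran L(t)^{-1/2} into dom l_s (`lintegral_Y_le_of_dense`). So
l_t - l_s is defined on the whole range. A crude quadratic bound and polarization make it a bounded
operator, and the sharp bound passes from the dense set to all v by continuity (`exists_form_sub`).

There remains E ≤ M‖v‖². It holds for each t because Ỹ(t) is bounded below and l_t(u,u) ≤ ‖v‖², but
M depends on t and nothing uniform is assumed. If J is small, the forms l_t and l_s are comparable,
so an energy constant M at t gives 2(M+1) at s (`energyBound_near`); compactness yields one constant
on each bounded interval. The final C is D times a factor growing with |r|.

The comparison needs Ran L(t)^{-1/2} = dom l_t, with l_t(u,u) controlling ‖v‖² and conversely. This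
is the representation theorem `IsClosedForm.range_sqrt`; its input is closedness of the maximal form
(`form_closed`), obtained from Fatou and the stability of weak differentials under local L¹ limits.
-/

section

/-! ### Quadratic forms on real and complex covectors -/

section CovectorAlgebra

variable {V : Type*} [AddCommGroup V] [Module ℝ V] [TopologicalSpace V]

/-- The real quadratic form `X ↦ gⁱʲ X̄ᵢ Xⱼ` on complex covectors. -/
def covQuad (g : LinearMap.BilinForm ℝ (V →L[ℝ] ℝ)) (X : V →L[ℝ] ℂ) : ℝ :=
  g (Complex.reCLM.comp X) (Complex.reCLM.comp X) + g (Complex.imCLM.comp X) (Complex.imCLM.comp X)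

theorem reCLM_comp_add (X Z : V →L[ℝ] ℂ) :
    Complex.reCLM.comp (X + Z) = Complex.reCLM.comp X + Complex.reCLM.comp Z := by
  ext; simp

theorem imCLM_comp_add (X Z : V →L[ℝ] ℂ) :
    Complex.imCLM.comp (X + Z) = Complex.imCLM.comp X + Complex.imCLM.comp Z := by
  ext; simp

theorem reCLM_comp_smul (z : ℂ) (X : V →L[ℝ] ℂ) :
    Complex.reCLM.comp (z • X) = z.re • Complex.reCLM.comp X - z.im • Complex.imCLM.comp X := by
  ext; simp

theorem imCLM_comp_smul (z : ℂ) (X : V →L[ℝ] ℂ) :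
    Complex.imCLM.comp (z • X) = z.re • Complex.imCLM.comp X + z.im • Complex.reCLM.comp X := by
  ext; simp

theorem reCLM_comp_ofReal (ξ : V →L[ℝ] ℝ) :
    Complex.reCLM.comp (Complex.ofRealCLM.comp ξ) = ξ := by
  ext; simp

theorem imCLM_comp_ofReal (ξ : V →L[ℝ] ℝ) :
    Complex.imCLM.comp (Complex.ofRealCLM.comp ξ) = 0 := by
  ext; simp

variable {g : LinearMap.BilinForm ℝ (V →L[ℝ] ℝ)}

theorem cForm_add_left (X X' Z : V →L[ℝ] ℂ) :
    cForm g (X + X') Z = cForm g X Z + cForm g X' Z := by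
  simp only [cForm, reCLM_comp_add, imCLM_comp_add, map_add, LinearMap.add_apply]
  push_cast; ring

theorem cForm_add_right (X Z Z' : V →L[ℝ] ℂ) :
    cForm g X (Z + Z') = cForm g X Z + cForm g X Z' := by
  simp only [cForm, reCLM_comp_add, imCLM_comp_add, map_add]
  push_cast; ring

theorem cForm_smul_left (z : ℂ) (X Z : V →L[ℝ] ℂ) :
    cForm g (z • X) Z = (starRingEnd ℂ) z * cForm g X Z := by
  simp only [cForm, reCLM_comp_smul, imCLM_comp_smul, map_add, map_sub, map_smul,
    LinearMap.add_apply, LinearMap.sub_apply, LinearMap.smul_apply, smul_eq_mul]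
  apply Complex.ext <;> simp <;> ring

theorem cForm_smul_right (z : ℂ) (X Z : V →L[ℝ] ℂ) :
    cForm g X (z • Z) = z * cForm g X Z := by
  simp only [cForm, reCLM_comp_smul, imCLM_comp_smul, map_add, map_sub, map_smul,
    smul_eq_mul]
  apply Complex.ext <;> simp <;> ring

theorem cForm_re (X Z : V →L[ℝ] ℂ) : (cForm g X Z).re =
    g (Complex.reCLM.comp X) (Complex.reCLM.comp Z)
      + g (Complex.imCLM.comp X) (Complex.imCLM.comp Z) := by
  simp [cForm]

theorem cForm_im (X Z : V →L[ℝ] ℂ) : (cForm g X Z).im =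
    g (Complex.reCLM.comp X) (Complex.imCLM.comp Z)
      - g (Complex.imCLM.comp X) (Complex.reCLM.comp Z) := by
  simp [cForm]

theorem cForm_conj (hs : ∀ ξ η, g ξ η = g η ξ) (X Z : V →L[ℝ] ℂ) :
    (starRingEnd ℂ) (cForm g X Z) = cForm g Z X := by
  apply Complex.ext
  · rw [Complex.conj_re, cForm_re, cForm_re, hs, hs (Complex.imCLM.comp X)]
  · rw [Complex.conj_im, cForm_im, cForm_im, hs, hs (Complex.imCLM.comp X)]; ring

theorem cForm_self (hs : ∀ ξ η, g ξ η = g η ξ) (X : V →L[ℝ] ℂ) :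
    cForm g X X = (covQuad g X : ℂ) := by
  apply Complex.ext
  · rw [cForm_re, Complex.ofReal_re, covQuad]
  · rw [cForm_im, Complex.ofReal_im, hs, sub_self]

theorem cForm_self_re (X : V →L[ℝ] ℂ) : (cForm g X X).re = covQuad g X := cForm_re X X

theorem covQuad_nonneg (hp : ∀ ξ, 0 ≤ g ξ ξ) (X : V →L[ℝ] ℂ) : 0 ≤ covQuad g X :=
  add_nonneg (hp _) (hp _)

/-- Expand the positivity of b at r ξ + η and at r ξ - η, then divide by r. The weight r stays free
because it is later chosen as a time integral, or as a quotient of one by a rate. -/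
theorem two_mul_abs_bilin_le {W : Type*} [AddCommGroup W] [Module ℝ W]
    {b : LinearMap.BilinForm ℝ W} (hs : ∀ ξ η, b ξ η = b η ξ) (hp : ∀ ξ, 0 ≤ b ξ ξ)
    {r : ℝ} (hr : 0 < r) (ξ η : W) :
    2 * |b ξ η| ≤ r * b ξ ξ + r⁻¹ * b η η := by
  have h1 := hp (r • ξ + η)
  have h2 := hp (r • ξ - η)
  simp only [map_add, map_sub, map_smul, LinearMap.add_apply, LinearMap.sub_apply,
    LinearMap.smul_apply, smul_eq_mul, hs η ξ] at h1 h2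
  have key : r * (2 * |b ξ η|) ≤ r * (r * b ξ ξ + r⁻¹ * b η η) := by
    rw [mul_add, ← mul_assoc r r⁻¹, mul_inv_cancel₀ hr.ne', one_mul]
    rcases abs_cases (b ξ η) with ⟨h, _⟩ | ⟨h, _⟩ <;> rw [h] <;> linarith
  exact le_of_mul_le_mul_left key hr

theorem norm_cForm_le (hs : ∀ ξ η, g ξ η = g η ξ) (hp : ∀ ξ, 0 ≤ g ξ ξ) (X Z : V →L[ℝ] ℂ) :
    ‖cForm g X Z‖ ≤ covQuad g X + covQuad g Z := by
  refine (Complex.norm_le_abs_re_add_abs_im _).trans ?_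
  rw [cForm_re, cForm_im]
  have h := fun ξ η => two_mul_abs_bilin_le hs hp one_pos ξ η
  have h1 := h (Complex.reCLM.comp X) (Complex.reCLM.comp Z)
  have h2 := h (Complex.imCLM.comp X) (Complex.imCLM.comp Z)
  have h3 := h (Complex.reCLM.comp X) (Complex.imCLM.comp Z)
  have h4 := h (Complex.imCLM.comp X) (Complex.reCLM.comp Z)
  have h5 := abs_add_le (g (Complex.reCLM.comp X) (Complex.reCLM.comp Z))
    (g (Complex.imCLM.comp X) (Complex.imCLM.comp Z))
  have h6 := abs_sub (g (Complex.reCLM.comp X) (Complex.imCLM.comp Z))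
    (g (Complex.imCLM.comp X) (Complex.reCLM.comp Z))
  simp only [covQuad]
  simp only [inv_one, one_mul] at h1 h2 h3 h4
  linarith

theorem covQuad_add (hs : ∀ ξ η, g ξ η = g η ξ) (X Z : V →L[ℝ] ℂ) :
    covQuad g (X + Z) = covQuad g X + 2 * (cForm g X Z).re + covQuad g Z := by
  rw [← cForm_self_re, cForm_add_left, cForm_add_right, cForm_add_right, Complex.add_re,
    Complex.add_re, Complex.add_re, cForm_self_re, cForm_self_re, ← cForm_conj hs X Z,
    Complex.conj_re]
  ring

theorem covQuad_smul (hs : ∀ ξ η, g ξ η = g η ξ) (z : ℂ) (X : V →L[ℝ] ℂ) :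
    covQuad g (z • X) = ‖z‖ ^ 2 * covQuad g X := by
  have h := cForm_self hs (z • X)
  rw [cForm_smul_left, cForm_smul_right, cForm_self hs, ← mul_assoc, Complex.conj_mul'] at h
  exact_mod_cast h.symm

/-- Only the cross term 2 Re⟨X, Z⟩ involves X; Young's inequality charges the small weight r to X
and the large weight 1/r to Z. -/
theorem abs_covQuad_add_sub_le (hs : ∀ ξ η, g ξ η = g η ξ) (hp : ∀ ξ, 0 ≤ g ξ ξ)
    {r : ℝ} (hr : 0 < r) (X Z : V →L[ℝ] ℂ) :
    |covQuad g (X + Z) - covQuad g X| ≤ r * covQuad g X + (1 + r⁻¹) * covQuad g Z := by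
  rw [covQuad_add hs, cForm_re]
  have h1 := two_mul_abs_bilin_le hs hp hr (Complex.reCLM.comp X) (Complex.reCLM.comp Z)
  have h2 := two_mul_abs_bilin_le hs hp hr (Complex.imCLM.comp X) (Complex.imCLM.comp Z)
  have h3 := covQuad_nonneg hp Z
  rw [abs_le]
  simp only [covQuad] at *
  have h4 := abs_le.1 (le_refl |g (Complex.reCLM.comp X) (Complex.reCLM.comp Z)|)
  have h5 := abs_le.1 (le_refl |g (Complex.imCLM.comp X) (Complex.imCLM.comp Z)|)
  constructor <;> linarith

theorem covQuad_add_le (hs : ∀ ξ η, g ξ η = g η ξ) (hp : ∀ ξ, 0 ≤ g ξ ξ) (X Z : V →L[ℝ] ℂ) :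
    covQuad g (X + Z) ≤ 2 * covQuad g X + 2 * covQuad g Z := by
  have h := (abs_le.1 (abs_covQuad_add_sub_le hs hp one_pos X Z)).2
  norm_num at h
  linarith

/-- Once z is factored out, ξ is the real part and η/2 the imaginary part of the covector, so no
cross term appears. -/
theorem covQuad_ofReal_add (hs : ∀ ξ η, g ξ η = g η ξ) (z : ℂ) (ξ η : V →L[ℝ] ℝ) :
    covQuad g (z • Complex.ofRealCLM.comp ξ + (Complex.I / 2 * z) • Complex.ofRealCLM.comp η)
      = ‖z‖ ^ 2 * (g ξ ξ + 1 / 4 * g η η) := by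
  have : z • Complex.ofRealCLM.comp ξ + (Complex.I / 2 * z) • Complex.ofRealCLM.comp η
      = z • (Complex.ofRealCLM.comp ξ + (Complex.I / 2) • Complex.ofRealCLM.comp η) := by
    rw [smul_add, smul_smul, mul_comm z]
  rw [this, covQuad_smul hs]
  congr 1
  simp only [covQuad, reCLM_comp_add, imCLM_comp_add, reCLM_comp_smul, imCLM_comp_smul,
    reCLM_comp_ofReal, imCLM_comp_ofReal]
  simp
  ring

theorem covQuad_smul_ofReal (hs : ∀ ξ η, g ξ η = g η ξ) (z : ℂ) (ξ : V →L[ℝ] ℝ) :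
    covQuad g (z • Complex.ofRealCLM.comp ξ) = ‖z‖ ^ 2 * g ξ ξ := by
  rw [covQuad_smul hs]
  simp [covQuad, reCLM_comp_ofReal, imCLM_comp_ofReal]

end CovectorAlgebra

/-! ### Bounded sesquilinear forms and the operators representing them -/

section HilbertForms

variable {H : Type*} [NormedAddCommGroup H] [InnerProductSpace ℂ H]

/-- A sesquilinear form whose quadratic form is bounded by `M` is bounded by `2 * M`. -/
theorem norm_sesq_le_of_quad {b : H → H → ℂ} {M : ℝ}
    (hal : ∀ u v w, b (u + v) w = b u w + b v w) (har : ∀ u v w, b u (v + w) = b u v + b u w)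
    (hsl : ∀ (z : ℂ) v w, b (z • v) w = (starRingEnd ℂ) z * b v w)
    (hsr : ∀ (z : ℂ) v w, b v (z • w) = z * b v w)
    (hM : ∀ v, ‖b v v‖ ≤ M * ‖v‖ ^ 2) (v w : H) : ‖b v w‖ ≤ 2 * M * ‖v‖ * ‖w‖ := by
  have key : ∀ v w, ‖b v w‖ ≤ M * (‖v‖ ^ 2 + ‖w‖ ^ 2) := by
    intro v w
    -- Polarization. Hermitian symmetry of b is not available here, so all four terms are estimated
    -- separately and the parallelogram law recombines them.
    have pol : 4 * b v w = b (v + w) (v + w) - b (v + (-1 : ℂ) • w) (v + (-1 : ℂ) • w)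
        - Complex.I * b (v + Complex.I • w) (v + Complex.I • w)
        + Complex.I * b (v + (-Complex.I) • w) (v + (-Complex.I) • w) := by
      simp only [hal, har, hsl, hsr, map_neg, Complex.conj_I, map_one]
      linear_combination (2 * b v w) * Complex.I_sq - (2 * b w v) * Complex.I_sq
    have h1 := hM (v + w)
    have h2 := hM (v + (-1 : ℂ) • w)
    have h3 := hM (v + Complex.I • w)
    have h4 := hM (v + (-Complex.I) • w)
    have p1 := parallelogram_law_with_norm ℂ v w
    have p2 := parallelogram_law_with_norm ℂ v (Complex.I • w)
    have e1 : v + (-1 : ℂ) • w = v - w := by simp [sub_eq_add_neg]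
    have e2 : v + (-Complex.I) • w = v - Complex.I • w := by simp [sub_eq_add_neg]
    have e3 : ‖Complex.I • w‖ = ‖w‖ := by simp [norm_smul]
    rw [e3] at p2
    have h : ‖4 * b v w‖ ≤ ‖b (v + w) (v + w)‖ + ‖b (v + (-1 : ℂ) • w) (v + (-1 : ℂ) • w)‖
        + ‖b (v + Complex.I • w) (v + Complex.I • w)‖
        + ‖b (v + (-Complex.I) • w) (v + (-Complex.I) • w)‖ := by
      rw [pol]
      refine (norm_add_le _ _).trans (add_le_add ((norm_sub_le _ _).trans
        (add_le_add (norm_sub_le _ _) ?_)) ?_) <;> simp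
    rw [norm_mul, e1, e2, show ‖(4 : ℂ)‖ = 4 by norm_num] at h
    rw [e1] at h2
    rw [e2] at h4
    have : 4 * ‖b v w‖ ≤ M * (4 * (‖v‖ ^ 2 + ‖w‖ ^ 2)) := by
      have : M * (4 * (‖v‖ ^ 2 + ‖w‖ ^ 2)) = M * ‖v + w‖ ^ 2 + M * ‖v - w‖ ^ 2
        + M * ‖v + Complex.I • w‖ ^ 2 + M * ‖v - Complex.I • w‖ ^ 2 := by
        linear_combination (-M) * p1 + (-M) * p2
      linarith
    linarith
  rcases eq_or_ne v 0 with rfl | hv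
  · have h0 : b 0 w = 0 := by simpa using hsl 0 0 w
    simp [h0]
  rcases eq_or_ne w 0 with rfl | hw
  · have h0 : b v 0 = 0 := by simpa using hsr 0 v 0
    simp [h0]
  have hv' := norm_pos_iff.2 hv
  have hw' := norm_pos_iff.2 hw
  -- Rescaling both arguments to the common norm ‖v‖‖w‖ turns the sum of squares into the product.
  have h := key (((‖w‖ : ℝ) : ℂ) • v) (((‖v‖ : ℝ) : ℂ) • w)
  rw [hsl, hsr, norm_mul, norm_mul, norm_smul, norm_smul] at h
  simp only [RCLike.norm_conj, Complex.norm_real, norm_norm] at h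
  have : (‖w‖ * ‖v‖) * ‖b v w‖ ≤ (‖w‖ * ‖v‖) * (2 * M * ‖v‖ * ‖w‖) := by
    nlinarith
  exact le_of_mul_le_mul_left this (by positivity)

theorem exists_clm_of_quad [CompleteSpace H] {b : H → H → ℂ} {M : ℝ}
    (hal : ∀ u v w, b (u + v) w = b u w + b v w) (har : ∀ u v w, b u (v + w) = b u v + b u w)
    (hsl : ∀ (z : ℂ) v w, b (z • v) w = (starRingEnd ℂ) z * b v w)
    (hsr : ∀ (z : ℂ) v w, b v (z • w) = z * b v w)
    (hM : ∀ v, ‖b v v‖ ≤ M * ‖v‖ ^ 2) :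
    ∃ T : H →L[ℂ] H, ∀ v w, inner ℂ v (T w) = b v w := by
  let f : H →ₗ⋆[ℂ] H →ₗ[ℂ] ℂ := LinearMap.mk₂'ₛₗ (starRingEnd ℂ) (RingHom.id ℂ) b hal
    (by simpa using hsl) har (by simpa using hsr)
  let F := LinearMap.mkContinuous₂ f (2 * M)
    (fun v w => norm_sesq_le_of_quad hal har hsl hsr hM v w)
  -- The Riesz operator of F acts on the first argument of the inner product; its adjoint acts on
  -- the second.
  refine ⟨(InnerProductSpace.continuousLinearMapOfBilin F).adjoint, fun v w => ?_⟩
  rw [ContinuousLinearMap.adjoint_inner_right,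
    InnerProductSpace.continuousLinearMapOfBilin_apply]
  rfl

theorem opNorm_le_of_quad {T : H →L[ℂ] H} {M : ℝ} (hM0 : 0 ≤ M)
    (hM : ∀ v, ‖inner ℂ v (T v)‖ ≤ M * ‖v‖ ^ 2) : ‖T‖ ≤ 2 * M := by
  refine T.opNorm_le_bound (by positivity) fun w => ?_
  have h := norm_sesq_le_of_quad (b := fun v w => inner ℂ v (T w)) (M := M)
    (by simp) (by simp) (by simp [mul_comm]) (by simp) hM (T w) w
  rcases eq_or_ne (T w) 0 with h0 | h0
  · rw [h0, norm_zero]; positivity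
  have h' := norm_pos_iff.2 h0
  simp only [inner_self_eq_norm_sq_to_K] at h
  have h2 : ‖T w‖ * ‖T w‖ ≤ ‖T w‖ * (2 * M * ‖w‖) := by
    have : ‖((‖T w‖ : ℂ)) ^ 2‖ = ‖T w‖ * ‖T w‖ := by
      rw [norm_pow, Complex.norm_real, norm_norm, sq]
    calc _ = _ := this.symm
      _ ≤ _ := h
      _ = _ := by ring
  exact le_of_mul_le_mul_left h2 h'

end HilbertForms

end

section

/-! ### Closed semibounded forms and the range of the square root -/

section ClosedForms

variable {H : Type*} [NormedAddCommGroup H] [InnerProductSpace ℂ H]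

/-- `l` is a hermitian sesquilinear form on `D`, bounded from below by `-K` and closed. -/
structure IsClosedForm (D : Submodule ℂ H) (l : H → H → ℂ) (K : ℝ) : Prop where
  add_right : ∀ u ∈ D, ∀ v ∈ D, ∀ w ∈ D, l u (v + w) = l u v + l u w
  smul_right : ∀ z : ℂ, ∀ u ∈ D, ∀ v ∈ D, l u (z • v) = z * l u v
  conj_symm : ∀ u v, (starRingEnd ℂ) (l u v) = l v u
  lower_nonneg : 0 ≤ K
  lower : ∀ u ∈ D, 0 ≤ (l u u).re + K * ‖u‖ ^ 2
  -- Closedness and lower semicontinuity in one clause: the limit of a form-Cauchy sequence stays in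
  -- the domain and inherits every asymptotic upper bound for the form.
  closed : ∀ (u : ℕ → H) (u' : H) (C : ℝ), (∀ k, u k ∈ D) →
    Filter.Tendsto u Filter.atTop (nhds u') →
    (∀ ε > 0, ∃ N, ∀ j ≥ N, ∀ k ≥ N, (l (u j - u k) (u j - u k)).re ≤ ε) →
    (∀ ε > 0, ∃ N, ∀ k ≥ N, (l (u k) (u k)).re ≤ C + ε) → u' ∈ D ∧ (l u' u').re ≤ C

namespace IsClosedForm

variable {D : Submodule ℂ H} {l : H → H → ℂ} {K : ℝ} (h : IsClosedForm D l K)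
include h

theorem add_left {u v w : H} (hu : u ∈ D) (hv : v ∈ D) (hw : w ∈ D) :
    l (u + v) w = l u w + l v w := by
  rw [← h.conj_symm, h.add_right w hw u hu v hv, map_add, h.conj_symm, h.conj_symm]

theorem smul_left (z : ℂ) {u v : H} (hu : u ∈ D) (hv : v ∈ D) :
    l (z • u) v = (starRingEnd ℂ) z * l u v := by
  rw [← h.conj_symm, h.smul_right z v hv u hu, map_mul, h.conj_symm]

theorem sub_right {u v w : H} (hu : u ∈ D) (hv : v ∈ D) (hw : w ∈ D) :
    l u (v - w) = l u v - l u w := by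
  rw [sub_eq_add_neg, ← neg_one_smul ℂ w, h.add_right u hu v hv _ (D.smul_mem _ hw),
    h.smul_right _ u hu w hw]
  ring

theorem sub_left {u v w : H} (hu : u ∈ D) (hv : v ∈ D) (hw : w ∈ D) :
    l (u - v) w = l u w - l v w := by
  rw [← h.conj_symm, h.sub_right hw hu hv, map_sub, h.conj_symm, h.conj_symm]

/-- Cauchy–Schwarz for the non-negative form l + K⟨·,·⟩, which makes D a pre-inner-product space. -/
theorem norm_sq_le {u v : H} (hu : u ∈ D) (hv : v ∈ D) :
    ‖l u v + K * inner ℂ u v‖ ^ 2 ≤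
      ((l u u).re + K * ‖u‖ ^ 2) * ((l v v).re + K * ‖v‖ ^ 2) := by
  let core : PreInnerProductSpace.Core ℂ D :=
    { inner := fun x y => l x y + K * inner ℂ (x : H) (y : H)
      conj_inner_symm := fun x y => by
        simp [h.conj_symm]
      re_inner_nonneg := fun x => by
        have := h.lower x x.2
        rw [inner_self_eq_norm_sq_to_K]
        simpa [← Complex.ofReal_pow, ← Complex.ofReal_mul] using this
      add_left := fun x y z => by
        simp only [Submodule.coe_add, h.add_left x.2 y.2 z.2, inner_add_left]; ring
      smul_left := fun x y r => by
        simp only [Submodule.coe_smul, h.smul_left r x.2 y.2, inner_smul_left]; ring }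
  have hself : ∀ x : D, (l x x + K * inner ℂ (x : H) (x : H)).re
      = (l x x).re + K * ‖(x : H)‖ ^ 2 := fun x => by
    rw [inner_self_eq_norm_sq_to_K]
    simp [← Complex.ofReal_pow, ← Complex.ofReal_mul]
  have key := @InnerProductSpace.Core.inner_mul_inner_self_le ℂ D _ _ _ core ⟨u, hu⟩ ⟨v, hv⟩
  change ‖l u v + K * inner ℂ u v‖ * ‖l v u + K * inner ℂ v u‖
    ≤ (l u u + K * inner ℂ u u).re * (l v v + K * inner ℂ v v).re at key
  have e : ‖l v u + K * inner ℂ v u‖ = ‖l u v + K * inner ℂ u v‖ := by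
    rw [← Complex.norm_conj]
    simp [h.conj_symm]
  rw [e, hself ⟨u, hu⟩, hself ⟨v, hv⟩] at key
  rw [sq]; exact key

end IsClosedForm

/-- The bound makes S f ↦ ⟨u, f⟩ a bounded functional on Ran S. Extend it by Hahn–Banach and
represent it by a vector v; symmetry of S gives S v = u. Since S may have a kernel, v is finally
projected to the closure of Ran S, which leaves S v unchanged. -/
theorem exists_eq_of_abs_inner_le [CompleteSpace H] {S : H →L[ℂ] H}
    (hS : ∀ x y, inner ℂ (S x) y = inner ℂ x (S y)) {u : H} {C : ℝ}
    (hC : ∀ f, ‖inner ℂ u f‖ ≤ C * ‖S f‖) :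
    ∃ v ∈ S.range.topologicalClosure, S v = u := by
  obtain ⟨σ, hσ⟩ := S.toLinearMap.rangeRestrict.exists_rightInverse_of_surjective
    (LinearMap.range_rangeRestrict _)
  have hσ' : ∀ y, S (σ y) = y := fun y => by
    have := congrArg (Subtype.val) (LinearMap.congr_fun hσ y)
    simpa using this
  let φ₀ : S.toLinearMap.range →ₗ[ℂ] ℂ := (innerₛₗ ℂ u).comp σ
  let φ : S.toLinearMap.range →L[ℂ] ℂ := φ₀.mkContinuous C (fun y => by
    have := hC (σ y)
    rw [hσ'] at this
    simpa [φ₀] using this)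
  obtain ⟨ψ, hψ, -⟩ := exists_extension_norm_eq S.toLinearMap.range φ
  set v := (InnerProductSpace.toDual ℂ H).symm ψ
  have hv : ∀ f, inner ℂ v (S f) = inner ℂ u f := by
    intro f
    rw [InnerProductSpace.toDual_symm_apply]
    have h1 := hψ ⟨S f, f, rfl⟩
    have h2 : φ ⟨S f, f, rfl⟩ = inner ℂ u (σ ⟨S f, f, rfl⟩) := rfl
    rw [h1, h2]
    -- This difference lies in ker S, so the bound forces its pairing with u to vanish: the
    -- functional does not depend on the chosen preimage.
    have h3 := hC (f - σ ⟨S f, f, rfl⟩)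
    rw [map_sub, hσ', sub_self, norm_zero, mul_zero, inner_sub_right] at h3
    exact (sub_eq_zero.1 (norm_le_zero_iff.1 h3)).symm
  have : CompleteSpace S.range.topologicalClosure :=
    S.range.isClosed_topologicalClosure.completeSpace_coe
  obtain ⟨y, hy, z, hz, hyz⟩ := S.range.topologicalClosure.exists_add_mem_mem_orthogonal v
  refine ⟨y, hy, ext_inner_right ℂ fun f => ?_⟩
  rw [hS, ← hv f, hyz, inner_add_left, left_eq_add]
  exact (Submodule.mem_orthogonal' _ _).1 hz _ (S.range.le_topologicalClosure ⟨f, rfl⟩)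

/-- The range of the square root of the inverse of the operator defined by a closed form is the
form domain. -/
theorem IsClosedForm.range_sqrt [CompleteSpace H] {D : Submodule ℂ H} {l : H → H → ℂ} {K : ℝ}
    (h : IsClosedForm D l K) {S : H →L[ℂ] H}
    (hS : ∀ x y, inner ℂ (S x) y = inner ℂ x (S y)) (hD : ∀ f, S (S f) ∈ D)
    (hl : ∀ f, ∀ u ∈ D, inner ℂ u f = l u (S (S f))) :
    (∀ v, S v ∈ D ∧ (l (S v) (S v)).re ≤ ‖v‖ ^ 2) ∧
    ∀ u ∈ D, ∃ v, S v = u ∧ ‖v‖ ^ 2 ≤ (l u u).re := by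
  have hq : ∀ f, (l (S (S f)) (S (S f))).re = ‖S f‖ ^ 2 := fun f => by
    rw [← hl f _ (hD f), hS, inner_self_eq_norm_sq_to_K]
    simp [← Complex.ofReal_pow]
  have hseq : ∀ v ∈ S.range.topologicalClosure, ∃ w : ℕ → H,
      Filter.Tendsto (fun k => S (w k)) Filter.atTop (nhds v) := by
    intro v hv
    obtain ⟨x, hx, hxv⟩ := mem_closure_iff_seq_limit.1 hv
    choose w hw using hx
    exact ⟨w, by simpa [show (fun k => S (w k)) = x from funext hw] using hxv⟩
  have hdiff : ∀ f f', S (S f) - S (S f') = S (S (f - f')) := fun f f' => by simp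
  have hrange : ∀ v, S v ∈ D ∧ (l (S v) (S v)).re ≤ ‖v‖ ^ 2 := by
    intro v
    have : CompleteSpace S.range.topologicalClosure :=
      S.range.isClosed_topologicalClosure.completeSpace_coe
    -- The orthogonal complement of Ran S is ker S, so v may be replaced by its component y in the
    -- closure of Ran S. There y = lim S w_k, and the vectors S S w_k lie in D with form values ‖S
    -- w_k‖².
    obtain ⟨y, hy, z, hz, hyz⟩ := S.range.topologicalClosure.exists_add_mem_mem_orthogonal v
    have hzS : S z = 0 := by
      refine ext_inner_right ℂ fun f => ?_
      rw [hS, inner_zero_left]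
      exact (Submodule.mem_orthogonal' _ _).1 hz _ (S.range.le_topologicalClosure ⟨f, rfl⟩)
    have hSv : S v = S y := by rw [hyz, map_add, hzS, add_zero]
    have hyv : ‖y‖ ^ 2 ≤ ‖v‖ ^ 2 := by
      have := norm_add_sq_eq_norm_sq_add_norm_sq_of_inner_eq_zero (𝕜 := ℂ) y z
        ((Submodule.mem_orthogonal _ _).1 hz _ hy)
      rw [hyz, sq, sq, this]
      nlinarith [norm_nonneg z]
    obtain ⟨w, hw⟩ := hseq y hy
    rw [hSv]
    refine h.closed (fun k => S (S (w k))) (S y) _ (fun k => hD _)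
      ((S.continuous.tendsto y).comp hw) (fun ε hε => ?_) (fun ε hε => ?_)
    · obtain ⟨N, hN⟩ := Metric.cauchySeq_iff.1 hw.cauchySeq (Real.sqrt ε) (Real.sqrt_pos.2 hε)
      refine ⟨N, fun j hj k hk => ?_⟩
      have h1 := hN j hj k hk
      rw [dist_eq_norm, ← map_sub] at h1
      rw [hdiff, hq]
      calc ‖S (w j - w k)‖ ^ 2 ≤ (Real.sqrt ε) ^ 2 := by gcongr
        _ = ε := Real.sq_sqrt hε.le
    · have h2 : Filter.Tendsto (fun k => ‖S (w k)‖ ^ 2) Filter.atTop (nhds (‖y‖ ^ 2)) :=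
        hw.norm.pow 2
      obtain ⟨N, hN⟩ := Filter.eventually_atTop.1
        (h2.eventually (Iio_mem_nhds (show ‖y‖ ^ 2 < ‖v‖ ^ 2 + ε by linarith)))
      exact ⟨N, fun k hk => by rw [hq]; exact (hN k hk).le⟩
  refine ⟨hrange, fun u hu => ?_⟩
  -- For u in D one has ⟨u, f⟩ = l(u, S S f). Cauchy–Schwarz for l + K and l(S S f, S S f) = ‖S f‖²
  -- bound this by a multiple of ‖S f‖, which is the criterion for u to lie in Ran S.
  have hbound : ∀ f, ‖inner ℂ u f‖ ≤
      (Real.sqrt (((l u u).re + K * ‖u‖ ^ 2) * (1 + K * ‖S‖ ^ 2)) + K * ‖S u‖) * ‖S f‖ := by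
    intro f
    have h1 := h.norm_sq_le hu (hD f)
    rw [← hl f u hu, hq] at h1
    have h3 := h.lower u hu
    have h4 : ‖S (S f)‖ ≤ ‖S‖ * ‖S f‖ := S.le_opNorm _
    have hK := h.lower_nonneg
    have h5 : ‖inner ℂ u f + K * inner ℂ u (S (S f))‖ ≤
        Real.sqrt (((l u u).re + K * ‖u‖ ^ 2) * (1 + K * ‖S‖ ^ 2)) * ‖S f‖ := by
      apply le_of_sq_le_sq _ (by positivity)
      rw [mul_pow, Real.sq_sqrt (by positivity)]
      refine h1.trans ?_
      rw [mul_assoc]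
      gcongr
      have : K * ‖S (S f)‖ ^ 2 ≤ K * (‖S‖ * ‖S f‖) ^ 2 := by gcongr
      nlinarith
    have h6 : ‖(K : ℂ) * inner ℂ u (S (S f))‖ ≤ K * ‖S u‖ * ‖S f‖ := by
      rw [norm_mul, ← hS, Complex.norm_real, Real.norm_of_nonneg hK, mul_assoc]
      gcongr
      exact norm_inner_le_norm _ _
    calc ‖inner ℂ u f‖ = ‖(inner ℂ u f + K * inner ℂ u (S (S f)))
          - K * inner ℂ u (S (S f))‖ := by rw [add_sub_cancel_right]
      _ ≤ _ := norm_sub_le _ _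
      _ ≤ _ := by rw [add_mul]; exact add_le_add h5 h6
  obtain ⟨v, hv, hvu⟩ := exists_eq_of_abs_inner_le hS hbound
  refine ⟨v, hvu, ?_⟩
  obtain ⟨w, hw⟩ := hseq v hv
  -- Expansion of 0 ≤ (l + K) evaluated at u - S S w_k. As S w_k → v, the left side tends to ‖v‖².
  have hlow : ∀ k, 2 * (inner ℂ v (S (w k))).re - ‖S (w k)‖ ^ 2 - K * ‖S v - S (S (w k))‖ ^ 2
      ≤ (l u u).re := by
    intro k
    have h1 := h.lower _ (D.sub_mem hu (hD (w k)))
    rw [h.sub_left hu (hD _) (D.sub_mem hu (hD _)), h.sub_right hu hu (hD _),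
      h.sub_right (hD _) hu (hD _), ← h.conj_symm u (S (S (w k))), ← hl (w k) u hu] at h1
    simp only [Complex.sub_re, Complex.conj_re, hq] at h1
    rw [← hvu, hS] at h1
    rw [hvu] at h1 ⊢
    linarith
  have hlim : Filter.Tendsto (fun k => 2 * (inner ℂ v (S (w k))).re - ‖S (w k)‖ ^ 2
      - K * ‖S v - S (S (w k))‖ ^ 2) Filter.atTop
      (nhds (2 * (inner ℂ v v : ℂ).re - ‖v‖ ^ 2 - K * ‖S v - S v‖ ^ 2)) := by
    have h1 : Filter.Tendsto (fun k => S (S (w k))) Filter.atTop (nhds (S v)) :=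
      (S.continuous.tendsto v).comp hw
    have h2 : Filter.Tendsto (fun k => (inner ℂ v (S (w k)) : ℂ).re) Filter.atTop
        (nhds (inner ℂ v v : ℂ).re) :=
      (Complex.continuous_re.tendsto _).comp (tendsto_const_nhds.inner hw)
    exact ((h2.const_mul 2).sub (hw.norm.pow 2)).sub
      (((tendsto_const_nhds.sub h1).norm.pow 2).const_mul K)
  have := le_of_tendsto hlim (Filter.Eventually.of_forall hlow)
  rw [inner_self_eq_norm_sq_to_K] at this
  simp [← Complex.ofReal_pow] at this
  linarith

end ClosedForms

end

section

/-! ### Coordinate frames in a chart -/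

section ChartFrames

variable {n : ℕ} {S : Type*} [TopologicalSpace S] [ChartedSpace (Spc n) S]
  [IsManifold 𝓘(ℝ, Spc n) ∞ S] {F : Type*} [NormedAddCommGroup F] [NormedSpace ℝ F]
  {e : OpenPartialHomeomorph S (Spc n)}

/-- The standard basis vectors of the model space. -/
def stdVec (i : Fin n) : Spc n := EuclideanSpace.single i 1

theorem clm_eq_sum_stdVec {G : Type*} [AddCommMonoid G] [Module ℝ G] [TopologicalSpace G]
    (L : Spc n →L[ℝ] G) (v : Spc n) :
    L v = ∑ i, (EuclideanSpace.proj i : Spc n →L[ℝ] ℝ) v • L (stdVec i) := by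
  have hv : v = ∑ i, (EuclideanSpace.proj i : Spc n →L[ℝ] ℝ) v • stdVec i := by
    ext j
    simp [stdVec, Finset.sum_apply, Pi.single_apply]
  conv_lhs => rw [hv]
  simp only [map_sum, map_smul]

theorem mfderiv_symm_mfderiv (he : e ∈ atlas (Spc n) S) {y : Spc n} (hy : y ∈ e.target)
    (w : TangentSpace 𝓘(ℝ, Spc n) (e.symm y)) :
    mfderiv 𝓘(ℝ, Spc n) 𝓘(ℝ, Spc n) e.symm y (mfderiv 𝓘(ℝ, Spc n) 𝓘(ℝ, Spc n) e (e.symm y) w)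
      = w := by
  have : IsManifold 𝓘(ℝ, Spc n) 1 S := IsManifold.of_le (n := ∞) (by norm_num)
  have h := (mdifferentiable_of_mem_atlas (I := 𝓘(ℝ, Spc n)) he).symm_comp_deriv
    (e.map_target hy)
  rw [e.right_inv hy] at h
  exact DFunLike.congr_fun h w

theorem form_apply_eq_sum (he : e ∈ atlas (Spc n) S) {y : Spc n} (hy : y ∈ e.target)
    (τ : OneForm n S F) (w : TangentSpace 𝓘(ℝ, Spc n) (e.symm y)) :
    τ (e.symm y) w = ∑ i, (coordCovector e (EuclideanSpace.proj i) (e.symm y) w) •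
      formComp e τ (stdVec i) y := by
  conv_lhs => rw [← mfderiv_symm_mfderiv he hy w]
  exact clm_eq_sum_stdVec (G := F)
    ((τ (e.symm y)).comp (mfderiv 𝓘(ℝ, Spc n) 𝓘(ℝ, Spc n) e.symm y))
    (mfderiv 𝓘(ℝ, Spc n) 𝓘(ℝ, Spc n) e (e.symm y) w)

theorem covector_eq_sum (he : e ∈ atlas (Spc n) S) {y : Spc n} (hy : y ∈ e.target)
    (ξ : TangentSpace 𝓘(ℝ, Spc n) (e.symm y) →L[ℝ] ℝ) :
    ξ = ∑ i, ξ (mfderiv 𝓘(ℝ, Spc n) 𝓘(ℝ, Spc n) e.symm y (stdVec i)) •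
      coordCovector e (EuclideanSpace.proj i) (e.symm y) := by
  ext w
  conv_lhs => rw [← mfderiv_symm_mfderiv he hy w]
  rw [sum_apply]
  refine (clm_eq_sum_stdVec (G := ℝ)
    (ξ.comp (mfderiv 𝓘(ℝ, Spc n) 𝓘(ℝ, Spc n) e.symm y))
    (mfderiv 𝓘(ℝ, Spc n) 𝓘(ℝ, Spc n) e (e.symm y) w)).trans ?_
  refine Finset.sum_congr rfl fun i _ => ?_
  rw [smul_apply, smul_eq_mul, smul_eq_mul, mul_comm]
  rfl

/-- Expansion in the coordinate frame reduces measurability and time integration of a contraction to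
those of finitely many components. -/
theorem comet_apply_eq_sum (he : e ∈ atlas (Spc n) S) {y : Spc n} (hy : y ∈ e.target)
    (g : CoMetric n S) (ξ ζ : TangentSpace 𝓘(ℝ, Spc n) (e.symm y) →L[ℝ] ℝ) :
    g (e.symm y) ξ ζ = ∑ i, ∑ j,
      ξ (mfderiv 𝓘(ℝ, Spc n) 𝓘(ℝ, Spc n) e.symm y (stdVec i)) *
      ζ (mfderiv 𝓘(ℝ, Spc n) 𝓘(ℝ, Spc n) e.symm y (stdVec j)) *
      metComp e g (EuclideanSpace.proj i) (EuclideanSpace.proj j) y := by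
  conv_lhs => rw [covector_eq_sum he hy ξ, covector_eq_sum he hy ζ]
  simp only [map_sum, map_smul, LinearMap.sum_apply, LinearMap.smul_apply, smul_eq_mul]
  simp only [Finset.mul_sum]
  rw [Finset.sum_comm]
  refine Finset.sum_congr rfl fun i _ => Finset.sum_congr rfl fun j _ => ?_
  rw [metComp]; ring

theorem vec_apply_eq_sum (he : e ∈ atlas (Spc n) S) {y : Spc n} (hy : y ∈ e.target)
    (τ : OneForm n S F) (β : VecField n S) :
    τ (e.symm y) (β (e.symm y)) = ∑ i, vecComp e β (EuclideanSpace.proj i) y •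
      formComp e τ (stdVec i) y :=
  form_apply_eq_sum he hy τ _

end ChartFrames

/-! ### Null sets and measurability in charts -/

section ChartMeasure

variable {n : ℕ} {S : Type*} [TopologicalSpace S] [ChartedSpace (Spc n) S]
  [MeasurableSpace S] [BorelSpace S] {μ : Measure S} {e : OpenPartialHomeomorph S (Spc n)}

theorem measurableSet_source (e : OpenPartialHomeomorph S (Spc n)) : MeasurableSet e.source :=
  e.open_source.measurableSet

theorem measurableSet_target (e : OpenPartialHomeomorph S (Spc n)) : MeasurableSet e.target :=
  e.open_target.measurableSet

theorem aemeasurable_chart (e : OpenPartialHomeomorph S (Spc n)) (μ : Measure S) :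
    AEMeasurable e (μ.restrict e.source) :=
  e.continuousOn.aemeasurable (measurableSet_source e)

theorem aemeasurable_chart_symm (e : OpenPartialHomeomorph S (Spc n)) (ν : Measure (Spc n)) :
    AEMeasurable e.symm (ν.restrict e.target) :=
  e.symm.continuousOn.aemeasurable (measurableSet_target e)

theorem IsSmoothDensity.map_chart_ac (hμ : IsSmoothDensity (n := n) μ)
    (he : e ∈ atlas (Spc n) S) : (μ.restrict e.source).map e ≪ volume.restrict e.target := by
  obtain ⟨m, -, -, h⟩ := hμ e he
  rw [h]
  exact withDensity_absolutelyContinuous _ _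

/-- The density m is strictly positive on the chart, so Lebesgue measure there is absolutely
continuous with respect to the image of μ. With `map_chart_ac`, null sets can be transported both
ways. -/
theorem IsSmoothDensity.map_chart_symm_ac (hμ : IsSmoothDensity (n := n) μ)
    (he : e ∈ atlas (Spc n) S) : (volume.restrict e.target).map e.symm ≪ μ := by
  obtain ⟨m, hm, hm0, h⟩ := hμ e he
  have hac : volume.restrict e.target ≪ (μ.restrict e.source).map e := by
    rw [h]
    refine withDensity_absolutelyContinuous' ?_ ?_
    · exact (hm.continuousOn.aemeasurable (measurableSet_target e)).ennreal_ofReal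
    · filter_upwards [ae_restrict_mem (measurableSet_target e)] with y hy
      simpa using hm0 y hy
  refine Measure.AbsolutelyContinuous.mk fun s hs hs0 => ?_
  rw [Measure.map_apply_of_aemeasurable (aemeasurable_chart_symm e _) hs]
  refine hac ?_
  have hmem : ∀ᵐ z ∂((μ.restrict e.source).map e), z ∈ e.target := by
    refine (ae_map_iff (aemeasurable_chart e μ) (measurableSet_target e)).2 ?_
    filter_upwards [ae_restrict_mem (measurableSet_source e)] with x hx using e.map_source hx
  have hmeas : MeasurableSet (e.target ∩ e.symm ⁻¹' s) := by
    have h1 : Continuous (e.target.domRestrict e.symm) :=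
      continuousOn_iff_continuous_domRestrict.1 e.symm.continuousOn
    rw [← Subtype.image_preimage_coe]
    exact (measurableSet_target e).subtype_image (h1.measurable hs)
  have : ((μ.restrict e.source).map e) (e.target ∩ e.symm ⁻¹' s) = 0 := by
    rw [Measure.map_apply_of_aemeasurable (aemeasurable_chart e μ) hmeas]
    refine measure_mono_null (t := s ∪ e.sourceᶜ) ?_ ?_
    · rintro x ⟨-, hx⟩
      by_cases hxs : x ∈ e.source
      · left; simpa [e.left_inv hxs] using hx
      · right; exact hxs
    · refine measure_union_null (Measure.restrict_le_self.absolutelyContinuous hs0) ?_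
      rw [Measure.restrict_apply (measurableSet_source e).compl]
      simp
  have h2 : ((μ.restrict e.source).map e) (e.targetᶜ) = 0 := hmem
  refine measure_mono_null (t := (e.target ∩ e.symm ⁻¹' s) ∪ e.targetᶜ) ?_
    (measure_union_null this h2)
  intro y hy
  by_cases hyt : y ∈ e.target
  · left; exact ⟨hyt, hy⟩
  · right; exact hyt

theorem IsSmoothDensity.ae_chart (hμ : IsSmoothDensity (n := n) μ)
    (he : e ∈ atlas (Spc n) S) {P : S → Prop} (h : ∀ᵐ x ∂μ, P x) :
    ∀ᵐ y ∂(volume.restrict e.target), P (e.symm y) :=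
  ae_of_ae_map (aemeasurable_chart_symm e _) ((hμ.map_chart_symm_ac he).ae_le h)

variable [SecondCountableTopology S]

theorem exists_countable_charts (n : ℕ) (S : Type*) [TopologicalSpace S] [ChartedSpace (Spc n) S]
    [SecondCountableTopology S] : ∃ s : Set S, s.Countable ∧
    ⋃ x : s, (chartAt (Spc n) (x : S)).source = univ := by
  obtain ⟨s, hs, h⟩ := TopologicalSpace.countable_cover_nhds
    (fun x : S => chart_source_mem_nhds (Spc n) x)
  exact ⟨s, hs, by rw [← h, biUnion_eq_iUnion]⟩

/-- Second countability reduces the atlas to countably many charts, so the exceptional sets add up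
to a null set. -/
theorem IsSmoothDensity.ae_of_chart (hμ : IsSmoothDensity (n := n) μ) {P : S → Prop}
    (h : ∀ e ∈ atlas (Spc n) S, ∀ᵐ y ∂(volume.restrict e.target), P (e.symm y)) :
    ∀ᵐ x ∂μ, P x := by
  obtain ⟨s, hs, hc⟩ := exists_countable_charts n S
  have := hs.to_subtype
  rw [← Measure.restrict_univ (μ := μ), ← hc, ae_restrict_iUnion_iff]
  intro x
  set e := chartAt (Spc n) (x : S)
  have he : e ∈ atlas (Spc n) S := chart_mem_atlas _ _
  have h1 := ae_of_ae_map (aemeasurable_chart e μ) ((hμ.map_chart_ac he).ae_le (h e he))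
  filter_upwards [h1, ae_restrict_mem (measurableSet_source e)] with z hz hzs
  rwa [e.left_inv hzs] at hz

/-- On one chart μ is the image of Lebesgue measure with a density; disjointifying a countable cover
writes μ as a countable sum of such pieces. This justifies all later uses of Tonelli and Fubini on ℝ
× S. -/
theorem IsSmoothDensity.sfinite (hμ : IsSmoothDensity (n := n) μ) : SFinite μ := by
  obtain ⟨s, hs, hc⟩ := exists_countable_charts n S
  have hsrc : ∀ e ∈ atlas (Spc n) S, SFinite (μ.restrict e.source) := by
    intro e he
    obtain ⟨m, hm, hm0, h⟩ := hμ e he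
    have h1 : AEMeasurable e.symm ((μ.restrict e.source).map e) := by
      rw [h]
      exact (aemeasurable_chart_symm e volume).mono_ac (withDensity_absolutelyContinuous _ _)
    have h2 : μ.restrict e.source = ((μ.restrict e.source).map e).map e.symm := by
      rw [AEMeasurable.map_map_of_aemeasurable h1 (aemeasurable_chart e μ)]
      conv_lhs => rw [← Measure.map_id (μ := μ.restrict e.source)]
      refine Measure.map_congr ?_
      filter_upwards [ae_restrict_mem (measurableSet_source e)] with z hz
      simp [e.left_inv hz]
    rw [h2, h]
    infer_instance
  rcases s.eq_empty_or_nonempty with h0 | h0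
  · have : IsEmpty S := by
      subst h0
      rw [iUnion_of_empty] at hc
      exact univ_eq_empty_iff.1 hc.symm
    rw [Measure.eq_zero_of_isEmpty μ]
    infer_instance
  · obtain ⟨f, rfl⟩ := hs.exists_eq_range h0
    have hc' : ⋃ k, (chartAt (Spc n) (f k)).source = univ := by
      refine eq_univ_of_forall fun x => ?_
      obtain ⟨⟨_, k, rfl⟩, hk⟩ := mem_iUnion.1 (hc ▸ mem_univ x)
      exact mem_iUnion.2 ⟨k, hk⟩
    rw [← Measure.restrict_univ (μ := μ), ← hc', ← iUnion_disjointed,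
      Measure.restrict_iUnion (disjoint_disjointed _)
        (fun k => MeasurableSet.disjointed (fun i => measurableSet_source _) k)]
    have : ∀ k, SFinite (μ.restrict (disjointed (fun k => (chartAt (Spc n) (f k)).source) k)) := by
      intro k
      have := hsrc _ (chart_mem_atlas (Spc n) (f k))
      rw [← Measure.restrict_restrict_of_subset (disjointed_subset
        (fun k => (chartAt (Spc n) (f k)).source) k)]
      infer_instance
    infer_instance

variable {E : Type*} [TopologicalSpace E] [TopologicalSpace.PseudoMetrizableSpace E]

theorem IsSmoothDensity.aestronglyMeasurable_chart (hμ : IsSmoothDensity (n := n) μ)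
    (he : e ∈ atlas (Spc n) S) {f : S → E} (hf : AEStronglyMeasurable f μ) :
    AEStronglyMeasurable (fun y => f (e.symm y)) (volume.restrict e.target) :=
  (hf.mono_ac (hμ.map_chart_symm_ac he)).comp_aemeasurable (aemeasurable_chart_symm e _)

theorem IsSmoothDensity.aestronglyMeasurable_prod_of_chart (hμ : IsSmoothDensity (n := n) μ)
    {f : ℝ × S → E} (hf : ∀ e ∈ atlas (Spc n) S,
      AEStronglyMeasurable (fun p : ℝ × Spc n => f (p.1, e.symm p.2))
        ((volume : Measure ℝ).prod (volume.restrict e.target))) :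
    AEStronglyMeasurable f ((volume : Measure ℝ).prod μ) := by
  obtain ⟨s, hs, hc⟩ := exists_countable_charts n S
  have := hs.to_subtype
  have := hμ.sfinite
  have huniv : (⋃ x : s, (univ : Set ℝ) ×ˢ (chartAt (Spc n) (x : S)).source) = univ := by
    rw [← prod_iUnion, hc, univ_prod_univ]
  rw [← Measure.restrict_univ (μ := (volume : Measure ℝ).prod μ), ← huniv,
    aestronglyMeasurable_iUnion_iff]
  intro x
  set e := chartAt (Spc n) (x : S)
  have he : e ∈ atlas (Spc n) S := chart_mem_atlas _ _
  rw [← Measure.prod_restrict, Measure.restrict_univ]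
  -- The chart is well behaved only on its source, so a globally measurable modification replaces it
  -- in the product map.
  have hem := aemeasurable_chart e μ
  have h1 : (((volume : Measure ℝ).prod (μ.restrict e.source)).map
      (Prod.map id (hem.mk e))) ≪ (volume : Measure ℝ).prod (volume.restrict e.target) := by
    rw [← Measure.map_prod_map _ _ measurable_id hem.measurable_mk, Measure.map_id]
    refine Measure.AbsolutelyContinuous.prod Measure.AbsolutelyContinuous.rfl ?_
    rw [Measure.map_congr hem.ae_eq_mk.symm]
    exact hμ.map_chart_ac he
  have h2 := ((hf e he).mono_ac h1).comp_measurable (measurable_id.prodMap hem.measurable_mk)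
  refine h2.congr ?_
  have h3 : ∀ᵐ z ∂(μ.restrict e.source), e.symm (hem.mk e z) = z := by
    filter_upwards [hem.ae_eq_mk, ae_restrict_mem (measurableSet_source e)] with z hz hzs
    rw [← hz, e.left_inv hzs]
  have h4 : ∀ᵐ p ∂((volume : Measure ℝ).prod (μ.restrict e.source)),
      e.symm (hem.mk e p.2) = p.2 := Measure.quasiMeasurePreserving_snd.ae h3
  filter_upwards [h4] with p hp
  simp [hp]

/-- Almost every time slice of a jointly measurable function is measurable, and here all slices
coincide. Static statements thus follow from the time-dependent ones. -/
theorem aestronglyMeasurable_of_comp_snd {X : Type*} [MeasurableSpace X] {ν : Measure X}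
    [SFinite ν] {f : X → E}
    (hf : AEStronglyMeasurable (fun p : ℝ × X => f p.2) ((volume : Measure ℝ).prod ν)) :
    AEStronglyMeasurable f ν := by
  obtain ⟨r, hr⟩ := hf.prodMk_left.exists
  exact hr

end ChartMeasure

end

section

/-! ### Test functions and weak differentials -/

section TestFunctions

variable {E F : Type*} [NormedAddCommGroup E] [NormedSpace ℝ E] [FiniteDimensional ℝ E]
  [MeasurableSpace E] [BorelSpace E] [NormedAddCommGroup F] [NormedSpace ℝ F]
  {ν : Measure E}

theorem integrable_smul_of_tsupport_subset {f : E → F} {U : Set E} {φ : E → ℝ}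
    (hf : LocallyIntegrableOn f U ν) (hφ : Continuous φ) (hc : HasCompactSupport φ)
    (hs : tsupport φ ⊆ U) : Integrable (fun y => φ y • f y) ν := by
  have h1 : IntegrableOn f (tsupport φ) ν := hf.integrableOn_compact_subset hs hc
  have h2 : IntegrableOn (fun y => φ y • f y) (tsupport φ) ν :=
    h1.continuousOn_smul hφ.continuousOn hc
  refine (integrableOn_iff_integrable_of_support_subset ?_).1 h2
  refine (Function.support_smul_subset_left φ f).trans (subset_tsupport φ)

theorem tsupport_fderiv_apply_subset' {φ : E → ℝ} (v : E) :
    tsupport (fun y => fderiv ℝ φ y v) ⊆ tsupport φ := by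
  refine closure_minimal (fun y hy => ?_) (isClosed_tsupport φ)
  refine tsupport_fderiv_subset ℝ (subset_tsupport _ ?_)
  intro h0
  exact hy (by simp [h0])

theorem integrable_fderiv_smul {f : E → F} {U : Set E} {φ : E → ℝ} (v : E)
    (hf : LocallyIntegrableOn f U ν) (hφ : ContDiff ℝ ∞ φ) (hc : HasCompactSupport φ)
    (hs : tsupport φ ⊆ U) : Integrable (fun y => fderiv ℝ φ y v • f y) ν := by
  refine integrable_smul_of_tsupport_subset hf ?_ ?_ ((tsupport_fderiv_apply_subset' v).trans hs)
  · exact (hφ.continuous_fderiv (by norm_num)).clm_apply continuous_const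
  · exact hc.mono' ((subset_tsupport _).trans (tsupport_fderiv_apply_subset' v))

end TestFunctions

section WeakDifferentials

variable {n : ℕ} {S : Type*} [TopologicalSpace S] [ChartedSpace (Spc n) S]
  {F : Type*} [NormedAddCommGroup F] [NormedSpace ℝ F]

theorem HasWeakDiff.add {f f' : S → F} {τ τ' : OneForm n S F} (h : HasWeakDiff f τ)
    (h' : HasWeakDiff f' τ') :
    HasWeakDiff (fun x => f x + f' x) (fun x => τ x + τ' x) where
  locInt e he := (h.locInt e he).add (h'.locInt e he)
  locInt_diff e he v := (h.locInt_diff e he v).add (h'.locInt_diff e he v)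
  integral_eq e he v φ hφ hc hs := by
    have h1 := h.integral_eq e he v φ hφ hc hs
    have h2 := h'.integral_eq e he v φ hφ hc hs
    have e1 : ∀ y, formComp e (fun x => τ x + τ' x) v y
      = formComp e τ v y + formComp e τ' v y := fun y => rfl
    simp only [smul_add, e1]
    rw [integral_add, integral_add, h1, h2, neg_add]
    · exact (integrable_smul_of_tsupport_subset (h.locInt_diff e he v) hφ.continuous hc hs).restrict
    · exact (integrable_smul_of_tsupport_subset (h'.locInt_diff e he v) hφ.continuous hc hs).restrict
    · exact (integrable_fderiv_smul v (h.locInt e he) hφ hc hs).restrict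
    · exact (integrable_fderiv_smul v (h'.locInt e he) hφ hc hs).restrict

theorem HasWeakDiff.const_smul {f : S → ℂ} {τ : OneForm n S ℂ} (h : HasWeakDiff f τ) (z : ℂ) :
    HasWeakDiff (fun x => z * f x) (fun x => z • τ x) where
  locInt e he := (h.locInt e he).smul z
  locInt_diff e he v := (h.locInt_diff e he v).smul z
  integral_eq e he v φ hφ hc hs := by
    have h1 := h.integral_eq e he v φ hφ hc hs
    have e1 : ∀ y, formComp e (fun x => z • τ x) v y = z * formComp e τ v y := fun y => rfl
    simp only [e1, Complex.real_smul, mul_left_comm _ z] at h1 ⊢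
    rw [integral_const_mul, integral_const_mul, h1, mul_neg]

variable [MeasurableSpace S] [BorelSpace S] [SecondCountableTopology S] {μ : Measure S}

theorem HasWeakDiff.congr (hμ : IsSmoothDensity (n := n) μ) {f f' : S → F} {τ : OneForm n S F}
    (h : HasWeakDiff f τ) (hff : f =ᵐ[μ] f') : HasWeakDiff f' τ where
  locInt e he := (h.locInt e he).congr (hμ.ae_chart he hff)
  locInt_diff := h.locInt_diff
  integral_eq e he v φ hφ hc hs := by
    rw [← h.integral_eq e he v φ hφ hc hs]
    refine integral_congr_ae ?_
    filter_upwards [hμ.ae_chart he hff] with y hy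
    rw [hy]

theorem HasWeakDiff.weakDiff {f : S → F} {τ : OneForm n S F} (h : HasWeakDiff f τ) :
    HasWeakDiff f (weakDiff (n := n) f) := by
  have h' : ∃ τ : OneForm n S F, HasWeakDiff f τ := ⟨τ, h⟩
  rw [_root_.weakDiff, dif_pos h']
  exact h'.choose_spec

variable [IsManifold 𝓘(ℝ, Spc n) ∞ S] [CompleteSpace F]

theorem ae_eq_of_formComp (hμ : IsSmoothDensity (n := n) μ) {τ τ' : OneForm n S F}
    (h : ∀ e ∈ atlas (Spc n) S, ∀ v, ∀ᵐ y ∂(volume.restrict e.target),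
      formComp e τ v y = formComp e τ' v y) : ∀ᵐ x ∂μ, τ x = τ' x := by
  refine hμ.ae_of_chart fun e he => ?_
  filter_upwards [ae_restrict_mem (measurableSet_target e),
    ae_all_iff.2 fun i => h e he (stdVec i)] with y hy hi
  ext w
  rw [form_apply_eq_sum he hy, form_apply_eq_sum he hy]
  simp only [hi]

/-- The fundamental lemma of the calculus of variations applied to each component in each chart. It
makes the choice inside `weakDiff` harmless. -/
theorem HasWeakDiff.ae_unique (hμ : IsSmoothDensity (n := n) μ) {f : S → F}
    {τ τ' : OneForm n S F} (h : HasWeakDiff f τ) (h' : HasWeakDiff f τ') :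
    ∀ᵐ x ∂μ, τ x = τ' x := by
  refine ae_eq_of_formComp hμ fun e he v => ?_
  rw [ae_restrict_iff' (measurableSet_target e)]
  have key := e.open_target.ae_eq_zero_of_integral_contDiff_smul_eq_zero
    ((h.locInt_diff e he v).sub (h'.locInt_diff e he v)) (fun φ hφ hc hs => by
      have h1 := h.integral_eq e he v φ hφ hc hs
      have h2 := h'.integral_eq e he v φ hφ hc hs
      rw [h1, neg_inj] at h2
      have h0 : ∀ f : Spc n → F, ∫ y in e.target, φ y • f y = ∫ y, φ y • f y := fun f =>
        setIntegral_eq_integral_of_forall_compl_eq_zero fun y hy => by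
          rw [image_eq_zero_of_notMem_tsupport fun h => hy (hs h), zero_smul]
      rw [h0, h0] at h2
      simp only [Pi.sub_apply, smul_sub]
      rw [integral_sub, h2, sub_self]
      · exact integrable_smul_of_tsupport_subset (h.locInt_diff e he v) hφ.continuous hc hs
      · exact integrable_smul_of_tsupport_subset (h'.locInt_diff e he v) hφ.continuous hc hs)
  filter_upwards [key] with y hy hyt
  exact sub_eq_zero.1 (hy hyt)

theorem HasWeakDiff.weakDiff_ae_eq (hμ : IsSmoothDensity (n := n) μ) {f : S → F}
    {τ : OneForm n S F} (h : HasWeakDiff f τ) : ∀ᵐ x ∂μ, _root_.weakDiff (n := n) f x = τ x :=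
  h.weakDiff.ae_unique hμ h

end WeakDifferentials

/-! ### Measurability of contractions of tensor fields -/

section TensorMeasurability

variable {n : ℕ} {S : Type*} [TopologicalSpace S] [ChartedSpace (Spc n) S]
  {F : Type*} [NormedAddCommGroup F] [NormedSpace ℝ F]

/-- The components of a one-form in every chart are measurable. -/
def MeasForm (τ : OneForm n S F) : Prop :=
  ∀ e ∈ atlas (Spc n) S, ∀ v : Spc n,
    AEStronglyMeasurable (formComp e τ v) (volume.restrict e.target)

/-- The components of a time-dependent one-form are jointly measurable. -/
def JointMeasForm (τ : ℝ → OneForm n S F) : Prop :=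
  ∀ e ∈ atlas (Spc n) S, ∀ v : Spc n,
    AEStronglyMeasurable (fun p : ℝ × Spc n => formComp e (τ p.1) v p.2)
      ((volume : Measure ℝ).prod (volume.restrict e.target))

/-- The components of a time-dependent field of bilinear forms are jointly measurable. -/
def JointMeasMet (g : ℝ → CoMetric n S) : Prop :=
  ∀ e ∈ atlas (Spc n) S, ∀ η ζ : Spc n →L[ℝ] ℝ,
    AEStronglyMeasurable (fun p : ℝ × Spc n => metComp e (g p.1) η ζ p.2)
      ((volume : Measure ℝ).prod (volume.restrict e.target))

/-- The components of a time-dependent vector field are jointly measurable. -/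
def JointMeasVec (β : ℝ → VecField n S) : Prop :=
  ∀ e ∈ atlas (Spc n) S, ∀ η : Spc n →L[ℝ] ℝ,
    AEStronglyMeasurable (fun p : ℝ × Spc n => vecComp e (β p.1) η p.2)
      ((volume : Measure ℝ).prod (volume.restrict e.target))

theorem MeasForm.joint {τ : OneForm n S F} (h : MeasForm τ) : JointMeasForm fun _ => τ :=
  fun e he v => (h e he v).comp_snd

theorem HasWeakDiff.measForm {f : S → F} {τ : OneForm n S F} (h : HasWeakDiff f τ) :
    MeasForm τ :=
  fun e he v => (h.locInt_diff e he v).aestronglyMeasurable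

theorem FormL2Loc.measForm {τ : OneForm n S ℝ} (h : FormL2Loc τ) : MeasForm τ :=
  fun e he v => (h e he v).1

theorem MeasForm.re {τ : OneForm n S ℂ} (h : MeasForm τ) :
    MeasForm (fun x => Complex.reCLM.comp (τ x)) :=
  fun e he v => Complex.reCLM.continuous.comp_aestronglyMeasurable (h e he v)

theorem MeasForm.im {τ : OneForm n S ℂ} (h : MeasForm τ) :
    MeasForm (fun x => Complex.imCLM.comp (τ x)) :=
  fun e he v => Complex.imCLM.continuous.comp_aestronglyMeasurable (h e he v)

theorem MeasForm.ofReal {τ : OneForm n S ℝ} (h : MeasForm τ) :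
    MeasForm (fun x => Complex.ofRealCLM.comp (τ x)) :=
  fun e he v => Complex.ofRealCLM.continuous.comp_aestronglyMeasurable (h e he v)

theorem MeasForm.add {τ τ' : OneForm n S F} (h : MeasForm τ) (h' : MeasForm τ') :
    MeasForm (fun x => τ x + τ' x) :=
  fun e he v => (h e he v).add (h' e he v)

theorem MeasForm.sub {τ τ' : OneForm n S F} (h : MeasForm τ) (h' : MeasForm τ') :
    MeasForm (fun x => τ x - τ' x) :=
  fun e he v => (h e he v).sub (h' e he v)

variable [MeasurableSpace S] [BorelSpace S] [SecondCountableTopology S] {μ : Measure S}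

theorem MeasForm.smul (hμ : IsSmoothDensity (n := n) μ) {τ : OneForm n S ℂ} (h : MeasForm τ)
    {u : S → ℂ} (hu : AEStronglyMeasurable u μ) : MeasForm (fun x => u x • τ x) :=
  fun e he v => (hμ.aestronglyMeasurable_chart he hu).smul (h e he v)

variable [IsManifold 𝓘(ℝ, Spc n) ∞ S]

theorem JointMeasMet.apply (hμ : IsSmoothDensity (n := n) μ) {g : ℝ → CoMetric n S}
    (hg : JointMeasMet g) {ξ ζ : ℝ → OneForm n S ℝ} (hξ : JointMeasForm ξ)
    (hζ : JointMeasForm ζ) :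
    AEStronglyMeasurable (fun p : ℝ × S => g p.1 p.2 (ξ p.1 p.2) (ζ p.1 p.2))
      ((volume : Measure ℝ).prod μ) := by
  refine hμ.aestronglyMeasurable_prod_of_chart fun e he => ?_
  have h1 : AEStronglyMeasurable (fun p : ℝ × Spc n => ∑ i, ∑ j,
      formComp e (ξ p.1) (stdVec i) p.2 * formComp e (ζ p.1) (stdVec j) p.2 *
      metComp e (g p.1) (EuclideanSpace.proj i) (EuclideanSpace.proj j) p.2)
      ((volume : Measure ℝ).prod (volume.restrict e.target)) :=
    Finset.aestronglyMeasurable_fun_sum _ fun i _ => Finset.aestronglyMeasurable_fun_sum _ fun j _ =>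
      ((hξ e he _).mul (hζ e he _)).mul (hg e he _ _)
  refine h1.congr ?_
  filter_upwards [Measure.quasiMeasurePreserving_snd.ae
    (ae_restrict_mem (measurableSet_target e))] with p hp
  exact (comet_apply_eq_sum he hp (g p.1) _ _).symm

theorem JointMeasVec.apply (hμ : IsSmoothDensity (n := n) μ) {β : ℝ → VecField n S}
    (hβ : JointMeasVec β) {τ : OneForm n S ℂ} (hτ : MeasForm τ) :
    AEStronglyMeasurable (fun p : ℝ × S => τ p.2 (β p.1 p.2)) ((volume : Measure ℝ).prod μ) := by
  refine hμ.aestronglyMeasurable_prod_of_chart fun e he => ?_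
  have h1 : AEStronglyMeasurable (fun p : ℝ × Spc n => ∑ i,
      vecComp e (β p.1) (EuclideanSpace.proj i) p.2 • formComp e τ (stdVec i) p.2)
      ((volume : Measure ℝ).prod (volume.restrict e.target)) :=
    Finset.aestronglyMeasurable_fun_sum _ fun i _ => (hβ e he _).smul (hτ.joint e he _)
  refine h1.congr ?_
  filter_upwards [Measure.quasiMeasurePreserving_snd.ae
    (ae_restrict_mem (measurableSet_target e))] with p hp
  exact (vec_apply_eq_sum he hp τ (β p.1)).symm

theorem IsSmoothDensity.aestronglyMeasurable_bilin (hμ : IsSmoothDensity (n := n) μ)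
    {g : CoMetric n S} (hg : ∀ e ∈ atlas (Spc n) S, ∀ η ζ : Spc n →L[ℝ] ℝ,
      AEStronglyMeasurable (metComp e g η ζ) (volume.restrict e.target))
    {ξ ζ : OneForm n S ℝ} (hξ : MeasForm ξ) (hζ : MeasForm ζ) :
    AEStronglyMeasurable (fun x => g x (ξ x) (ζ x)) μ := by
  have := hμ.sfinite
  have hg' : JointMeasMet (fun _ : ℝ => g) := fun e he η ζ => (hg e he η ζ).comp_snd
  exact aestronglyMeasurable_of_comp_snd (hg'.apply hμ hξ.joint hζ.joint)

theorem IsSmoothDensity.aestronglyMeasurable_cForm (hμ : IsSmoothDensity (n := n) μ)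
    {g : CoMetric n S} (hg : ∀ e ∈ atlas (Spc n) S, ∀ η ζ : Spc n →L[ℝ] ℝ,
      AEStronglyMeasurable (metComp e g η ζ) (volume.restrict e.target))
    {X Z : OneForm n S ℂ} (hX : MeasForm X) (hZ : MeasForm Z) :
    AEStronglyMeasurable (fun x => cForm (g x) (X x) (Z x)) μ := by
  have h := fun {ξ ζ : OneForm n S ℝ} (hξ : MeasForm ξ) (hζ : MeasForm ζ) =>
    hμ.aestronglyMeasurable_bilin hg hξ hζ
  exact (Complex.continuous_ofReal.comp_aestronglyMeasurable
    ((h hX.re hZ.re).add (h hX.im hZ.im))).add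
    ((Complex.continuous_ofReal.comp_aestronglyMeasurable
    ((h hX.re hZ.im).sub (h hX.im hZ.re))).const_mul Complex.I)

theorem IsSmoothDensity.aestronglyMeasurable_covQuad (hμ : IsSmoothDensity (n := n) μ)
    {g : CoMetric n S} (hg : ∀ e ∈ atlas (Spc n) S, ∀ η ζ : Spc n →L[ℝ] ℝ,
      AEStronglyMeasurable (metComp e g η ζ) (volume.restrict e.target))
    {X : OneForm n S ℂ} (hX : MeasForm X) :
    AEStronglyMeasurable (fun x => covQuad (g x) (X x)) μ :=
  (hμ.aestronglyMeasurable_bilin hg hX.re hX.re).add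
    (hμ.aestronglyMeasurable_bilin hg hX.im hX.im)

end TensorMeasurability

end

section

/-! ### Limits of covectors and of weak differentials -/

section PointwiseLimits

variable {V : Type*} [NormedAddCommGroup V] [NormedSpace ℝ V] [FiniteDimensional ℝ V]
  {g : LinearMap.BilinForm ℝ (V →L[ℝ] ℝ)}

theorem exists_clm_eq_bilin {W : Type*} [NormedAddCommGroup W] [NormedSpace ℝ W]
    [FiniteDimensional ℝ W] (b : LinearMap.BilinForm ℝ W) :
    ∃ G : W →L[ℝ] W →L[ℝ] ℝ, ∀ ξ η, G ξ η = b ξ η :=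
  ⟨LinearMap.toContinuousLinearMap
    ((LinearMap.toContinuousLinearMap : (W →ₗ[ℝ] ℝ) ≃ₗ[ℝ] (W →L[ℝ] ℝ)).toLinearMap.comp b),
    fun _ _ => rfl⟩

/-- The constant is the minimum of the quadratic form on the compact unit sphere. -/
theorem exists_coercive_bilin {W : Type*} [NormedAddCommGroup W] [NormedSpace ℝ W]
    [FiniteDimensional ℝ W] (b : LinearMap.BilinForm ℝ W) (hb : ∀ ξ, ξ ≠ 0 → 0 < b ξ ξ) :
    ∃ a > 0, ∀ ξ, a * ‖ξ‖ ^ 2 ≤ b ξ ξ := by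
  obtain ⟨G, hG⟩ := exists_clm_eq_bilin b
  have hcont : Continuous fun ξ => b ξ ξ := by
    simp only [← hG]
    exact G.continuous.clm_apply continuous_id
  rcases subsingleton_or_nontrivial W with hW | hW
  · exact ⟨1, one_pos, fun ξ => by simp [Subsingleton.elim ξ 0]⟩
  obtain ⟨ξ₀, hξ₀, hmin⟩ := (isCompact_sphere (0 : W) 1).exists_isMinOn
    (NormedSpace.sphere_nonempty.2 zero_le_one) hcont.continuousOn
  have hξ₀' : ξ₀ ≠ 0 := by
    rintro rfl
    simp at hξ₀
  refine ⟨b ξ₀ ξ₀, hb _ hξ₀', fun ξ => ?_⟩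
  rcases eq_or_ne ξ 0 with rfl | hξ
  · simp
  have hn := norm_pos_iff.2 hξ
  have h1 : b ξ₀ ξ₀ ≤ b (‖ξ‖⁻¹ • ξ) (‖ξ‖⁻¹ • ξ) :=
    hmin (show ‖ξ‖⁻¹ • ξ ∈ Metric.sphere (0 : W) 1 by
      rw [mem_sphere_zero_iff_norm, norm_smul, norm_inv, norm_norm, inv_mul_cancel₀ hn.ne'])
  simp only [map_smul, LinearMap.smul_apply, smul_eq_mul] at h1
  calc b ξ₀ ξ₀ * ‖ξ‖ ^ 2 ≤ ‖ξ‖⁻¹ * (‖ξ‖⁻¹ * b ξ ξ) * ‖ξ‖ ^ 2 := by gcongr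
    _ = b ξ ξ := by field_simp

theorem continuous_covQuad (g : LinearMap.BilinForm ℝ (V →L[ℝ] ℝ)) : Continuous (covQuad g) := by
  obtain ⟨G, hG⟩ := exists_clm_eq_bilin g
  have : covQuad g = fun X => G (Complex.reCLM.comp X) (Complex.reCLM.comp X)
      + G (Complex.imCLM.comp X) (Complex.imCLM.comp X) := by
    funext X; simp [covQuad, hG]
  rw [this]
  fun_prop

theorem exists_covQuad_coercive (hg : ∀ ξ, ξ ≠ 0 → 0 < g ξ ξ) :
    ∃ a > 0, ∀ X : V →L[ℝ] ℂ, a * ‖X‖ ^ 2 ≤ covQuad g X := by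
  obtain ⟨a, ha, h⟩ := exists_coercive_bilin g hg
  refine ⟨a / 2, by positivity, fun X => ?_⟩
  have h1 : ‖X‖ ≤ ‖Complex.reCLM.comp X‖ + ‖Complex.imCLM.comp X‖ := by
    refine X.opNorm_le_bound (by positivity) fun v => ?_
    refine (Complex.norm_le_abs_re_add_abs_im _).trans ?_
    rw [add_mul]
    exact add_le_add ((Complex.reCLM.comp X).le_opNorm v) ((Complex.imCLM.comp X).le_opNorm v)
  have h2 := h (Complex.reCLM.comp X)
  have h3 := h (Complex.imCLM.comp X)
  have h4 : ‖X‖ ^ 2 ≤ 2 * (‖Complex.reCLM.comp X‖ ^ 2 + ‖Complex.imCLM.comp X‖ ^ 2) := by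
    calc ‖X‖ ^ 2 ≤ (‖Complex.reCLM.comp X‖ + ‖Complex.imCLM.comp X‖) ^ 2 := by gcongr
      _ ≤ _ := by nlinarith [sq_nonneg (‖Complex.reCLM.comp X‖ - ‖Complex.imCLM.comp X‖)]
  rw [covQuad]
  nlinarith

/-- Coercivity turns geometric decay of the increments in the quadratic form into decay in norm, so
the sequence is Cauchy in a complete space. -/
theorem exists_limit_of_covQuad_le (hg : ∀ ξ, ξ ≠ 0 → 0 < g ξ ξ) {X : ℕ → V →L[ℝ] ℂ} {M : ℝ}
    (hX : ∀ j, covQuad g (X (j + 1) - X j) ≤ M * ((1 / 2) ^ j) ^ 2) :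
    ∃ L : V →L[ℝ] ℂ, (∀ v, Filter.Tendsto (fun j => X j v) Filter.atTop (nhds (L v))) ∧
      ∀ Z, Filter.Tendsto (fun j => covQuad g (X j - Z)) Filter.atTop
        (nhds (covQuad g (L - Z))) := by
  obtain ⟨a, ha, h⟩ := exists_covQuad_coercive hg
  have hM : 0 ≤ M := by
    have h0 := (h _).trans (hX 0)
    have : 0 ≤ a * ‖X (0 + 1) - X 0‖ ^ 2 := by positivity
    simpa using this.trans h0
  have hc : CauchySeq X := by
    refine cauchySeq_of_le_geometric (1 / 2) (Real.sqrt (M / a)) (by norm_num) fun j => ?_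
    rw [dist_comm, dist_eq_norm]
    apply le_of_sq_le_sq _ (by positivity)
    rw [mul_pow, Real.sq_sqrt (by positivity), div_mul_eq_mul_div, le_div_iff₀ ha, mul_comm]
    exact (h _).trans (hX j)
  obtain ⟨L, hL⟩ := cauchySeq_tendsto_of_complete hc
  refine ⟨L, fun v => ((ContinuousLinearMap.apply ℝ ℂ v).continuous.tendsto L).comp hL,
    fun Z => ?_⟩
  exact (((continuous_covQuad g).comp (continuous_id.sub continuous_const)).tendsto L).comp hL

end PointwiseLimits

section LocalLOne

variable {E F : Type*} [NormedAddCommGroup E] [NormedSpace ℝ E] [FiniteDimensional ℝ E]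
  [MeasurableSpace E] [BorelSpace E] [NormedAddCommGroup F] [NormedSpace ℝ F]
  {ν : Measure E}

/-- Convergence in `L¹` on the compact subsets of `U`. -/
def TendstoLocLOne (ν : Measure E) (U : Set E) (f : ℕ → E → F) (f' : E → F) : Prop :=
  ∀ K ⊆ U, IsCompact K → Filter.Tendsto (fun j => eLpNorm (f j - f') 1 (ν.restrict K))
    Filter.atTop (nhds 0)

theorem TendstoLocLOne.locallyIntegrableOn {U : Set E} (hU : IsOpen U) {f : ℕ → E → F}
    {f' : E → F} (h : TendstoLocLOne ν U f f') (hf : ∀ j, LocallyIntegrableOn (f j) U ν)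
    (hm : AEStronglyMeasurable f' (ν.restrict U)) : LocallyIntegrableOn f' U ν := by
  rw [locallyIntegrableOn_iff hU.isLocallyClosed]
  intro K hK hKc
  obtain ⟨j, hj⟩ := ((h K hK hKc).eventually (Iio_mem_nhds one_pos)).exists
  have h1 : IntegrableOn (f j) K ν := (hf j).integrableOn_compact_subset hK hKc
  have hm' : AEStronglyMeasurable f' (ν.restrict K) :=
    hm.mono_measure (Measure.restrict_mono hK le_rfl)
  have h2 : MemLp (f j - f') 1 (ν.restrict K) :=
    ⟨h1.aestronglyMeasurable.sub hm', hj.trans ENNReal.one_lt_top⟩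
  have h3 := h1.sub (memLp_one_iff_integrable.1 h2)
  simpa using h3

theorem TendstoLocLOne.tendsto_integral {U : Set E} {f : ℕ → E → F}
    {f' : E → F} (h : TendstoLocLOne ν U f f') (hf : ∀ j, LocallyIntegrableOn (f j) U ν)
    (hf' : LocallyIntegrableOn f' U ν) {φ : E → ℝ} (hφ : Continuous φ)
    (hc : HasCompactSupport φ) (hs : tsupport φ ⊆ U) :
    Filter.Tendsto (fun j => ∫ y in U, φ y • f j y ∂ν) Filter.atTop
      (nhds (∫ y in U, φ y • f' y ∂ν)) := by
  have h0 : ∀ f : E → F, ∫ y in U, φ y • f y ∂ν = ∫ y in tsupport φ, φ y • f y ∂ν := fun f => by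
    rw [setIntegral_eq_integral_of_forall_compl_eq_zero fun y hy => by
        rw [image_eq_zero_of_notMem_tsupport fun h => hy (hs h), zero_smul],
      setIntegral_eq_integral_of_forall_compl_eq_zero fun y hy => by
        rw [image_eq_zero_of_notMem_tsupport hy, zero_smul]]
  simp only [h0]
  obtain ⟨B, hB⟩ := hc.exists_bound_of_continuous hφ
  have hint : ∀ f : E → F, LocallyIntegrableOn f U ν →
      Integrable (fun y => φ y • f y) (ν.restrict (tsupport φ)) := fun f hf =>
    (integrable_smul_of_tsupport_subset hf hφ hc hs).restrict
  refine tendsto_integral_of_L1' _ (hint f' hf').aestronglyMeasurable (Filter.Eventually.of_forall fun j => hint _ (hf j))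
    ?_
  have h1 := h _ hs hc
  have h2 := ENNReal.Tendsto.const_mul (a := ENNReal.ofReal B) h1 (Or.inr ENNReal.ofReal_ne_top)
  rw [mul_zero] at h2
  refine tendsto_of_tendsto_of_tendsto_of_le_of_le tendsto_const_nhds h2 (fun _ => zero_le)
    fun j => ?_
  refine eLpNorm_le_mul_eLpNorm_of_ae_le_mul (Filter.Eventually.of_forall fun y => ?_) 1
  simp only [Pi.sub_apply, ← smul_sub, norm_smul]
  exact mul_le_mul_of_nonneg_right (hB y) (norm_nonneg _)

end LocalLOne

section WeakLimits

variable {n : ℕ} {S : Type*} [TopologicalSpace S] [ChartedSpace (Spc n) S]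
  {F : Type*} [NormedAddCommGroup F] [NormedSpace ℝ F]

/-- Both sides of the integration-by-parts identity are continuous under L¹ convergence on the
compact support of the test function. -/
theorem HasWeakDiff.of_tendsto {f : ℕ → S → F} {τ : ℕ → OneForm n S F} {f' : S → F}
    {τ' : OneForm n S F} (h : ∀ j, HasWeakDiff (f j) (τ j))
    (hfm : ∀ e ∈ atlas (Spc n) S,
      AEStronglyMeasurable (fun y => f' (e.symm y)) (volume.restrict e.target))
    (hτm : MeasForm τ')
    (hf : ∀ e ∈ atlas (Spc n) S, TendstoLocLOne volume e.target
      (fun j y => f j (e.symm y)) (fun y => f' (e.symm y)))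
    (hτ : ∀ e ∈ atlas (Spc n) S, ∀ v, TendstoLocLOne volume e.target
      (fun j => formComp e (τ j) v) (formComp e τ' v)) : HasWeakDiff f' τ' where
  locInt e he := (hf e he).locallyIntegrableOn e.open_target (fun j => (h j).locInt e he)
    (hfm e he)
  locInt_diff e he v := (hτ e he v).locallyIntegrableOn e.open_target
    (fun j => (h j).locInt_diff e he v) (hτm e he v)
  integral_eq e he v φ hφ hc hs := by
    have h1 := (hf e he).tendsto_integral
      (fun j => (h j).locInt e he)
      ((hf e he).locallyIntegrableOn e.open_target (fun j => (h j).locInt e he) (hfm e he))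
      (φ := fun y => fderiv ℝ φ y v)
      ((hφ.continuous_fderiv (by norm_num)).clm_apply continuous_const)
      (hc.mono' ((subset_tsupport _).trans (tsupport_fderiv_apply_subset' v)))
      ((tsupport_fderiv_apply_subset' v).trans hs)
    have h2 := (hτ e he v).tendsto_integral
      (fun j => (h j).locInt_diff e he v)
      ((hτ e he v).locallyIntegrableOn e.open_target
        (fun j => (h j).locInt_diff e he v) (hτm e he v)) hφ.continuous hc hs
    refine tendsto_nhds_unique h1 ?_
    simp only [(h _).integral_eq e he v φ hφ hc hs]
    exact h2.neg

end WeakLimits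

end

section

/-! ### The maximal form: domain, sesquilinearity, lower bound -/

section LTwo

variable {X : Type*} [MeasurableSpace X] {μ : Measure X}

theorem integrable_norm_sq (u : Lp ℂ 2 μ) : Integrable (fun x => ‖u x‖ ^ 2) μ := by
  have h := (L2.integrable_inner (𝕜 := ℂ) u u).re
  refine h.congr (Filter.Eventually.of_forall fun x => ?_)
  change RCLike.re (inner ℂ (u x) (u x)) = _
  rw [inner_self_eq_norm_sq]

theorem norm_sq_eq_integral (u : Lp ℂ 2 μ) : ‖u‖ ^ 2 = ∫ x, ‖u x‖ ^ 2 ∂μ := by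
  rw [← inner_self_eq_norm_sq (𝕜 := ℂ) u, L2.inner_def]
  rw [← integral_re (L2.integrable_inner (𝕜 := ℂ) u u)]
  simp only [inner_self_eq_norm_sq]

theorem lintegral_norm_sq (u : Lp ℂ 2 μ) :
    ∫⁻ x, ENNReal.ofReal (‖u x‖ ^ 2) ∂μ = ENNReal.ofReal (‖u‖ ^ 2) := by
  rw [norm_sq_eq_integral, ofReal_integral_eq_lintegral_ofReal (integrable_norm_sq u)
    (Filter.Eventually.of_forall fun x => sq_nonneg _)]

end LTwo

variable {n : ℕ} {S : Type*} [TopologicalSpace S] [ChartedSpace (Spc n) S]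
  [MeasurableSpace S] [BorelSpace S] [SecondCountableTopology S] {μ : Measure S}
  [IsManifold 𝓘(ℝ, Spc n) ∞ S]

namespace KGCoeffs

variable (c : KGCoeffs n S μ)

/-- `u` has a weak differential. -/
def HasWD (_c : KGCoeffs n S μ) (u : Lp ℂ 2 μ) : Prop :=
  ∃ τ : OneForm n S ℂ, HasWeakDiff (u : S → ℂ) τ

/-- The energy density `g̃ⁱʲ(t) X̄ᵢ Xⱼ` of `X = D^{A,γ}(t) u`. -/
def dens (t : ℝ) (u : Lp ℂ 2 μ) (x : S) : ℝ := covQuad (c.g t x) (c.covD t u x)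

theorem g_nonneg (t : ℝ) (x : S) (ξ : TangentSpace 𝓘(ℝ, Spc n) x →L[ℝ] ℝ) :
    0 ≤ c.g t x ξ ξ := by
  rcases eq_or_ne ξ 0 with rfl | h
  · simp
  · exact (c.g_pos t x ξ h).le

theorem dens_nonneg (t : ℝ) (u : Lp ℂ 2 μ) (x : S) : 0 ≤ c.dens t u x :=
  covQuad_nonneg (c.g_nonneg t x) _

theorem measForm_covD (hμ : IsSmoothDensity (n := n) μ) (t : ℝ) {u : Lp ℂ 2 μ}
    (hu : c.HasWD u) : MeasForm (c.covD t u) := by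
  obtain ⟨τ, hτ⟩ := hu
  have hm := Lp.aestronglyMeasurable u
  exact ((hτ.weakDiff.measForm.smul hμ aestronglyMeasurable_const).sub
    ((c.A_locL2 t).measForm.ofReal.smul hμ hm)).add
    ((c.θ_locL2 t).measForm.ofReal.smul hμ (hm.const_mul (Complex.I / 2)))

theorem HasWD.add {c : KGCoeffs n S μ} (hμ : IsSmoothDensity (n := n) μ) {u v : Lp ℂ 2 μ}
    (hu : c.HasWD u) (hv : c.HasWD v) : c.HasWD (u + v) := by
  obtain ⟨τ, hτ⟩ := hu
  obtain ⟨σ, hσ⟩ := hv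
  exact ⟨_, (hτ.add hσ).congr hμ (Lp.coeFn_add u v).symm⟩

theorem HasWD.smul {c : KGCoeffs n S μ} (hμ : IsSmoothDensity (n := n) μ) (z : ℂ) {u : Lp ℂ 2 μ}
    (hu : c.HasWD u) : c.HasWD (z • u) := by
  obtain ⟨τ, hτ⟩ := hu
  exact ⟨_, (hτ.const_smul z).congr hμ (Lp.coeFn_smul z u).symm⟩

theorem weakDiff_add_ae (hμ : IsSmoothDensity (n := n) μ) {u v : Lp ℂ 2 μ}
    (hu : c.HasWD u) (hv : c.HasWD v) : ∀ᵐ x ∂μ, weakDiff (n := n) (↑(u + v) : S → ℂ) x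
      = weakDiff (n := n) (u : S → ℂ) x + weakDiff (n := n) (v : S → ℂ) x := by
  obtain ⟨τ, hτ⟩ := hu
  obtain ⟨σ, hσ⟩ := hv
  exact ((hτ.weakDiff.add hσ.weakDiff).congr hμ (Lp.coeFn_add u v).symm).weakDiff_ae_eq hμ

theorem weakDiff_smul_ae (hμ : IsSmoothDensity (n := n) μ) (z : ℂ) {u : Lp ℂ 2 μ}
    (hu : c.HasWD u) : ∀ᵐ x ∂μ, weakDiff (n := n) (↑(z • u) : S → ℂ) x
      = z • weakDiff (n := n) (u : S → ℂ) x := by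
  obtain ⟨τ, hτ⟩ := hu
  exact ((hτ.weakDiff.const_smul z).congr hμ (Lp.coeFn_smul z u).symm).weakDiff_ae_eq hμ

theorem covD_apply (t : ℝ) (u : S → ℂ) (x : S) (w : TangentSpace 𝓘(ℝ, Spc n) x) :
    c.covD t u x w = -Complex.I * weakDiff (n := n) u x w - u x * (c.A t x w : ℂ)
      + Complex.I / 2 * u x * (c.θ t x w : ℂ) := rfl

theorem covD_add_ae (hμ : IsSmoothDensity (n := n) μ) (t : ℝ) {u v : Lp ℂ 2 μ}
    (hu : c.HasWD u) (hv : c.HasWD v) :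
    ∀ᵐ x ∂μ, c.covD t (↑(u + v) : S → ℂ) x = c.covD t u x + c.covD t v x := by
  filter_upwards [c.weakDiff_add_ae hμ hu hv, Lp.coeFn_add u v] with x h1 h2
  ext w
  rw [add_apply, covD_apply, covD_apply, covD_apply, h1, h2, add_apply, Pi.add_apply]
  ring

theorem covD_smul_ae (hμ : IsSmoothDensity (n := n) μ) (t : ℝ) (z : ℂ) {u : Lp ℂ 2 μ}
    (hu : c.HasWD u) :
    ∀ᵐ x ∂μ, c.covD t (↑(z • u) : S → ℂ) x = z • c.covD t u x := by
  filter_upwards [c.weakDiff_smul_ae hμ z hu, Lp.coeFn_smul z u] with x h1 h2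
  simp only [covD, h1, h2, Pi.smul_apply, smul_eq_mul, smul_add, smul_sub, smul_smul]
  rw [mul_comm z (-Complex.I), mul_left_comm]

theorem mem_formDom_iff (t : ℝ) (u : Lp ℂ 2 μ) : u ∈ c.formDom t ↔
    c.HasWD u ∧ Integrable (c.dens t u) μ ∧ Integrable (fun x => c.Y t x * ‖u x‖ ^ 2) μ := by
  have h : (fun x => cForm (c.g t x) (c.covD t u x) (c.covD t u x))
      = fun x => ((c.dens t u x : ℝ) : ℂ) := funext fun x => cForm_self (c.g_symm t x) _
  have h2 : Integrable (fun x => ((c.dens t u x : ℝ) : ℂ)) μ ↔ Integrable (c.dens t u) μ :=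
    ⟨fun h => h.re, fun h => h.ofReal⟩
  simp only [formDom, mem_ofPred_eq, h, h2, HasWD]

theorem aestronglyMeasurable_dens (hμ : IsSmoothDensity (n := n) μ) (t : ℝ) {u : Lp ℂ 2 μ}
    (hu : c.HasWD u) : AEStronglyMeasurable (c.dens t u) μ :=
  hμ.aestronglyMeasurable_covQuad (c.g_meas t) (c.measForm_covD hμ t hu)

theorem aestronglyMeasurable_Y (t : ℝ) : AEStronglyMeasurable (c.Y t) μ :=
  (c.Y_locInt t).aestronglyMeasurable

theorem add_mem_formDom (hμ : IsSmoothDensity (n := n) μ) (t : ℝ) {u v : Lp ℂ 2 μ}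
    (hu : u ∈ c.formDom t) (hv : v ∈ c.formDom t) : u + v ∈ c.formDom t := by
  rw [mem_formDom_iff] at *
  have hw := hu.1.add hμ hv.1
  refine ⟨hw, ?_, ?_⟩
  · refine ((hu.2.1.const_mul 2).add (hv.2.1.const_mul 2)).mono'
      (c.aestronglyMeasurable_dens hμ t hw) ?_
    filter_upwards [c.covD_add_ae hμ t hu.1 hv.1] with x hx
    rw [Real.norm_of_nonneg (c.dens_nonneg t _ x)]
    simp only [dens, hx]
    exact covQuad_add_le (c.g_symm t x) (c.g_nonneg t x) _ _
  · refine ((hu.2.2.norm.const_mul 2).add (hv.2.2.norm.const_mul 2)).mono'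
      ((c.aestronglyMeasurable_Y t).mul ((Lp.aestronglyMeasurable _).norm.pow 2)) ?_
    filter_upwards [Lp.coeFn_add u v] with x hx
    rw [hx]
    simp only [Pi.add_apply, norm_mul, norm_pow, norm_norm]
    have h1 : ‖u x + v x‖ ^ 2 ≤ 2 * ‖u x‖ ^ 2 + 2 * ‖v x‖ ^ 2 := by
      have := norm_add_le (u x) (v x)
      nlinarith [norm_nonneg (u x + v x), sq_nonneg (‖u x‖ - ‖v x‖)]
    calc ‖c.Y t x‖ * ‖u x + v x‖ ^ 2 ≤ ‖c.Y t x‖ * (2 * ‖u x‖ ^ 2 + 2 * ‖v x‖ ^ 2) := by gcongr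
      _ = _ := by ring

theorem smul_mem_formDom (hμ : IsSmoothDensity (n := n) μ) (t : ℝ) (z : ℂ) {u : Lp ℂ 2 μ}
    (hu : u ∈ c.formDom t) : z • u ∈ c.formDom t := by
  rw [mem_formDom_iff] at *
  refine ⟨hu.1.smul hμ z, ?_, ?_⟩
  · refine (hu.2.1.const_mul (‖z‖ ^ 2)).congr ?_
    filter_upwards [c.covD_smul_ae hμ t z hu.1] with x hx
    simp only [dens, hx, covQuad_smul (c.g_symm t x)]
  · refine (hu.2.2.const_mul (‖z‖ ^ 2)).congr ?_
    filter_upwards [Lp.coeFn_smul z u] with x hx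
    rw [hx, Pi.smul_apply, norm_smul]
    ring

theorem zero_mem_formDom (hμ : IsSmoothDensity (n := n) μ) (t : ℝ) :
    (0 : Lp ℂ 2 μ) ∈ c.formDom t := by
  have h0 : c.HasWD 0 := by
    refine ⟨fun _ => 0, HasWeakDiff.congr (f := fun _ => 0) hμ ?_ (Lp.coeFn_zero ℂ 2 μ).symm⟩
    refine ⟨fun e _ => locallyIntegrableOn_zero, fun e _ v => locallyIntegrableOn_zero, ?_⟩
    intro e _ v φ _ _ _
    simp [formComp]
  have hae : ∀ᵐ x ∂μ, c.covD t ((0 : Lp ℂ 2 μ) : S → ℂ) x = 0 := by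
    have h1 := c.covD_smul_ae hμ t 0 h0
    rw [smul_zero] at h1
    filter_upwards [h1] with x hx
    rw [hx, zero_smul]
  rw [mem_formDom_iff]
  refine ⟨h0, (integrable_zero S ℝ μ).congr ?_, (integrable_zero S ℝ μ).congr ?_⟩
  · filter_upwards [hae] with x hx
    simp only [dens, hx]
    simp [covQuad]
  · filter_upwards [Lp.coeFn_zero ℂ 2 μ] with x hx
    rw [hx, Pi.zero_apply, Pi.zero_apply, norm_zero]
    simp

/-- The form domain as a subspace. -/
def formSubmodule (hμ : IsSmoothDensity (n := n) μ) (t : ℝ) : Submodule ℂ (Lp ℂ 2 μ) where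
  carrier := c.formDom t
  add_mem' := c.add_mem_formDom hμ t
  zero_mem' := c.zero_mem_formDom hμ t
  smul_mem' z _ := c.smul_mem_formDom hμ t z

theorem integrable_form (hμ : IsSmoothDensity (n := n) μ) (t : ℝ) {u v : Lp ℂ 2 μ}
    (hu : u ∈ c.formDom t) (hv : v ∈ c.formDom t) :
    Integrable (fun x => cForm (c.g t x) (c.covD t u x) (c.covD t v x)
      + (starRingEnd ℂ) (u x) * (c.Y t x : ℂ) * v x) μ := by
  rw [mem_formDom_iff] at hu hv
  refine Integrable.add ?_ ?_
  · refine (hu.2.1.add hv.2.1).mono' (hμ.aestronglyMeasurable_cForm (c.g_meas t)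
      (c.measForm_covD hμ t hu.1) (c.measForm_covD hμ t hv.1)) ?_
    exact Filter.Eventually.of_forall fun x =>
      norm_cForm_le (c.g_symm t x) (c.g_nonneg t x) _ _
  · refine (hu.2.2.norm.add hv.2.2.norm).mono' ?_ ?_
    · exact ((Complex.continuous_conj.comp_aestronglyMeasurable (Lp.aestronglyMeasurable u)).mul
        (Complex.continuous_ofReal.comp_aestronglyMeasurable (c.aestronglyMeasurable_Y t))).mul
        (Lp.aestronglyMeasurable v)
    · refine Filter.Eventually.of_forall fun x => ?_
      simp only [Pi.add_apply, norm_mul, norm_pow, norm_norm, RCLike.norm_conj, Complex.norm_real]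
      rw [← mul_add, mul_comm ‖u x‖, mul_assoc]
      gcongr
      nlinarith [sq_nonneg (‖u x‖ - ‖v x‖), mul_nonneg (norm_nonneg (u x)) (norm_nonneg (v x))]

theorem form_add_right (hμ : IsSmoothDensity (n := n) μ) (t : ℝ) {u v w : Lp ℂ 2 μ}
    (hu : u ∈ c.formDom t) (hv : v ∈ c.formDom t) (hw : w ∈ c.formDom t) :
    c.form t u (v + w) = c.form t u v + c.form t u w := by
  simp only [form]
  rw [← integral_add (c.integrable_form hμ t hu hv) (c.integrable_form hμ t hu hw)]
  refine integral_congr_ae ?_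
  rw [mem_formDom_iff] at hv hw
  filter_upwards [c.covD_add_ae hμ t hv.1 hw.1, Lp.coeFn_add v w] with x h1 h2
  rw [h1, h2, cForm_add_right, Pi.add_apply]
  ring

theorem form_smul_right (hμ : IsSmoothDensity (n := n) μ) (t : ℝ) (z : ℂ) (u : Lp ℂ 2 μ)
    {v : Lp ℂ 2 μ} (hv : c.HasWD v) : c.form t u (z • v) = z * c.form t u v := by
  simp only [form]
  rw [← integral_const_mul]
  refine integral_congr_ae ?_
  filter_upwards [c.covD_smul_ae hμ t z hv, Lp.coeFn_smul z v] with x h1 h2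
  rw [h1, h2, cForm_smul_right, Pi.smul_apply, smul_eq_mul]
  ring

theorem form_conj_symm (t : ℝ) (u v : Lp ℂ 2 μ) :
    (starRingEnd ℂ) (c.form t u v) = c.form t v u := by
  simp only [form]
  rw [← integral_conj]
  refine integral_congr_ae (Filter.Eventually.of_forall fun x => ?_)
  simp only [map_add, map_mul, cForm_conj (c.g_symm t x), Complex.conj_conj, Complex.conj_ofReal]
  ring

theorem form_self_re (t : ℝ) {u : Lp ℂ 2 μ} (hu : u ∈ c.formDom t) :
    (c.form t u u).re = (∫ x, c.dens t u x ∂μ) + ∫ x, c.Y t x * ‖u x‖ ^ 2 ∂μ := by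
  rw [mem_formDom_iff] at hu
  rw [← integral_add hu.2.1 hu.2.2]
  have : c.form t u u = ∫ x, ((c.dens t u x + c.Y t x * ‖u x‖ ^ 2 : ℝ) : ℂ) ∂μ := by
    simp only [form]
    refine integral_congr_ae (Filter.Eventually.of_forall fun x => ?_)
    simp only [dens, cForm_self (c.g_symm t x)]
    push_cast
    rw [← Complex.conj_mul']
    ring
  rw [this, integral_complex_ofReal, Complex.ofReal_re]

/-- A non-negative constant `K` with `-K ≤ Ỹ(t)`. -/
theorem exists_lower (t : ℝ) : ∃ K : ℝ, 0 ≤ K ∧ ∀ᵐ x ∂μ, 0 ≤ c.Y t x + K := by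
  obtain ⟨K, hK⟩ := c.Y_bddBelow t
  refine ⟨max 0 (-K), le_max_left _ _, ?_⟩
  filter_upwards [hK] with x hx
  linarith [le_max_right 0 (-K)]

/-- The constant `K` with `-K ≤ Ỹ(t)`. -/
def lowerK (t : ℝ) : ℝ := (c.exists_lower t).choose

theorem lowerK_nonneg (t : ℝ) : 0 ≤ c.lowerK t := (c.exists_lower t).choose_spec.1

theorem lowerK_spec (t : ℝ) : ∀ᵐ x ∂μ, 0 ≤ c.Y t x + c.lowerK t :=
  (c.exists_lower t).choose_spec.2

theorem form_self_add_eq (t : ℝ) {u : Lp ℂ 2 μ} (hu : u ∈ c.formDom t) :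
    (c.form t u u).re + c.lowerK t * ‖u‖ ^ 2 =
      ∫ x, (c.dens t u x + (c.Y t x + c.lowerK t) * ‖u x‖ ^ 2) ∂μ := by
  rw [c.form_self_re t hu, norm_sq_eq_integral, ← integral_const_mul, add_assoc]
  rw [mem_formDom_iff] at hu
  have h1 := (integrable_norm_sq u).const_mul (c.lowerK t)
  rw [← integral_add hu.2.2 h1]
  refine (integral_add hu.2.1 (hu.2.2.add h1)).symm.trans ?_
  refine integral_congr_ae (Filter.Eventually.of_forall fun x => ?_)
  simp only [Pi.add_apply]
  ring

theorem integrable_form_self_add (t : ℝ) {u : Lp ℂ 2 μ} (hu : u ∈ c.formDom t) :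
    Integrable (fun x => c.dens t u x + (c.Y t x + c.lowerK t) * ‖u x‖ ^ 2) μ := by
  rw [mem_formDom_iff] at hu
  refine (hu.2.1.add (hu.2.2.add ((integrable_norm_sq u).const_mul (c.lowerK t)))).congr
    (Filter.Eventually.of_forall fun x => ?_)
  simp only [Pi.add_apply]
  ring

theorem form_self_add_nonneg (t : ℝ) {u : Lp ℂ 2 μ} (hu : u ∈ c.formDom t) :
    0 ≤ (c.form t u u).re + c.lowerK t * ‖u‖ ^ 2 := by
  rw [c.form_self_add_eq t hu]
  refine integral_nonneg_of_ae ?_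
  filter_upwards [c.lowerK_spec t] with x hx
  exact add_nonneg (c.dens_nonneg t u x) (mul_nonneg hx (sq_nonneg _))

theorem integral_dens_le (t : ℝ) {u : Lp ℂ 2 μ} (hu : u ∈ c.formDom t) :
    ∫ x, c.dens t u x ∂μ ≤ (c.form t u u).re + c.lowerK t * ‖u‖ ^ 2 := by
  rw [c.form_self_add_eq t hu]
  refine integral_mono_ae ((c.mem_formDom_iff t u).1 hu).2.1 (c.integrable_form_self_add t hu) ?_
  filter_upwards [c.lowerK_spec t] with x hx
  exact le_add_of_nonneg_right (mul_nonneg hx (sq_nonneg _))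

end KGCoeffs

end

section

/-! ### Local comparison with Lebesgue measure and Euclidean norms -/

section ChartBounds

variable {n : ℕ} {S : Type*} [TopologicalSpace S] [ChartedSpace (Spc n) S]
  [MeasurableSpace S] [BorelSpace S] {μ : Measure S} {e : OpenPartialHomeomorph S (Spc n)}

/-- On a compact set the density has a positive lower bound δ, and 1/δ is the constant. -/
theorem IsSmoothDensity.exists_map_symm_restrict_le (hμ : IsSmoothDensity (n := n) μ)
    (he : e ∈ atlas (Spc n) S) {K : Set (Spc n)} (hK : IsCompact K) (hKt : K ⊆ e.target) :
    ∃ C : ℝ≥0∞, C ≠ ⊤ ∧ (volume.restrict K).map e.symm ≤ C • μ := by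
  obtain ⟨m, hm, hm0, h⟩ := hμ e he
  obtain ⟨δ, hδ, hδm⟩ := hK.exists_forall_le' (hm.continuousOn.mono hKt) (a := 0)
    (fun y hy => hm0 y (hKt hy))
  refine ⟨(ENNReal.ofReal δ)⁻¹, by simpa using hδ, Measure.le_iff.2 fun s hs => ?_⟩
  have hem : AEMeasurable e.symm (volume.restrict K) :=
    (aemeasurable_chart_symm e volume).mono_measure (Measure.restrict_mono hKt le_rfl)
  have hmeas : MeasurableSet (e.target ∩ e.symm ⁻¹' s) := by
    have h1 : Continuous (e.target.domRestrict e.symm) :=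
      continuousOn_iff_continuous_domRestrict.1 e.symm.continuousOn
    rw [← Subtype.image_preimage_coe]
    exact (measurableSet_target e).subtype_image (h1.measurable hs)
  rw [Measure.map_apply_of_aemeasurable hem hs, Measure.smul_apply, smul_eq_mul]
  have h1 : (volume.restrict K) (e.symm ⁻¹' s) ≤ volume (K ∩ (e.target ∩ e.symm ⁻¹' s)) := by
    rw [Measure.restrict_apply' hK.measurableSet]
    exact measure_mono fun y hy => ⟨hy.2, hKt hy.2, hy.1⟩
  have h2 : ((μ.restrict e.source).map e) (e.target ∩ e.symm ⁻¹' s) ≤ μ s := by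
    rw [Measure.map_apply_of_aemeasurable (aemeasurable_chart e μ) hmeas,
      Measure.restrict_apply' (measurableSet_source e)]
    refine measure_mono ?_
    rintro x ⟨⟨-, hx⟩, hxs⟩
    simpa [e.left_inv hxs] using hx
  have h3 : ENNReal.ofReal δ * volume (K ∩ (e.target ∩ e.symm ⁻¹' s)) ≤
      ((μ.restrict e.source).map e) (e.target ∩ e.symm ⁻¹' s) := by
    rw [h, withDensity_apply _ hmeas, Measure.restrict_restrict hmeas]
    have hsub : K ∩ (e.target ∩ e.symm ⁻¹' s) ⊆ (e.target ∩ e.symm ⁻¹' s) ∩ e.target :=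
      fun y hy => ⟨hy.2, hy.2.1⟩
    refine le_trans ?_ (lintegral_mono_set hsub)
    rw [← setLIntegral_const]
    exact setLIntegral_mono' (hK.measurableSet.inter hmeas) fun y hy =>
      ENNReal.ofReal_le_ofReal (hδm y hy.1)
  refine h1.trans ?_
  rw [← ENNReal.div_eq_inv_mul, ENNReal.le_div_iff_mul_le (by simp [hδ]) (by simp), mul_comm]
  exact h3.trans h2

theorem IsSmoothDensity.exists_eLpNorm_chart_le (hμ : IsSmoothDensity (n := n) μ)
    (he : e ∈ atlas (Spc n) S) {K : Set (Spc n)} (hK : IsCompact K) (hKt : K ⊆ e.target) :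
    ∃ C : ℝ≥0∞, C ≠ ⊤ ∧ ∀ {F : Type} [NormedAddCommGroup F] (f : S → F),
      AEStronglyMeasurable f μ →
      eLpNorm (fun y => f (e.symm y)) 2 (volume.restrict K) ≤ C * eLpNorm f 2 μ := by
  obtain ⟨C, hC, h⟩ := hμ.exists_map_symm_restrict_le he hK hKt
  refine ⟨C ^ (1 / (2 : ℝ≥0∞)).toReal, ENNReal.rpow_ne_top_of_nonneg (by positivity) hC,
    fun f hf => ?_⟩
  have hem : AEMeasurable e.symm (volume.restrict K) :=
    (aemeasurable_chart_symm e volume).mono_measure (Measure.restrict_mono hKt le_rfl)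
  have hac : (volume.restrict K).map e.symm ≪ μ :=
    (Measure.absolutelyContinuous_of_le h).trans Measure.smul_absolutelyContinuous
  have h1 := eLpNorm_map_measure (p := 2) (hf.mono_ac hac) hem
  rw [← smul_eq_mul, ← eLpNorm_smul_measure_of_ne_top (by norm_num)]
  exact h1.symm.le.trans (eLpNorm_mono_measure f h)

end ChartBounds

section LTwoLintegral

variable {X : Type*} [MeasurableSpace X] {μ : Measure X}

theorem eLpNorm_sqrt_eq (f : X → ℝ) (hf : ∀ x, 0 ≤ f x) :
    eLpNorm (fun x => Real.sqrt (f x)) 2 μ = (∫⁻ x, ENNReal.ofReal (f x) ∂μ) ^ (1 / 2 : ℝ) := by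
  rw [eLpNorm_eq_lintegral_rpow_enorm_toReal (by norm_num) (by norm_num)]
  simp only [ENNReal.toReal_ofNat]
  congr 2
  funext x
  rw [Real.enorm_eq_ofReal (Real.sqrt_nonneg _), ENNReal.ofReal_rpow_of_nonneg
    (Real.sqrt_nonneg _) (by norm_num), Real.rpow_two, Real.sq_sqrt (hf x)]

end LTwoLintegral

variable {n : ℕ} {S : Type*} [TopologicalSpace S] [ChartedSpace (Spc n) S]
  [MeasurableSpace S] [BorelSpace S] [SecondCountableTopology S] {μ : Measure S}
  [IsManifold 𝓘(ℝ, Spc n) ∞ S]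

namespace KGCoeffs

variable (c : KGCoeffs n S μ)

/-- Local ellipticity of the inverse metric: g ≥ a on K gives |X(v)| ≤ ‖v‖ a^{-1/2} times the length
of X. -/
theorem exists_formComp_le {e : OpenPartialHomeomorph S (Spc n)} (t : ℝ)
    (he : e ∈ atlas (Spc n) S) {K : Set (Spc n)} (hK : IsCompact K) (hKt : K ⊆ e.target)
    (v : Spc n) : ∃ B : ℝ, 0 ≤ B ∧ ∀ᵐ y ∂(volume.restrict K), ∀ X : OneForm n S ℂ,
      ‖formComp e X v y‖ ≤ B * Real.sqrt (covQuad (c.g t (e.symm y)) (X (e.symm y))) := by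
  obtain ⟨a, C, ha, h⟩ := c.g_locBdd t e he K hK hKt
  refine ⟨‖v‖ / Real.sqrt a, by positivity, ?_⟩
  filter_upwards [h, ae_restrict_mem hK.measurableSet] with y hy hyK X
  have key : ∀ ξ : TangentSpace 𝓘(ℝ, Spc n) (e.symm y) →L[ℝ] ℝ,
      a * (ξ (mfderiv 𝓘(ℝ, Spc n) 𝓘(ℝ, Spc n) e.symm y v)) ^ 2 ≤
        ‖v‖ ^ 2 * c.g t (e.symm y) ξ ξ := by
    intro ξ
    let η : Spc n →L[ℝ] ℝ := ξ.comp (mfderiv 𝓘(ℝ, Spc n) 𝓘(ℝ, Spc n) e.symm y)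
    have h1 := (hy η).1
    have h2 : coordCovector e η (e.symm y) = ξ := by
      ext w
      change ξ (mfderiv 𝓘(ℝ, Spc n) 𝓘(ℝ, Spc n) e.symm y
        (mfderiv 𝓘(ℝ, Spc n) 𝓘(ℝ, Spc n) e (e.symm y) w)) = ξ w
      rw [mfderiv_symm_mfderiv he (hKt hyK)]
    rw [metComp, h2] at h1
    have h3 : ‖η v‖ ≤ ‖η‖ * ‖v‖ := η.le_opNorm v
    have h4 : (η v) ^ 2 ≤ (‖η‖ * ‖v‖) ^ 2 := by
      rw [← sq_abs, ← Real.norm_eq_abs]; gcongr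
    calc a * (η v) ^ 2 ≤ a * (‖η‖ * ‖v‖) ^ 2 := by gcongr
      _ = ‖v‖ ^ 2 * (a * ‖η‖ ^ 2) := by ring
      _ ≤ _ := by gcongr
  have h1 := key (Complex.reCLM.comp (X (e.symm y)))
  have h2 := key (Complex.imCLM.comp (X (e.symm y)))
  apply le_of_sq_le_sq _ (by positivity)
  rw [mul_pow, div_pow, Real.sq_sqrt ha.le, Real.sq_sqrt (covQuad_nonneg (c.g_nonneg t _) _),
    div_mul_eq_mul_div, le_div_iff₀ ha, covQuad]
  have h3 : ‖formComp e X v y‖ ^ 2 = (formComp e X v y).re ^ 2 + (formComp e X v y).im ^ 2 := by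
    rw [← Complex.normSq_eq_norm_sq, Complex.normSq_apply]; ring
  rw [h3, mul_add]
  have h1' : a * (formComp e X v y).re ^ 2 ≤ _ := h1
  have h2' : a * (formComp e X v y).im ^ 2 ≤ _ := h2
  linarith

end KGCoeffs

end

section

/-! ### Fatou, Hölder, and limits of covariant differentials -/

section Fatou

variable {X : Type*} [MeasurableSpace X] {μ : Measure X}

theorem lintegral_ofReal_le_of_tendsto {f : ℕ → X → ℝ} {f' : X → ℝ} {B : ℝ≥0∞}
    (hf : ∀ k, AEStronglyMeasurable (f k) μ)
    (hlim : ∀ᵐ x ∂μ, Filter.Tendsto (fun k => f k x) Filter.atTop (nhds (f' x)))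
    (hB : ∀ᶠ k in Filter.atTop, ∫⁻ x, ENNReal.ofReal (f k x) ∂μ ≤ B) :
    ∫⁻ x, ENNReal.ofReal (f' x) ∂μ ≤ B := by
  calc ∫⁻ x, ENNReal.ofReal (f' x) ∂μ
      = ∫⁻ x, Filter.liminf (fun k => ENNReal.ofReal (f k x)) Filter.atTop ∂μ := by
        refine lintegral_congr_ae ?_
        filter_upwards [hlim] with x hx
        exact ((ENNReal.continuous_ofReal.tendsto _).comp hx).liminf_eq.symm
    _ ≤ Filter.liminf (fun k => ∫⁻ x, ENNReal.ofReal (f k x) ∂μ) Filter.atTop :=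
        lintegral_liminf_le' fun k => (hf k).aemeasurable.ennreal_ofReal
    _ ≤ B := by
        refine (Filter.liminf_le_liminf hB).trans ?_
        simp

theorem tendsto_eLpNorm_mul {a : X → ℝ} {b : ℕ → X → ℝ} (ha : MemLp a 2 μ)
    (hb : ∀ j, AEStronglyMeasurable (b j) μ)
    (hlim : Filter.Tendsto (fun j => eLpNorm (b j) 2 μ) Filter.atTop (nhds 0)) :
    Filter.Tendsto (fun j => eLpNorm (fun x => a x * b j x) 1 μ) Filter.atTop (nhds 0) := by
  have h := ENNReal.Tendsto.const_mul (a := eLpNorm a 2 μ) hlim (Or.inr ha.2.ne)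
  rw [mul_zero] at h
  refine tendsto_of_tendsto_of_tendsto_of_le_of_le tendsto_const_nhds h (fun _ => zero_le)
    fun j => ?_
  have h1 : eLpNorm (a • b j) 1 μ ≤ eLpNorm a 2 μ * eLpNorm (b j) 2 μ :=
    eLpNorm_smul_le_mul_eLpNorm (p := 2) (q := 2) (r := 1) (hb j) ha.1
  exact h1

end Fatou

variable {n : ℕ} {S : Type*} [TopologicalSpace S] [ChartedSpace (Spc n) S]
  [MeasurableSpace S] [BorelSpace S] [SecondCountableTopology S] {μ : Measure S}
  [IsManifold 𝓘(ℝ, Spc n) ∞ S]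

theorem FormL2Loc.memLp {τ : OneForm n S ℝ} (h : FormL2Loc τ)
    {e : OpenPartialHomeomorph S (Spc n)} (he : e ∈ atlas (Spc n) S) (v : Spc n)
    {K : Set (Spc n)} (hK : IsCompact K) (hKt : K ⊆ e.target) :
    MemLp (formComp e τ v) 2 (volume.restrict K) := by
  rw [memLp_two_iff_integrable_sq
    ((h e he v).1.mono_measure (Measure.restrict_mono hKt le_rfl))]
  exact (h e he v).2.integrableOn_compact_subset hKt hK

namespace KGCoeffs

variable (c : KGCoeffs n S μ)

theorem covD_sub_ae (hμ : IsSmoothDensity (n := n) μ) (t : ℝ) {u v : Lp ℂ 2 μ}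
    (hu : c.HasWD u) (hv : c.HasWD v) :
    ∀ᵐ x ∂μ, c.covD t (↑(u - v) : S → ℂ) x = c.covD t u x - c.covD t v x := by
  have h := c.covD_add_ae hμ t hu (hv.smul hμ (-1))
  rw [neg_one_smul, ← sub_eq_add_neg] at h
  filter_upwards [h, c.covD_smul_ae hμ t (-1) hv] with x h1 h2
  rw [neg_one_smul] at h2
  rw [h1, h2, neg_one_smul, sub_eq_add_neg]

theorem HasWD.sub {c : KGCoeffs n S μ} (hμ : IsSmoothDensity (n := n) μ) {u v : Lp ℂ 2 μ}
    (hu : c.HasWD u) (hv : c.HasWD v) : c.HasWD (u - v) := by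
  rw [sub_eq_add_neg, ← neg_one_smul ℂ v]
  exact hu.add hμ (hv.smul hμ _)

/-- Pointwise convergence of the covariant differentials along a fast Cauchy sequence. -/
theorem exists_limit_covD (hμ : IsSmoothDensity (n := n) μ) (t : ℝ) {w : ℕ → Lp ℂ 2 μ}
    (hw : ∀ j, c.HasWD (w j))
    (hfast : ∀ j, ∫⁻ x, ENNReal.ofReal (c.dens t (w (j + 1) - w j) x) ∂μ
      ≤ ENNReal.ofReal ((1 / 8) ^ j)) :
    ∃ X : OneForm n S ℂ, ∀ᵐ x ∂μ,
      (∀ v, Filter.Tendsto (fun j => c.covD t (w j) x v) Filter.atTop (nhds (X x v))) ∧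
      ∀ Z, Filter.Tendsto (fun j => covQuad (c.g t x) (c.covD t (w j) x - Z)) Filter.atTop
        (nhds (covQuad (c.g t x) (X x - Z))) := by
  classical
  -- The weight 4^j beats the square root lost in passing from energies to lengths, while 4/8 = 1/2
  -- keeps the series summable. Its finiteness at a.e. x bounds the j-th increment by a constant
  -- times 2^{-j} in length.
  have hsum : ∫⁻ x, ∑' j, ENNReal.ofReal (4 ^ j * c.dens t (w (j + 1) - w j) x) ∂μ ≠ ⊤ := by
    rw [lintegral_tsum fun j => ((c.aestronglyMeasurable_dens hμ t
      ((hw (j + 1)).sub hμ (hw j))).const_mul _).aemeasurable.ennreal_ofReal]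
    have h1 : ∀ j, ∫⁻ x, ENNReal.ofReal (4 ^ j * c.dens t (w (j + 1) - w j) x) ∂μ
        ≤ ENNReal.ofReal ((1 / 2) ^ j) := by
      intro j
      simp only [ENNReal.ofReal_mul (show (0 : ℝ) ≤ 4 ^ j by positivity)]
      rw [lintegral_const_mul' _ _ ENNReal.ofReal_ne_top]
      calc _ ≤ ENNReal.ofReal (4 ^ j) * ENNReal.ofReal ((1 / 8) ^ j) := by gcongr; exact hfast j
        _ = _ := by
          rw [← ENNReal.ofReal_mul (by positivity), ← mul_pow]; norm_num
    refine ne_top_of_le_ne_top ?_ (ENNReal.tsum_le_tsum h1)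
    rw [← ENNReal.ofReal_tsum_of_nonneg (fun j => by positivity) summable_geometric_two]
    exact ENNReal.ofReal_ne_top
  have hae := ae_lt_top' (AEMeasurable.tsum fun j => ((c.aestronglyMeasurable_dens hμ t
      ((hw (j + 1)).sub hμ (hw j))).const_mul (4 ^ j)).aemeasurable.ennreal_ofReal) hsum
  have hlim : ∀ᵐ x ∂μ, ∃ L : TangentSpace 𝓘(ℝ, Spc n) x →L[ℝ] ℂ,
      (∀ v, Filter.Tendsto (fun j => c.covD t (w j) x v) Filter.atTop (nhds (L v))) ∧
      ∀ Z, Filter.Tendsto (fun j => covQuad (c.g t x) (c.covD t (w j) x - Z)) Filter.atTop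
        (nhds (covQuad (c.g t x) (L - Z))) := by
    filter_upwards [hae, ae_all_iff.2 fun j => c.covD_sub_ae hμ t (hw (j + 1)) (hw j)]
      with x hx hsub
    refine exists_limit_of_covQuad_le (V := Spc n) (g := c.g t x) (c.g_pos t x)
      (X := fun j => c.covD t (w j) x)
      (M := (∑' j, ENNReal.ofReal (4 ^ j * c.dens t (w (j + 1) - w j) x)).toReal) fun j => ?_
    have h1 := ENNReal.le_tsum (f := fun j => ENNReal.ofReal
      (4 ^ j * c.dens t (w (j + 1) - w j) x)) j
    have h2 := (ENNReal.ofReal_le_iff_le_toReal hx.ne).1 h1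
    have h3 : covQuad (c.g t x) (c.covD t (w (j + 1)) x - c.covD t (w j) x)
        = c.dens t (w (j + 1) - w j) x := by rw [dens, hsub j]
    refine h3.le.trans ?_
    calc c.dens t (w (j + 1) - w j) x
        = (4 ^ j * c.dens t (w (j + 1) - w j) x) * ((1 / 2) ^ j) ^ 2 := by
          rw [← pow_mul, mul_comm j 2, pow_mul, mul_right_comm, ← mul_pow]; norm_num
      _ ≤ _ := by gcongr
  refine ⟨fun x => if h : _ then Classical.choose (p := fun L : TangentSpace 𝓘(ℝ, Spc n) x →L[ℝ] ℂ
    => (∀ v, Filter.Tendsto (fun j => c.covD t (w j) x v) Filter.atTop (nhds (L v))) ∧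
      ∀ Z, Filter.Tendsto (fun j => covQuad (c.g t x) (c.covD t (w j) x - Z)) Filter.atTop
        (nhds (covQuad (c.g t x) (L - Z)))) h else 0, ?_⟩
  filter_upwards [hlim] with x hx
  rw [dif_pos hx]
  exact hx.choose_spec

/-- Solving X = D^{A,γ} u for du gives the stated one-form. On compact sets the differentials of w_j
converge to it in L¹: ellipticity handles the covariant part, and A, γ⁻¹dγ in L²_loc times w_j - u →
0 in L² handle the rest by Hölder. -/
theorem hasWeakDiff_of_tendsto_covD (hμ : IsSmoothDensity (n := n) μ) (t : ℝ)
    {w : ℕ → Lp ℂ 2 μ} {u : Lp ℂ 2 μ} (hw : ∀ j, c.HasWD (w j))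
    (hlim : Filter.Tendsto w Filter.atTop (nhds u)) {X : OneForm n S ℂ} (hXm : MeasForm X)
    (hX : Filter.Tendsto (fun j => ∫⁻ x, ENNReal.ofReal
      (covQuad (c.g t x) (c.covD t (w j) x - X x)) ∂μ) Filter.atTop (nhds 0)) :
    HasWeakDiff (u : S → ℂ) fun x => Complex.I • (X x + u x • Complex.ofRealCLM.comp (c.A t x)
      - (Complex.I / 2 * u x) • Complex.ofRealCLM.comp (c.θ t x)) := by
  have hm := Lp.aestronglyMeasurable u
  have hwu : ∀ j, AEStronglyMeasurable (fun x => ‖w j x - u x‖) μ := fun j =>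
    ((Lp.aestronglyMeasurable (w j)).sub hm).norm
  have hwlim : Filter.Tendsto (fun j => eLpNorm (fun x => ‖w j x - u x‖) 2 μ) Filter.atTop
      (nhds 0) := by
    have h := (Lp.tendsto_Lp_iff_tendsto_eLpNorm' w u).1 hlim
    refine h.congr fun j => ?_
    rw [← eLpNorm_norm]
    rfl
  have hXj : ∀ j, AEStronglyMeasurable
      (fun x => Real.sqrt (covQuad (c.g t x) (c.covD t (w j) x - X x))) μ := fun j =>
    Real.continuous_sqrt.comp_aestronglyMeasurable (hμ.aestronglyMeasurable_covQuad (c.g_meas t)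
      ((c.measForm_covD hμ t (hw j)).sub hXm))
  have hXlim : Filter.Tendsto (fun j => eLpNorm
      (fun x => Real.sqrt (covQuad (c.g t x) (c.covD t (w j) x - X x))) 2 μ) Filter.atTop
      (nhds 0) := by
    simp only [eLpNorm_sqrt_eq _ (fun x => covQuad_nonneg (c.g_nonneg t x) _)]
    have h := hX.ennrpow_const (1 / 2 : ℝ)
    rwa [ENNReal.zero_rpow_of_pos (by norm_num)] at h
  have hchart : ∀ e ∈ atlas (Spc n) S, ∀ K, IsCompact K → K ⊆ e.target →
      ∀ f : ℕ → S → ℝ, (∀ j, AEStronglyMeasurable (f j) μ) →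
      Filter.Tendsto (fun j => eLpNorm (f j) 2 μ) Filter.atTop (nhds 0) →
      (∀ j, AEStronglyMeasurable (fun y => f j (e.symm y)) (volume.restrict K)) ∧
      Filter.Tendsto (fun j => eLpNorm (fun y => f j (e.symm y)) 2 (volume.restrict K))
        Filter.atTop (nhds 0) := by
    intro e he K hK hKt f hf hlim
    refine ⟨fun j => (hμ.aestronglyMeasurable_chart he (hf j)).mono_measure
      (Measure.restrict_mono hKt le_rfl), ?_⟩
    obtain ⟨C, hC, h⟩ := hμ.exists_eLpNorm_chart_le he hK hKt
    have h2 := ENNReal.Tendsto.const_mul (a := C) hlim (Or.inr hC)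
    rw [mul_zero] at h2
    exact tendsto_of_tendsto_of_tendsto_of_le_of_le tendsto_const_nhds h2 (fun _ => zero_le)
      fun j => h (f j) (hf j)
  have hone : ∀ (a : ℝ) (K : Set (Spc n)), IsCompact K →
      MemLp (fun _ : Spc n => a) 2 (volume.restrict K) := fun a K hK => by
    have : IsFiniteMeasure (volume.restrict K) := ⟨by simpa using hK.measure_lt_top⟩
    exact memLp_const a
  refine HasWeakDiff.of_tendsto (f := fun j => (w j : S → ℂ))
    (τ := fun j => weakDiff (n := n) (w j : S → ℂ))
    (fun j => (hw j).choose_spec.weakDiff)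
    (fun e he => hμ.aestronglyMeasurable_chart he hm) ?_ ?_ ?_
  · exact ((hXm.add ((c.A_locL2 t).measForm.ofReal.smul hμ hm)).sub
      ((c.θ_locL2 t).measForm.ofReal.smul hμ (hm.const_mul (Complex.I / 2)))).smul hμ
      aestronglyMeasurable_const
  · intro e he K hKt hK
    obtain ⟨h1, h2⟩ := hchart e he K hK hKt _ hwu hwlim
    have h3 := tendsto_eLpNorm_mul (hone 1 K hK) h1 h2
    refine tendsto_of_tendsto_of_tendsto_of_le_of_le tendsto_const_nhds h3 (fun _ => zero_le)
      fun j => eLpNorm_mono fun y => ?_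
    simp
  · intro e he v K hKt hK
    obtain ⟨h1, h2⟩ := hchart e he K hK hKt _ hwu hwlim
    obtain ⟨h4, h5⟩ := hchart e he K hK hKt _ hXj hXlim
    obtain ⟨B, hB0, hB⟩ := c.exists_formComp_le t he hK hKt v
    have hA := (c.A_locL2 t).memLp he v hK hKt
    have hθ := (c.θ_locL2 t).memLp he v hK hKt
    have k1 := tendsto_eLpNorm_mul (hone B K hK) h4 h5
    have k2 := tendsto_eLpNorm_mul hA.norm h1 h2
    have k3 := tendsto_eLpNorm_mul hθ.norm h1 h2
    have k := (k1.add k2).add k3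
    simp only [add_zero] at k
    refine tendsto_of_tendsto_of_tendsto_of_le_of_le tendsto_const_nhds k (fun _ => zero_le)
      fun j => ?_
    have m1 := (hone B K hK).1.mul (h4 j)
    have m2 := hA.norm.1.mul (h1 j)
    have m3 := hθ.norm.1.mul (h1 j)
    refine le_trans ?_ ((eLpNorm_add_le (m1.add m2) m3 le_rfl).trans
      (add_le_add (eLpNorm_add_le m1 m2 le_rfl) le_rfl))
    refine eLpNorm_mono_ae ?_
    filter_upwards [hB] with y hy
    have h6 := hy fun x => c.covD t (w j) x - X x
    set x := e.symm y
    set E := mfderiv 𝓘(ℝ, Spc n) 𝓘(ℝ, Spc n) e.symm y v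
    have e1 : formComp e (fun x => c.covD t (w j) x - X x) v y
        = -Complex.I * weakDiff (n := n) (w j : S → ℂ) x E - w j x * (c.A t x E : ℂ)
          + Complex.I / 2 * w j x * (c.θ t x E : ℂ) - X x E := rfl
    rw [e1] at h6
    change ‖weakDiff (n := n) (w j : S → ℂ) x E - Complex.I * (X x E + u x * (c.A t x E : ℂ)
      - (Complex.I / 2 * u x) * (c.θ t x E : ℂ))‖ ≤ ‖B * Real.sqrt (covQuad (c.g t x)
        (c.covD t (w j) x - X x)) + ‖c.A t x E‖ * ‖w j x - u x‖ + ‖c.θ t x E‖ * ‖w j x - u x‖‖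
    have e2 : weakDiff (n := n) (w j : S → ℂ) x E - Complex.I * (X x E + u x * (c.A t x E : ℂ)
      - (Complex.I / 2 * u x) * (c.θ t x E : ℂ)) =
      Complex.I * ((-Complex.I * weakDiff (n := n) (w j : S → ℂ) x E - w j x * (c.A t x E : ℂ)
          + Complex.I / 2 * w j x * (c.θ t x E : ℂ) - X x E) + (c.A t x E : ℂ) * (w j x - u x)
          + -(Complex.I / 2) * ((c.θ t x E : ℂ) * (w j x - u x))) := by
      linear_combination (weakDiff (n := n) (w j : S → ℂ) x E) * Complex.I_mul_I
    rw [e2, norm_mul, Complex.norm_I, one_mul, Real.norm_of_nonneg (by positivity)]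
    refine (norm_add_le _ _).trans (add_le_add ((norm_add_le _ _).trans (add_le_add h6 ?_)) ?_)
    · rw [norm_mul, Complex.norm_real]
    · rw [norm_mul, norm_mul, norm_neg, Complex.norm_real, norm_div, Complex.norm_I]
      have : 0 ≤ ‖c.θ t x E‖ * ‖w j x - u x‖ := by positivity
      rw [show ‖(2 : ℂ)‖ = 2 by norm_num]
      linarith

end KGCoeffs

end

section

/-! ### Closedness of the maximal form and the range of L(t)^{-1/2} -/

section OpSqrt

variable {H : Type*} [NormedAddCommGroup H] [InnerProductSpace ℂ H] [CompleteSpace H]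

theorem opSqrt_opSqrt {R : H →L[ℂ] H} (hR : 0 ≤ R) (f : H) : opSqrt R (opSqrt R f) = R f :=
  congrArg (fun T : H →L[ℂ] H => T f) (CFC.sqrt_mul_sqrt_self R hR)

theorem inner_opSqrt (R : H →L[ℂ] H) (f f' : H) :
    inner ℂ (opSqrt R f) f' = inner ℂ f (opSqrt R f') :=
  ContinuousLinearMap.isSelfAdjoint_iff_isSymmetric.1
    (IsSelfAdjoint.of_nonneg (CFC.sqrt_nonneg R)) f f'

end OpSqrt

variable {n : ℕ} {S : Type*} [TopologicalSpace S] [ChartedSpace (Spc n) S]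
  [MeasurableSpace S] [BorelSpace S] [SecondCountableTopology S] {μ : Measure S}
  [IsManifold 𝓘(ℝ, Spc n) ∞ S]

namespace KGCoeffs

variable (c : KGCoeffs n S μ)

theorem lintegral_dens_eq (t : ℝ) {u : Lp ℂ 2 μ} (hu : u ∈ c.formDom t) :
    ∫⁻ x, ENNReal.ofReal (c.dens t u x) ∂μ = ENNReal.ofReal (∫ x, c.dens t u x ∂μ) :=
  (ofReal_integral_eq_lintegral_ofReal ((c.mem_formDom_iff t u).1 hu).2.1
    (Filter.Eventually.of_forall (c.dens_nonneg t u))).symm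

theorem lintegral_form_self_add_eq (t : ℝ) {u : Lp ℂ 2 μ} (hu : u ∈ c.formDom t) :
    ∫⁻ x, ENNReal.ofReal (c.dens t u x + (c.Y t x + c.lowerK t) * ‖u x‖ ^ 2) ∂μ
      = ENNReal.ofReal ((c.form t u u).re + c.lowerK t * ‖u‖ ^ 2) := by
  rw [c.form_self_add_eq t hu, ofReal_integral_eq_lintegral_ofReal
    (c.integrable_form_self_add t hu)]
  filter_upwards [c.lowerK_spec t] with x hx
  exact add_nonneg (c.dens_nonneg t u x) (mul_nonneg hx (sq_nonneg _))

theorem measForm_of_tendsto (hμ : IsSmoothDensity (n := n) μ) {Z : ℕ → OneForm n S ℂ}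
    {X : OneForm n S ℂ} (hZ : ∀ j, MeasForm (Z j))
    (hX : ∀ᵐ x ∂μ, ∀ v, Filter.Tendsto (fun j => Z j x v) Filter.atTop (nhds (X x v))) :
    MeasForm X := by
  intro e he v
  refine aestronglyMeasurable_of_tendsto_ae Filter.atTop (fun j => hZ j e he v) ?_
  filter_upwards [hμ.ae_chart he hX] with y hy
  exact hy _

/-- For a fast sequence the covariant differentials converge a.e. and in energy to some X, which
must be that of u. Adding K to Ỹ makes the form density non-negative, so Fatou gives both membership
in the domain and the bound. -/
theorem form_closed_of_fast (hμ : IsSmoothDensity (n := n) μ) (t : ℝ) {w : ℕ → Lp ℂ 2 μ}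
    {u : Lp ℂ 2 μ} {C : ℝ} (hw : ∀ j, w j ∈ c.formDom t)
    (hlim : Filter.Tendsto w Filter.atTop (nhds u))
    (hae : ∀ᵐ x ∂μ, Filter.Tendsto (fun j => w j x) Filter.atTop (nhds (u x)))
    (hfast : ∀ j, ∀ k ≥ j, ∫ x, c.dens t (w k - w j) x ∂μ ≤ (1 / 8) ^ j)
    (hC : ∀ ε > 0, ∃ N, ∀ k ≥ N, (c.form t (w k) (w k)).re ≤ C + ε) :
    u ∈ c.formDom t ∧ (c.form t u u).re ≤ C := by
  have hwd : ∀ j, c.HasWD (w j) := fun j => ((c.mem_formDom_iff t _).1 (hw j)).1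
  have hsubmem : ∀ j k, w k - w j ∈ c.formDom t := fun j k =>
    (c.formSubmodule hμ t).sub_mem (hw k) (hw j)
  have hfast' : ∀ j, ∀ k ≥ j, ∫⁻ x, ENNReal.ofReal (c.dens t (w k - w j) x) ∂μ
      ≤ ENNReal.ofReal ((1 / 8) ^ j) := fun j k hk => by
    rw [c.lintegral_dens_eq t (hsubmem j k)]
    exact ENNReal.ofReal_le_ofReal (hfast j k hk)
  obtain ⟨X, hX⟩ := c.exists_limit_covD hμ t hwd fun j => hfast' j (j + 1) (Nat.le_succ j)
  have hXm : MeasForm X := measForm_of_tendsto hμ (fun j => c.measForm_covD hμ t (hwd j))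
    (hX.mono fun x hx => hx.1)
  -- With j fixed, Fatou as k → ∞ gives an energy distance of at most 8^{-j} from the j-th
  -- differential to X.
  have hXlim : Filter.Tendsto (fun j => ∫⁻ x, ENNReal.ofReal
      (covQuad (c.g t x) (c.covD t (w j) x - X x)) ∂μ) Filter.atTop (nhds 0) := by
    have h0 : Filter.Tendsto (fun j : ℕ => ENNReal.ofReal ((1 / 8) ^ j)) Filter.atTop
        (nhds 0) := by
      rw [← ENNReal.ofReal_zero]
      exact (ENNReal.continuous_ofReal.tendsto 0).comp
        (tendsto_pow_atTop_nhds_zero_of_lt_one (by norm_num) (by norm_num))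
    refine tendsto_of_tendsto_of_tendsto_of_le_of_le tendsto_const_nhds h0 (fun _ => zero_le)
      fun j => ?_
    have h1 := lintegral_ofReal_le_of_tendsto (μ := μ)
      (f := fun k x => c.dens t (w k - w j) x)
      (f' := fun x => covQuad (c.g t x) (X x - c.covD t (w j) x))
      (B := ENNReal.ofReal ((1 / 8) ^ j))
      (fun k => c.aestronglyMeasurable_dens hμ t ((hwd k).sub hμ (hwd j))) ?_
      (Filter.eventually_atTop.2 ⟨j, fun k hk => hfast' j k hk⟩)
    · refine le_trans (le_of_eq ?_) h1
      refine lintegral_congr fun x => ?_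
      rw [← neg_sub, ← neg_one_smul ℂ (X x - c.covD t (w j) x), covQuad_smul (c.g_symm t x)]
      simp
    · filter_upwards [hX, ae_all_iff.2 fun k => c.covD_sub_ae hμ t (hwd k) (hwd j)] with x h1 h2
      simp only [dens, h2]
      exact h1.2 _
  have hu : HasWeakDiff (u : S → ℂ) _ := c.hasWeakDiff_of_tendsto_covD hμ t hwd hlim hXm hXlim
  have hcov : ∀ᵐ x ∂μ, c.covD t u x = X x := by
    filter_upwards [hu.weakDiff_ae_eq hμ] with x hx
    ext v
    rw [covD_apply, hx]
    change -Complex.I * (Complex.I * (X x v + u x * (c.A t x v : ℂ)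
      - (Complex.I / 2 * u x) * (c.θ t x v : ℂ))) - u x * (c.A t x v : ℂ)
      + Complex.I / 2 * u x * (c.θ t x v : ℂ) = X x v
    linear_combination (-(X x v + u x * (c.A t x v : ℂ)
      - (Complex.I / 2 * u x) * (c.θ t x v : ℂ))) * Complex.I_mul_I
  have hwdu : c.HasWD u := ⟨_, hu⟩
  have hlimae : ∀ᵐ x ∂μ, Filter.Tendsto
      (fun k => c.dens t (w k) x + (c.Y t x + c.lowerK t) * ‖w k x‖ ^ 2) Filter.atTop
      (nhds (c.dens t u x + (c.Y t x + c.lowerK t) * ‖u x‖ ^ 2)) := by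
    filter_upwards [hX, hae, hcov] with x h1 h2 h3
    refine Filter.Tendsto.add ?_ ((h2.norm.pow 2).const_mul _)
    have := h1.2 0
    simp only [sub_zero] at this
    rwa [dens, h3]
  have hnorm : Filter.Tendsto (fun k => c.lowerK t * ‖w k‖ ^ 2) Filter.atTop
      (nhds (c.lowerK t * ‖u‖ ^ 2)) := (hlim.norm.pow 2).const_mul _
  have hmeas : ∀ v : Lp ℂ 2 μ, c.HasWD v → AEStronglyMeasurable
      (fun x => c.dens t v x + (c.Y t x + c.lowerK t) * ‖v x‖ ^ 2) μ := fun v hv =>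
    (c.aestronglyMeasurable_dens hμ t hv).add (((c.aestronglyMeasurable_Y t).add
      aestronglyMeasurable_const).mul ((Lp.aestronglyMeasurable v).norm.pow 2))
  -- The non-negativity is recorded because `ENNReal.ofReal` truncates at zero, and it is needed to
  -- return to a real inequality at the end.
  have hbound : ∀ ε > 0, 0 ≤ C + c.lowerK t * ‖u‖ ^ 2 + ε ∧
      ∫⁻ x, ENNReal.ofReal (c.dens t u x + (c.Y t x + c.lowerK t) * ‖u x‖ ^ 2) ∂μ
      ≤ ENNReal.ofReal (C + c.lowerK t * ‖u‖ ^ 2 + ε) := by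
    intro ε hε
    obtain ⟨N, hN⟩ := hC (ε / 2) (by positivity)
    have hev : ∀ᶠ k in Filter.atTop, (c.form t (w k) (w k)).re + c.lowerK t * ‖w k‖ ^ 2
        ≤ C + c.lowerK t * ‖u‖ ^ 2 + ε := by
      filter_upwards [Filter.eventually_ge_atTop N, hnorm.eventually
        (Iio_mem_nhds (show c.lowerK t * ‖u‖ ^ 2 < c.lowerK t * ‖u‖ ^ 2 + ε / 2 by linarith))]
        with k hk hk2
      have := hN k hk
      have hk2' : c.lowerK t * ‖w k‖ ^ 2 < c.lowerK t * ‖u‖ ^ 2 + ε / 2 := hk2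
      linarith
    constructor
    · obtain ⟨k, hk⟩ := hev.exists
      exact (c.form_self_add_nonneg t (hw k)).trans hk
    · refine lintegral_ofReal_le_of_tendsto (fun k => hmeas _ (hwd k)) hlimae ?_
      filter_upwards [hev] with k hk
      rw [c.lintegral_form_self_add_eq t (hw k)]
      exact ENNReal.ofReal_le_ofReal hk
  have hnn : 0 ≤ᵐ[μ] fun x => c.dens t u x + (c.Y t x + c.lowerK t) * ‖u x‖ ^ 2 := by
    filter_upwards [c.lowerK_spec t] with x hx
    exact add_nonneg (c.dens_nonneg t u x) (mul_nonneg hx (sq_nonneg _))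
  have hint : Integrable (fun x => c.dens t u x + (c.Y t x + c.lowerK t) * ‖u x‖ ^ 2) μ := by
    refine (lintegral_ofReal_ne_top_iff_integrable (hmeas u hwdu) hnn).1 ?_
    exact ne_top_of_le_ne_top ENNReal.ofReal_ne_top (hbound 1 one_pos).2
  have hint1 : Integrable (c.dens t u) μ := by
    refine hint.mono' (c.aestronglyMeasurable_dens hμ t hwdu) ?_
    filter_upwards [c.lowerK_spec t] with x hx
    rw [Real.norm_of_nonneg (c.dens_nonneg t u x)]
    exact le_add_of_nonneg_right (mul_nonneg hx (sq_nonneg _))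
  have hmem : u ∈ c.formDom t := by
    rw [mem_formDom_iff]
    refine ⟨hwdu, hint1, ?_⟩
    refine ((hint.sub hint1).sub ((integrable_norm_sq u).const_mul (c.lowerK t))).congr
      (Filter.Eventually.of_forall fun x => ?_)
    simp only [Pi.sub_apply]
    ring
  refine ⟨hmem, le_of_forall_pos_le_add fun ε hε => ?_⟩
  obtain ⟨h1, h2⟩ := hbound ε hε
  rw [c.lintegral_form_self_add_eq t hmem, ENNReal.ofReal_le_ofReal_iff h1] at h2
  linarith

/-- The energy is dominated by the form plus K‖·‖², hence is Cauchy along the sequence. One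
subsequence converges a.e., and a further one is fast. -/
theorem form_closed (hμ : IsSmoothDensity (n := n) μ) (t : ℝ) (u : ℕ → Lp ℂ 2 μ)
    (u' : Lp ℂ 2 μ) (C : ℝ) (hu : ∀ k, u k ∈ c.formDom t)
    (hlim : Filter.Tendsto u Filter.atTop (nhds u'))
    (hcauchy : ∀ ε > 0, ∃ N, ∀ j ≥ N, ∀ k ≥ N, (c.form t (u j - u k) (u j - u k)).re ≤ ε)
    (hC : ∀ ε > 0, ∃ N, ∀ k ≥ N, (c.form t (u k) (u k)).re ≤ C + ε) :
    u' ∈ c.formDom t ∧ (c.form t u' u').re ≤ C := by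
  obtain ⟨φ, hφ, hφae⟩ := (tendstoInMeasure_of_tendsto_Lp hlim).exists_seq_tendsto_ae
  have hfast : ∀ j, ∃ N, ∀ k ≥ N, ∀ l ≥ k,
      ∫ x, c.dens t (u (φ l) - u (φ k)) x ∂μ ≤ (1 / 8) ^ j := by
    intro j
    -- Half of the tolerance is spent on the form and half on K‖·‖²; dividing by K + 1 covers K = 0.
    have hpos : (0 : ℝ) < (1 / 8) ^ j / 2 := by positivity
    obtain ⟨N, hN⟩ := hcauchy _ hpos
    have hK := c.lowerK_nonneg t
    obtain ⟨N', hN'⟩ := Metric.cauchySeq_iff.1 hlim.cauchySeq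
      (Real.sqrt ((1 / 8) ^ j / 2 / (c.lowerK t + 1))) (Real.sqrt_pos.2 (by positivity))
    refine ⟨max N N', fun k hk l hl => ?_⟩
    have hk1 : max N N' ≤ φ k := hk.trans (hφ.id_le k)
    have hl1 : max N N' ≤ φ l := (hk.trans hl).trans (hφ.id_le l)
    refine (c.integral_dens_le t ((c.formSubmodule hμ t).sub_mem (hu _) (hu _))).trans ?_
    have h1 := hN (φ l) ((le_max_left _ _).trans hl1) (φ k) ((le_max_left _ _).trans hk1)
    have h2 := hN' (φ l) ((le_max_right _ _).trans hl1) (φ k) ((le_max_right _ _).trans hk1)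
    rw [dist_eq_norm] at h2
    have h3 : ‖u (φ l) - u (φ k)‖ ^ 2 ≤ (1 / 8) ^ j / 2 / (c.lowerK t + 1) := by
      calc _ ≤ (Real.sqrt ((1 / 8) ^ j / 2 / (c.lowerK t + 1))) ^ 2 := by gcongr
        _ = _ := Real.sq_sqrt (by positivity)
    have h4 : c.lowerK t * ‖u (φ l) - u (φ k)‖ ^ 2 ≤ (1 / 8) ^ j / 2 := by
      rw [le_div_iff₀ (by positivity)] at h3
      nlinarith [sq_nonneg ‖u (φ l) - u (φ k)‖]
    linarith
  obtain ⟨ψ, hψ, hψf⟩ := Filter.extraction_forall_of_eventually' hfast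
  refine c.form_closed_of_fast hμ t (w := fun j => u (φ (ψ j))) (fun j => hu _)
    (hlim.comp (hφ.tendsto_atTop.comp hψ.tendsto_atTop)) ?_ ?_ ?_
  · filter_upwards [hφae] with x hx
    exact hx.comp hψ.tendsto_atTop
  · intro j k hk
    exact hψf j (ψ k) (hψ.monotone hk)
  · intro ε hε
    obtain ⟨N, hN⟩ := hC ε hε
    exact ⟨N, fun k hk => hN _ (hk.trans ((hψ.id_le k).trans (hφ.id_le _)))⟩

theorem isClosedForm (hμ : IsSmoothDensity (n := n) μ) (t : ℝ) :
    IsClosedForm (c.formSubmodule hμ t) (c.form t) (c.lowerK t) where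
  add_right _ hu _ hv _ hw := c.form_add_right hμ t hu hv hw
  smul_right z u _ v hv := c.form_smul_right hμ t z u ((c.mem_formDom_iff t v).1 hv).1
  conj_symm := c.form_conj_symm t
  lower_nonneg := c.lowerK_nonneg t
  lower _ hu := c.form_self_add_nonneg t hu
  closed u u' C hu := c.form_closed hμ t u u' C hu

theorem PositiveInvertible.isInverse_Linv {c : KGCoeffs n S μ} {t : ℝ}
    (h : c.PositiveInvertible t) : c.IsInverse t (c.Linv t) := by
  rw [Linv, dif_pos h.2]
  exact h.2.choose_spec

theorem PositiveInvertible.isL {c : KGCoeffs n S μ} {t : ℝ}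
    (h : c.PositiveInvertible t) (f : Lp ℂ 2 μ) : c.IsL t (c.Linv t f) f :=
  (h.isInverse_Linv _ _).2 rfl

theorem PositiveInvertible.Linv_nonneg {c : KGCoeffs n S μ} {t : ℝ}
    (h : c.PositiveInvertible t) : 0 ≤ c.Linv t := by
  rw [ContinuousLinearMap.nonneg_iff_isPositive]
  refine ⟨fun f f' => ?_, fun f => ?_⟩
  · change inner ℂ (c.Linv t f) f' = inner ℂ f (c.Linv t f')
    rw [(h.isL f').2 _ (h.isL f).1, ← inner_conj_symm, (h.isL f).2 _ (h.isL f').1,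
      c.form_conj_symm]
  · exact h.1 _ _ (h.isL f)

theorem PositiveInvertible.LinvSqrt_LinvSqrt {c : KGCoeffs n S μ} {t : ℝ}
    (h : c.PositiveInvertible t) (f : Lp ℂ 2 μ) :
    c.LinvSqrt t (c.LinvSqrt t f) = c.Linv t f :=
  opSqrt_opSqrt h.Linv_nonneg f

theorem inner_LinvSqrt (t : ℝ) (f f' : Lp ℂ 2 μ) :
    inner ℂ (c.LinvSqrt t f) f' = inner ℂ f (c.LinvSqrt t f') :=
  inner_opSqrt _ f f'

/-- Both directions matter: the first controls the form on the range, the second writes an element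
of dom l_t as L(t)^{-1/2} v' when it was produced at another time. -/
theorem PositiveInvertible.range_LinvSqrt {c : KGCoeffs n S μ}
    (hμ : IsSmoothDensity (n := n) μ) {t : ℝ} (h : c.PositiveInvertible t) :
    (∀ v, c.LinvSqrt t v ∈ c.formDom t ∧
      (c.form t (c.LinvSqrt t v) (c.LinvSqrt t v)).re ≤ ‖v‖ ^ 2) ∧
    ∀ u ∈ c.formDom t, ∃ v, c.LinvSqrt t v = u ∧ ‖v‖ ^ 2 ≤ (c.form t u u).re := by
  refine (c.isClosedForm hμ t).range_sqrt (c.inner_LinvSqrt t) (fun f => ?_) fun f u hu => ?_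
  · rw [h.LinvSqrt_LinvSqrt]
    exact (h.isL f).1
  · rw [h.LinvSqrt_LinvSqrt]
    exact (h.isL f).2 u hu

end KGCoeffs

end

section

open scoped Interval


/-! ### An integral Minkowski inequality and pointwise time integration -/

section WeightedJensen

/-- A weighted Jensen inequality for the quadratic form of a positive bilinear form. -/
theorem ofReal_bilin_le_lintegral {V : Type*} [AddCommGroup V] [Module ℝ V]
    {b : LinearMap.BilinForm ℝ V} (hs : ∀ ξ η, b ξ η = b η ξ) (hp : ∀ ξ, 0 ≤ b ξ ξ)
    {a : ℝ → V} {A : V} {s t : ℝ} {C : ℝ → ℝ} (hC : IntegrableOn C (Ι s t))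
    (hC1 : ∀ r, 1 ≤ C r) (hA : b A A = ∫ r in s..t, b (a r) A) :
    ENNReal.ofReal (b A A) ≤
      ∫⁻ r in Ι s t, ENNReal.ofReal ((∫ r in Ι s t, C r) / C r * b (a r) (a r)) := by
  set J := ∫ r in Ι s t, C r
  rcases eq_or_ne s t with rfl | hst
  · rw [hA]; simp
  have hJ : 0 < J := by
    have : IsFiniteMeasure (volume.restrict (Ι s t)) := by rw [uIoc]; infer_instance
    have h1 : ∫ r in Ι s t, (1 : ℝ) ≤ J :=
      integral_mono (integrable_const _) hC hC1
    have h2 : ∫ r in Ι s t, (1 : ℝ) = |t - s| := by simp [measureReal_def, abs_nonneg]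
    rw [h2] at h1
    exact lt_of_lt_of_le (abs_pos.2 (sub_ne_zero.2 hst.symm)) h1
  have hb := hp A
  have h1 : ENNReal.ofReal (b A A) ≤ ∫⁻ r in Ι s t, ENNReal.ofReal |b (a r) A| := by
    have h2 : ‖b A A‖ = ‖∫ r in Ι s t, b (a r) A‖ := by
      rw [hA, intervalIntegral.norm_intervalIntegral_eq]
    have h3 := enorm_integral_le_lintegral_enorm (μ := volume.restrict (Ι s t))
      (fun r => b (a r) A)
    rw [← ofReal_norm, ← h2, Real.norm_of_nonneg hb] at h3
    refine h3.trans (le_of_eq (lintegral_congr fun r => ?_))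
    rw [← ofReal_norm, Real.norm_eq_abs]
  -- Young's inequality with weights J/C(r) and C(r)/J. The second weight has integral one, so one
  -- copy of b(A, A) is absorbed on the left.
  have h2 : 2 * ENNReal.ofReal (b A A) ≤
      (∫⁻ r in Ι s t, ENNReal.ofReal (J / C r * b (a r) (a r))) + ENNReal.ofReal (b A A) := by
    have h3 : ∫⁻ r in Ι s t, ENNReal.ofReal (C r / J * b A A) = ENNReal.ofReal (b A A) := by
      rw [← ofReal_integral_eq_lintegral_ofReal ((hC.div_const J).mul_const _)
        (Filter.Eventually.of_forall fun r =>
          mul_nonneg (div_nonneg (zero_le_one.trans (hC1 r)) hJ.le) hb),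
        integral_mul_const, integral_div, div_self hJ.ne', one_mul]
    calc 2 * ENNReal.ofReal (b A A)
        ≤ 2 * ∫⁻ r in Ι s t, ENNReal.ofReal |b (a r) A| := by gcongr
      _ = ∫⁻ r in Ι s t, 2 * ENNReal.ofReal |b (a r) A| := by
          rw [lintegral_const_mul' _ _ (by norm_num)]
      _ ≤ ∫⁻ r in Ι s t, (ENNReal.ofReal (J / C r * b (a r) (a r))
            + ENNReal.ofReal (C r / J * b A A)) := by
          refine lintegral_mono fun r => ?_
          have hr : 0 < C r := lt_of_lt_of_le one_pos (hC1 r)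
          have h4 := two_mul_abs_bilin_le hs hp (div_pos hJ hr) (a r) A
          rw [inv_div] at h4
          rw [← ENNReal.ofReal_add (mul_nonneg (div_pos hJ hr).le (hp _))
            (mul_nonneg (div_pos hr hJ).le hb)]
          calc 2 * ENNReal.ofReal |b (a r) A| = ENNReal.ofReal (2 * |b (a r) A|) := by
                rw [ENNReal.ofReal_mul zero_le_two, ENNReal.ofReal_ofNat]
            _ ≤ _ := ENNReal.ofReal_le_ofReal h4
      _ = _ := by
          rw [lintegral_add_right' _
            ((hC.aestronglyMeasurable.aemeasurable.div_const J).mul_const _).ennreal_ofReal, h3]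
  rw [two_mul] at h2
  exact (ENNReal.add_le_add_iff_right ENNReal.ofReal_ne_top).1 h2

/-- This is Minkowski's inequality in squared form. After Tonelli, the weight J/C(r) against the
bound C(r)²N leaves J C(r) N, whose integral is J²N. -/
theorem lintegral_weighted_le {X : Type*} [MeasurableSpace X] {μ : Measure X} [SFinite μ]
    {s t : ℝ} {C : ℝ → ℝ} (hC : IntegrableOn C (Ι s t)) (hC1 : ∀ r, 1 ≤ C r)
    {q : X → ℝ} {f : ℝ → X → ℝ} {N : ℝ} (hN : 0 ≤ N)
    (hf : AEStronglyMeasurable (fun p : ℝ × X => f p.1 p.2) ((volume : Measure ℝ).prod μ))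
    (hq : ∀ᵐ x ∂μ, ENNReal.ofReal (q x) ≤
      ∫⁻ r in Ι s t, ENNReal.ofReal ((∫ r in Ι s t, C r) / C r * f r x))
    (hfN : ∀ᵐ r ∂(volume.restrict (Ι s t)),
      ∫⁻ x, ENNReal.ofReal (f r x) ∂μ ≤ ENNReal.ofReal (C r ^ 2 * N)) :
    ∫⁻ x, ENNReal.ofReal (q x) ∂μ ≤ ENNReal.ofReal ((∫ r in Ι s t, C r) ^ 2 * N) := by
  set J := ∫ r in Ι s t, C r
  have hC0 : ∀ r, 0 < C r := fun r => lt_of_lt_of_le one_pos (hC1 r)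
  have hJ : 0 ≤ J := integral_nonneg fun r => (hC0 r).le
  have hCm : AEMeasurable C (volume.restrict (Ι s t)) := hC.aestronglyMeasurable.aemeasurable
  have hfm : AEMeasurable (fun p : X × ℝ => ENNReal.ofReal (J / C p.2 * f p.2 p.1))
      (μ.prod (volume.restrict (Ι s t))) := by
    have h1 : AEMeasurable (fun p : ℝ × X => f p.1 p.2) ((volume.restrict (Ι s t)).prod μ) := by
      refine hf.aemeasurable.mono_measure ?_
      exact Measure.prod_mono Measure.restrict_le_self le_rfl
    have h2 : AEMeasurable (fun p : X × ℝ => f p.2 p.1) (μ.prod (volume.restrict (Ι s t))) :=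
      h1.prod_swap
    exact (((hCm.comp_snd).const_div J).mul h2).ennreal_ofReal
  calc ∫⁻ x, ENNReal.ofReal (q x) ∂μ
      ≤ ∫⁻ x, (∫⁻ r in Ι s t, ENNReal.ofReal (J / C r * f r x)) ∂μ := lintegral_mono_ae hq
    _ = ∫⁻ r in Ι s t, ∫⁻ x, ENNReal.ofReal (J / C r * f r x) ∂μ :=
        lintegral_lintegral_swap hfm
    _ ≤ ∫⁻ r in Ι s t, ENNReal.ofReal (C r * (J * N)) := by
        refine lintegral_mono_ae ?_
        filter_upwards [hfN] with r hr
        have h0 : 0 ≤ J / C r := div_nonneg hJ (hC0 r).le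
        simp only [ENNReal.ofReal_mul h0]
        rw [lintegral_const_mul' _ _ ENNReal.ofReal_ne_top]
        calc _ ≤ ENNReal.ofReal (J / C r) * ENNReal.ofReal (C r ^ 2 * N) := by gcongr
          _ = _ := by
            rw [← ENNReal.ofReal_mul h0]
            congr 1
            field_simp [(hC0 r).ne']
    _ = _ := by
        rw [← ofReal_integral_eq_lintegral_ofReal (hC.mul_const _)
          (Filter.Eventually.of_forall fun r => mul_nonneg (hC0 r).le (mul_nonneg hJ hN)),
          integral_mul_const]
        congr 1
        ring

end WeightedJensen

variable {n : ℕ} {S : Type*} [TopologicalSpace S] [ChartedSpace (Spc n) S]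
  [MeasurableSpace S] [BorelSpace S] [SecondCountableTopology S] {μ : Measure S}
  [IsManifold 𝓘(ℝ, Spc n) ∞ S]

section TimeDerivatives

/-- A finite sum of integrals with constant coefficients. -/
theorem intervalIntegral_sum_smul {ι E : Type*} [NormedAddCommGroup E] [NormedSpace ℝ E]
    [CompleteSpace E] (I : Finset ι) {f df : ι → ℝ → ℝ} (a : ι → E) {s t : ℝ}
    (h : ∀ i ∈ I, IntervalIntegrable (df i) volume s t ∧ f i t - f i s = ∫ r in s..t, df i r) :
    IntervalIntegrable (fun r => ∑ i ∈ I, df i r • a i) volume s t ∧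
      (∑ i ∈ I, f i t • a i) - ∑ i ∈ I, f i s • a i = ∫ r in s..t, ∑ i ∈ I, df i r • a i := by
  have hi : ∀ i ∈ I, IntervalIntegrable (fun r => df i r • a i) volume s t := fun i hi =>
    ⟨(h i hi).1.1.smul_const _, (h i hi).1.2.smul_const _⟩
  refine ⟨?_, ?_⟩
  · have := IntervalIntegrable.sum I hi
    refine this.congr ?_
    exact fun r _ => by simp
  · rw [intervalIntegral.integral_finsetSum hi, ← Finset.sum_sub_distrib]
    refine Finset.sum_congr rfl fun i hi => ?_
    rw [intervalIntegral.integral_smul_const, ← (h i hi).2, sub_smul]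

/-- The exceptional set comes from the finitely many frame components and so does not depend on ℓ.
This allows functionals that vary with the point. -/
theorem IsFormTimeDeriv.ae_linear (hμ : IsSmoothDensity (n := n) μ) {τ dτ : ℝ → OneForm n S ℝ}
    (h : IsFormTimeDeriv τ dτ) (s t : ℝ) :
    ∀ᵐ x ∂μ, ∀ ℓ : (TangentSpace 𝓘(ℝ, Spc n) x →L[ℝ] ℝ) →ₗ[ℝ] ℝ,
      IntervalIntegrable (fun r => ℓ (dτ r x)) volume s t ∧
      ℓ (τ t x) - ℓ (τ s x) = ∫ r in s..t, ℓ (dτ r x) := by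
  refine hμ.ae_of_chart fun e he => ?_
  filter_upwards [ae_restrict_mem (measurableSet_target e),
    ae_all_iff.2 fun i => (h e he (stdVec i)).2 s t] with y hy hi ℓ
  have key : ∀ ξ : TangentSpace 𝓘(ℝ, Spc n) (e.symm y) →L[ℝ] ℝ, ℓ ξ = ∑ i,
      ξ (mfderiv 𝓘(ℝ, Spc n) 𝓘(ℝ, Spc n) e.symm y (stdVec i)) •
      ℓ (coordCovector e (EuclideanSpace.proj i) (e.symm y)) := by
    intro ξ
    conv_lhs => rw [covector_eq_sum he hy ξ]
    simp only [map_sum, map_smul]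
  have h2 := intervalIntegral_sum_smul Finset.univ
    (fun i => ℓ (coordCovector e (EuclideanSpace.proj i) (e.symm y)))
    (f := fun i r => formComp e (τ r) (stdVec i) y)
    (df := fun i r => formComp e (dτ r) (stdVec i) y) (fun i _ => hi i)
  rw [key (τ t _), key (τ s _), show (fun r => ℓ (dτ r (e.symm y))) = _ from
    funext fun r => key (dτ r (e.symm y))]
  exact h2

theorem IsVecTimeDeriv.ae_apply (hμ : IsSmoothDensity (n := n) μ) {β dβ : ℝ → VecField n S}
    (h : IsVecTimeDeriv β dβ) (τ : OneForm n S ℂ) (s t : ℝ) :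
    ∀ᵐ x ∂μ, IntervalIntegrable (fun r => τ x (dβ r x)) volume s t ∧
      τ x (β t x) - τ x (β s x) = ∫ r in s..t, τ x (dβ r x) := by
  refine hμ.ae_of_chart fun e he => ?_
  filter_upwards [ae_restrict_mem (measurableSet_target e),
    ae_all_iff.2 fun i => (h e he (EuclideanSpace.proj i)).2 s t] with y hy hi
  have h2 := intervalIntegral_sum_smul Finset.univ
    (fun i => formComp e τ (stdVec i) y)
    (f := fun i r => vecComp e (β r) (EuclideanSpace.proj i) y)
    (df := fun i r => vecComp e (dβ r) (EuclideanSpace.proj i) y) (fun i _ => hi i)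
  simp only [vec_apply_eq_sum he hy τ]
  exact h2

theorem IsMetTimeDeriv.ae_apply (hμ : IsSmoothDensity (n := n) μ) {g dg : ℝ → CoMetric n S}
    (h : IsMetTimeDeriv g dg) (s t : ℝ) :
    ∀ᵐ x ∂μ, ∀ ξ : TangentSpace 𝓘(ℝ, Spc n) x →L[ℝ] ℝ,
      IntervalIntegrable (fun r => dg r x ξ ξ) volume s t ∧
      g t x ξ ξ - g s x ξ ξ = ∫ r in s..t, dg r x ξ ξ := by
  refine hμ.ae_of_chart fun e he => ?_
  filter_upwards [ae_restrict_mem (measurableSet_target e),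
    ae_all_iff.2 fun i => ae_all_iff.2 fun j =>
      (h e he (EuclideanSpace.proj i) (EuclideanSpace.proj j)).2 s t] with y hy hi ξ
  have key : ∀ b : CoMetric n S, b (e.symm y) ξ ξ = ∑ p : Fin n × Fin n,
      metComp e b (EuclideanSpace.proj p.1) (EuclideanSpace.proj p.2) y •
      (ξ (mfderiv 𝓘(ℝ, Spc n) 𝓘(ℝ, Spc n) e.symm y (stdVec p.1)) *
      ξ (mfderiv 𝓘(ℝ, Spc n) 𝓘(ℝ, Spc n) e.symm y (stdVec p.2))) := by
    intro b
    rw [comet_apply_eq_sum he hy b ξ ξ, Fintype.sum_prod_type]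
    exact Finset.sum_congr rfl fun i _ => Finset.sum_congr rfl fun j _ => mul_comm _ _
  have h2 := intervalIntegral_sum_smul Finset.univ
    (fun p : Fin n × Fin n => ξ (mfderiv 𝓘(ℝ, Spc n) 𝓘(ℝ, Spc n) e.symm y (stdVec p.1)) *
      ξ (mfderiv 𝓘(ℝ, Spc n) 𝓘(ℝ, Spc n) e.symm y (stdVec p.2)))
    (f := fun p r => metComp e (g r) (EuclideanSpace.proj p.1) (EuclideanSpace.proj p.2) y)
    (df := fun p r => metComp e (dg r) (EuclideanSpace.proj p.1) (EuclideanSpace.proj p.2) y)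
    (fun p _ => hi p.1 p.2)
  simp only [key]
  exact h2

theorem IsFormTimeDeriv.jointMeas {τ dτ : ℝ → OneForm n S ℝ} (h : IsFormTimeDeriv τ dτ) :
    JointMeasForm dτ := fun e he v => (h e he v).1

theorem IsVecTimeDeriv.jointMeas {β dβ : ℝ → VecField n S} (h : IsVecTimeDeriv β dβ) :
    JointMeasVec dβ := fun e he v => (h e he v).1

theorem IsMetTimeDeriv.jointMeas {g dg : ℝ → CoMetric n S} (h : IsMetTimeDeriv g dg) :
    JointMeasMet dg := fun e he η ζ => (h e he η ζ).1

theorem JointMeasMet.of_static {g : CoMetric n S}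
    (hg : ∀ e ∈ atlas (Spc n) S, ∀ η ζ : Spc n →L[ℝ] ℝ,
      AEStronglyMeasurable (metComp e g η ζ) (volume.restrict e.target)) :
    JointMeasMet (fun _ => g) := fun e he η ζ => (hg e he η ζ).comp_snd

end TimeDerivatives

end

/-! ### Time increments of one-forms, of the metric, and of W -/

section

open scoped Interval


theorem uIoc_subset_Icc_of_abs_sub_le {s t : ℝ} (h : |t - s| ≤ 1) :
    Ι s t ⊆ Icc (t - 1) (t + 1) := by
  obtain ⟨h1, h2⟩ := abs_le.1 h
  intro r hr
  rw [uIoc, mem_Ioc] at hr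
  constructor
  · rcases min_choice s t with h3 | h3 <;> rw [h3] at hr <;> linarith [hr.1]
  · rcases max_choice s t with h3 | h3 <;> rw [h3] at hr <;> linarith [hr.2]

theorem LocallyIntegrable.integrableOn_uIoc {D : ℝ → ℝ} (hD : LocallyIntegrable D) (s t : ℝ) :
    IntegrableOn D (Ι s t) :=
  (hD.integrableOn_isCompact isCompact_uIcc).mono_set uIoc_subset_uIcc

theorem abs_sub_le_setIntegral {D : ℝ → ℝ} (hD : LocallyIntegrable D) (hD1 : ∀ r, 1 ≤ D r)
    (s t : ℝ) : |t - s| ≤ ∫ r in Ι s t, D r := by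
  have : IsFiniteMeasure (volume.restrict (Ι s t)) := by rw [uIoc]; infer_instance
  have h1 : ∫ r in Ι s t, (1 : ℝ) ≤ ∫ r in Ι s t, D r :=
    integral_mono (integrable_const _) (LocallyIntegrable.integrableOn_uIoc hD s t) hD1
  have h2 : ∫ r in Ι s t, (1 : ℝ) = |t - s| := by simp [measureReal_def, abs_nonneg]
  rwa [h2] at h1

theorem exists_memLp_norm_le {X : Type*} [MeasurableSpace X] {μ : Measure X} {f : X → ℂ} {a : ℝ}
    (ha : 0 ≤ a) (hf : AEStronglyMeasurable f μ)
    (h : ∫⁻ x, ENNReal.ofReal (‖f x‖ ^ 2) ∂μ ≤ ENNReal.ofReal (a ^ 2)) :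
    ∃ hm : MemLp f 2 μ, ‖hm.toLp‖ ≤ a := by
  have h1 : ∀ x, ‖f x‖ = Real.sqrt (‖f x‖ ^ 2) := fun x => (Real.sqrt_sq (norm_nonneg _)).symm
  have h2 : eLpNorm f 2 μ ≤ ENNReal.ofReal a := by
    rw [← eLpNorm_norm, show (fun x => ‖f x‖) = fun x => Real.sqrt (‖f x‖ ^ 2) from funext h1,
      eLpNorm_sqrt_eq _ (fun x => sq_nonneg _)]
    calc _ ≤ (ENNReal.ofReal (a ^ 2)) ^ (1 / 2 : ℝ) := by gcongr
      _ = ENNReal.ofReal a := by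
        rw [ENNReal.ofReal_rpow_of_nonneg (sq_nonneg _) (by norm_num), ← Real.sqrt_eq_rpow,
          Real.sqrt_sq ha]
  have hm : MemLp f 2 μ := ⟨hf, h2.trans_lt ENNReal.ofReal_lt_top⟩
  refine ⟨hm, ?_⟩
  rw [Lp.norm_toLp]
  exact ENNReal.toReal_le_of_le_ofReal ha h2

variable {n : ℕ} {S : Type*} [TopologicalSpace S] [ChartedSpace (Spc n) S]
  [MeasurableSpace S] [BorelSpace S] [SecondCountableTopology S] {μ : Measure S}
  [IsManifold 𝓘(ℝ, Spc n) ∞ S]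

namespace KGCoeffs

variable (c : KGCoeffs n S μ)

theorem FormMulBound.mono {c : KGCoeffs n S μ} {t : ℝ} {τ : OneForm n S ℝ} {C C' : ℝ}
    (h : c.FormMulBound t τ C) (hC : C ≤ C') : c.FormMulBound t τ C' := fun v =>
  (h v).trans (ENNReal.ofReal_le_ofReal (by gcongr))

/-- The hypothesis, squared: the integrated form fits Tonelli better than the norm. -/
theorem FormMulBound.lintegral_le {c : KGCoeffs n S μ} {t : ℝ} {τ : OneForm n S ℝ} {C : ℝ}
    (h : c.FormMulBound t τ C) (hC : 0 ≤ C) (v : Lp ℂ 2 μ) :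
    ∫⁻ x, ENNReal.ofReal (‖c.LinvSqrt t v x‖ ^ 2 * c.g t x (τ x) (τ x)) ∂μ
      ≤ ENNReal.ofReal (C ^ 2 * ‖v‖ ^ 2) := by
  have h1 := h v
  rw [formNorm] at h1
  simp only [cForm_self_re, covQuad_smul_ofReal (c.g_symm t _)] at h1
  have h2 := ENNReal.rpow_le_rpow h1 (z := 2) (by norm_num)
  rw [← ENNReal.rpow_mul] at h2
  rw [show (1 / 2 : ℝ) * 2 = 1 by norm_num, ENNReal.rpow_one, ENNReal.rpow_ofNat,
    ← ENNReal.ofReal_pow (by positivity), mul_pow] at h2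
  exact h2

variable {c}

/-- Jensen in time at each point of the manifold, then Tonelli and the relative bound at each time:
the L² size of the increment is at most J‖v‖. -/
theorem lintegral_form_sub_le (hμ : IsSmoothDensity (n := n) μ) {τ dτ : ℝ → OneForm n S ℝ}
    (hτ : IsFormTimeDeriv τ dτ) {D : ℝ → ℝ} (hD : LocallyIntegrable D) (hD1 : ∀ r, 1 ≤ D r)
    {s t : ℝ} (hst : |t - s| ≤ 1)
    (hb : ∀ᵐ r ∂(volume.restrict (Icc (t - 1) (t + 1))), c.FormMulBound t (dτ r) (D r))
    (v : Lp ℂ 2 μ) :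
    ∫⁻ x, ENNReal.ofReal (‖c.LinvSqrt t v x‖ ^ 2 *
        c.g t x (τ t x - τ s x) (τ t x - τ s x)) ∂μ
      ≤ ENNReal.ofReal ((∫ r in Ι s t, D r) ^ 2 * ‖v‖ ^ 2) := by
  have := hμ.sfinite
  have hDi := LocallyIntegrable.integrableOn_uIoc hD s t
  set u := c.LinvSqrt t v
  refine lintegral_weighted_le hDi hD1 (f := fun r x => ‖u x‖ ^ 2 * c.g t x (dτ r x) (dτ r x))
    (sq_nonneg _) ?_ ?_ ?_
  · exact ((Lp.aestronglyMeasurable u).norm.pow 2).comp_snd.mul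
      ((JointMeasMet.of_static (c.g_meas t)).apply hμ hτ.jointMeas hτ.jointMeas)
  · filter_upwards [hτ.ae_linear hμ s t] with x hx
    -- The functional is pairing with the increment itself, as required by the weighted Jensen
    -- inequality.
    have h1 := (hx ((c.g t x).flip (τ t x - τ s x))).2
    rw [← map_sub] at h1
    have h2 := ofReal_bilin_le_lintegral (c.g_symm t x) (c.g_nonneg t x) hDi hD1 h1
    rw [ENNReal.ofReal_mul (sq_nonneg _)]
    have h3 : ∀ r, (∫ r in Ι s t, D r) / D r * (‖u x‖ ^ 2 * c.g t x (dτ r x) (dτ r x))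
      = ‖u x‖ ^ 2 * ((∫ r in Ι s t, D r) / D r * c.g t x (dτ r x) (dτ r x)) := fun r => by ring
    simp only [h3, ENNReal.ofReal_mul (sq_nonneg ‖u x‖)]
    rw [lintegral_const_mul' _ _ ENNReal.ofReal_ne_top]
    gcongr
  · filter_upwards [ae_restrict_of_ae_restrict_of_subset (uIoc_subset_Icc_of_abs_sub_le hst) hb]
      with r hr
    exact hr.lintegral_le (zero_le_one.trans (hD1 r)) v

/-- The bound on the derivative of the metric is pointwise, so it integrates directly by Tonelli; no
Jensen step is needed. -/
theorem lintegral_metric_sub_le (hμ : IsSmoothDensity (n := n) μ) {dg : ℝ → CoMetric n S}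
    (hdg : IsMetTimeDeriv c.g dg) {D : ℝ → ℝ} (hD : LocallyIntegrable D) (hD0 : ∀ r, 0 ≤ D r)
    {s t : ℝ} (hst : |t - s| ≤ 1)
    (hb : ∀ᵐ r ∂(volume.restrict (Icc (t - 1) (t + 1))), ∀ᵐ x ∂μ,
      ∀ ξ : TangentSpace 𝓘(ℝ, Spc n) x →L[ℝ] ℝ, |dg r x ξ ξ| ≤ D r * c.g t x ξ ξ)
    {X : OneForm n S ℂ} (hX : MeasForm X) :
    ∫⁻ x, ENNReal.ofReal |covQuad (c.g s x) (X x) - covQuad (c.g t x) (X x)| ∂μ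
      ≤ ENNReal.ofReal (∫ r in Ι s t, D r) *
        ∫⁻ x, ENNReal.ofReal (covQuad (c.g t x) (X x)) ∂μ := by
  have := hμ.sfinite
  have hDi := LocallyIntegrable.integrableOn_uIoc hD s t
  have hm : AEStronglyMeasurable (fun p : ℝ × S => covQuad (dg p.1 p.2) (X p.2))
      ((volume : Measure ℝ).prod μ) :=
    (hdg.jointMeas.apply hμ hX.re.joint hX.re.joint).add
      (hdg.jointMeas.apply hμ hX.im.joint hX.im.joint)
  have hm' : AEMeasurable (fun p : S × ℝ => ENNReal.ofReal |covQuad (dg p.2 p.1) (X p.1)|)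
      (μ.prod (volume.restrict (Ι s t))) := by
    have h1 : AEMeasurable (fun p : ℝ × S => |covQuad (dg p.1 p.2) (X p.2)|)
        ((volume.restrict (Ι s t)).prod μ) :=
      hm.norm.aemeasurable.mono_measure (Measure.prod_mono Measure.restrict_le_self le_rfl)
    exact h1.prod_swap.ennreal_ofReal
  calc ∫⁻ x, ENNReal.ofReal |covQuad (c.g s x) (X x) - covQuad (c.g t x) (X x)| ∂μ
      ≤ ∫⁻ x, (∫⁻ r in Ι s t, ENNReal.ofReal |covQuad (dg r x) (X x)|) ∂μ := by
        refine lintegral_mono_ae ?_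
        filter_upwards [hdg.ae_apply hμ s t] with x hx
        have h1 := hx (Complex.reCLM.comp (X x))
        have h2 := hx (Complex.imCLM.comp (X x))
        have h3 : covQuad (c.g t x) (X x) - covQuad (c.g s x) (X x)
            = ∫ r in s..t, covQuad (dg r x) (X x) := by
          simp only [covQuad]
          rw [intervalIntegral.integral_add h1.1 h2.1, ← h1.2, ← h2.2]
          ring
        rw [abs_sub_comm, h3, ← Real.norm_eq_abs, intervalIntegral.norm_intervalIntegral_eq,
          ofReal_norm]
        refine (enorm_integral_le_lintegral_enorm _).trans (le_of_eq (lintegral_congr fun r => ?_))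
        rw [← ofReal_norm, Real.norm_eq_abs]
    _ = ∫⁻ r in Ι s t, ∫⁻ x, ENNReal.ofReal |covQuad (dg r x) (X x)| ∂μ :=
        lintegral_lintegral_swap hm'
    _ ≤ ∫⁻ r in Ι s t, ENNReal.ofReal (D r) *
          ∫⁻ x, ENNReal.ofReal (covQuad (c.g t x) (X x)) ∂μ := by
        refine lintegral_mono_ae ?_
        filter_upwards [ae_restrict_of_ae_restrict_of_subset
          (uIoc_subset_Icc_of_abs_sub_le hst) hb] with r hr
        rw [← lintegral_const_mul' _ _ ENNReal.ofReal_ne_top]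
        refine lintegral_mono_ae ?_
        filter_upwards [hr] with x hx
        rw [← ENNReal.ofReal_mul (hD0 r)]
        refine ENNReal.ofReal_le_ofReal ((abs_add_le _ _).trans ?_)
        rw [covQuad, mul_add]
        exact add_le_add (hx _) (hx _)
    _ = _ := by
        rw [lintegral_mul_const'' _ hDi.aestronglyMeasurable.aemeasurable.ennreal_ofReal,
          ofReal_integral_eq_lintegral_ofReal hDi (Filter.Eventually.of_forall hD0)]

/-- At almost every point the increment of W u is the time integral of the derivative operator
applied to u. Minkowski then bounds its L² norm by J‖v‖, and linearity in v makes it an operator. -/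
theorem exists_W_sub (hμ : IsSmoothDensity (n := n) μ) {t : ℝ} (hLt : c.PositiveInvertible t)
    {dβ : ℝ → VecField n S} (hdβ : IsVecTimeDeriv c.β dβ)
    {dw : ℝ → S → ℂ} (hdw : IsTimeDeriv μ c.wCoeff dw)
    {D : ℝ → ℝ} (hD : LocallyIntegrable D) (hD1 : ∀ r, 1 ≤ D r)
    {s : ℝ} (hst : |t - s| ≤ 1)
    (hb : ∀ᵐ r ∂(volume.restrict (Icc (t - 1) (t + 1))), ∃ B : Lp ℂ 2 μ →L[ℂ] Lp ℂ 2 μ,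
        (∀ v, (B v : S → ℂ) =ᵐ[μ] firstOrder (dβ r) (dw r) (c.LinvSqrt t v)) ∧ ‖B‖ ≤ D r) :
    ∃ B : Lp ℂ 2 μ →L[ℂ] Lp ℂ 2 μ,
      (∀ v, (B v : S → ℂ) =ᵐ[μ]
        fun x => c.W t (c.LinvSqrt t v) x - c.W s (c.LinvSqrt t v) x) ∧
      ‖B‖ ≤ ∫ r in Ι s t, D r := by
  have := hμ.sfinite
  have hDi := LocallyIntegrable.integrableOn_uIoc hD s t
  set J := ∫ r in Ι s t, D r
  have hJ : 0 ≤ J := (abs_nonneg _).trans (abs_sub_le_setIntegral hD hD1 s t)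
  have hwd : ∀ v, c.HasWD (c.LinvSqrt t v) := fun v =>
    ((c.mem_formDom_iff t _).1 ((hLt.range_LinvSqrt hμ).1 v).1).1
  have hdiff : ∀ v, ∀ᵐ x ∂μ,
      IntervalIntegrable (fun r => firstOrder (dβ r) (dw r) (c.LinvSqrt t v) x) volume s t ∧
      c.W t (c.LinvSqrt t v) x - c.W s (c.LinvSqrt t v) x =
        ∫ r in s..t, firstOrder (dβ r) (dw r) (c.LinvSqrt t v) x := by
    intro v
    filter_upwards [hdβ.ae_apply hμ (weakDiff (n := n) (c.LinvSqrt t v : S → ℂ)) s t,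
      hdw.2 s t] with x h1 h2
    have h3 := h1.1.const_mul Complex.I
    have h4 := h2.1.mul_const (c.LinvSqrt t v x)
    refine ⟨h3.add h4, ?_⟩
    simp only [W, firstOrder]
    rw [intervalIntegral.integral_add h3 h4, intervalIntegral.integral_const_mul,
      intervalIntegral.integral_mul_const, ← h1.2, ← h2.2]
    ring
  have hjoint : ∀ v, AEStronglyMeasurable
      (fun p : ℝ × S => firstOrder (dβ p.1) (dw p.1) (c.LinvSqrt t v) p.2)
      ((volume : Measure ℝ).prod μ) := by
    intro v
    obtain ⟨σ, hσ⟩ := hwd v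
    exact ((hdβ.jointMeas.apply hμ hσ.weakDiff.measForm).const_mul Complex.I).add
      (hdw.1.mul (Lp.aestronglyMeasurable (c.LinvSqrt t v)).comp_snd)
  -- Measurability of the increment comes from its representation as a time integral of a jointly
  -- measurable function; the coefficients of W(t) at a fixed time carry no measurability
  -- assumption.
  have hmeas : ∀ v, AEStronglyMeasurable
      (fun x => c.W t (c.LinvSqrt t v) x - c.W s (c.LinvSqrt t v) x) μ := by
    intro v
    have h1 : AEStronglyMeasurable
        (fun p : S × ℝ => firstOrder (dβ p.2) (dw p.2) (c.LinvSqrt t v) p.1)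
        (μ.prod (volume : Measure ℝ)) := (hjoint v).prod_swap
    have h2 : ∀ a b : ℝ, AEStronglyMeasurable
        (fun x => ∫ r in Ioc a b, firstOrder (dβ r) (dw r) (c.LinvSqrt t v) x) μ := fun a b =>
      (h1.mono_measure (Measure.prod_mono le_rfl Measure.restrict_le_self)).integral_prod_right'
    refine ((h2 s t).sub (h2 t s)).congr ?_
    filter_upwards [hdiff v] with x hx
    rw [hx.2]
    rfl
  have hlint : ∀ v, ∫⁻ x, ENNReal.ofReal
      (‖c.W t (c.LinvSqrt t v) x - c.W s (c.LinvSqrt t v) x‖ ^ 2) ∂μ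
      ≤ ENNReal.ofReal ((J * ‖v‖) ^ 2) := by
    intro v
    rw [mul_pow]
    refine lintegral_weighted_le hDi hD1
      (f := fun r x => ‖firstOrder (dβ r) (dw r) (c.LinvSqrt t v) x‖ ^ 2) (sq_nonneg _)
      ((hjoint v).norm.pow 2) ?_ ?_
    · filter_upwards [hdiff v] with x hx
      -- The plane ℂ is treated as a real inner product space, so the complex-valued increment fits
      -- the bilinear Jensen inequality.
      have h1 := ofReal_bilin_le_lintegral (b := innerₗ ℂ)
        (a := fun r => firstOrder (dβ r) (dw r) (c.LinvSqrt t v) x)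
        (A := c.W t (c.LinvSqrt t v) x - c.W s (c.LinvSqrt t v) x)
        (fun ξ η => by simp [real_inner_comm]) (fun ξ => by simp) hDi hD1 (by
          simp only [innerₗ_apply_apply]
          have h2 := ((innerSL ℝ (c.W t (c.LinvSqrt t v) x -
            c.W s (c.LinvSqrt t v) x))).intervalIntegral_comp_comm hx.1
          simp only [innerSL_apply_apply] at h2
          rw [← hx.2] at h2
          rw [← h2]
          exact intervalIntegral.integral_congr fun r _ => real_inner_comm _ _)
      simpa only [innerₗ_apply_apply, real_inner_self_eq_norm_sq] using h1
    · filter_upwards [ae_restrict_of_ae_restrict_of_subset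
        (uIoc_subset_Icc_of_abs_sub_le hst) hb] with r ⟨B, hB, hBD⟩
      have h1 : ∫⁻ x, ENNReal.ofReal (‖firstOrder (dβ r) (dw r) (c.LinvSqrt t v) x‖ ^ 2) ∂μ
          = ∫⁻ x, ENNReal.ofReal (‖B v x‖ ^ 2) ∂μ := by
        refine lintegral_congr_ae ?_
        filter_upwards [hB v] with x hx
        rw [hx]
      rw [h1, lintegral_norm_sq]
      refine ENNReal.ofReal_le_ofReal ?_
      rw [← mul_pow]
      gcongr
      exact (B.le_opNorm v).trans (by gcongr)
  have hLp := fun v => exists_memLp_norm_le (mul_nonneg hJ (norm_nonneg v)) (hmeas v) (hlint v)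
  choose hmem hnorm using hLp
  let B₀ : Lp ℂ 2 μ →ₗ[ℂ] Lp ℂ 2 μ :=
    { toFun := fun v => (hmem v).toLp
      map_add' := fun v v' => by
        refine Lp.ext ?_
        filter_upwards [(hmem (v + v')).coeFn_toLp, (hmem v).coeFn_toLp, (hmem v').coeFn_toLp,
          Lp.coeFn_add (hmem v).toLp (hmem v').toLp, c.weakDiff_add_ae hμ (hwd v) (hwd v'),
          Lp.coeFn_add (c.LinvSqrt t v) (c.LinvSqrt t v')] with x h1 h2 h3 h4 h5 h6
        rw [h1, h4, Pi.add_apply, h2, h3]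
        simp only [W, firstOrder, map_add, h5, h6, add_apply, Pi.add_apply]
        ring
      map_smul' := fun z v => by
        refine Lp.ext ?_
        filter_upwards [(hmem (z • v)).coeFn_toLp, (hmem v).coeFn_toLp,
          Lp.coeFn_smul z (hmem v).toLp, c.weakDiff_smul_ae hμ z (hwd v),
          Lp.coeFn_smul z (c.LinvSqrt t v)] with x h1 h2 h3 h4 h5
        rw [h1, RingHom.id_apply, h3, Pi.smul_apply, h2]
        simp only [W, firstOrder, map_smul, h4, h5, smul_apply, Pi.smul_apply, smul_eq_mul]
        ring }
  refine ⟨B₀.mkContinuous J hnorm, fun v => (hmem v).coeFn_toLp,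
    B₀.mkContinuous_norm_le hJ hnorm⟩

end KGCoeffs

end

/-! ### Increment of the energy density -/

section

open scoped Interval


variable {n : ℕ} {S : Type*} [TopologicalSpace S] [ChartedSpace (Spc n) S]
  [MeasurableSpace S] [BorelSpace S] [SecondCountableTopology S] {μ : Measure S}
  [IsManifold 𝓘(ℝ, Spc n) ∞ S]

namespace KGCoeffs

variable {c : KGCoeffs n S μ}

theorem covD_eq_add (c : KGCoeffs n S μ) (s t : ℝ) (u : S → ℂ) (x : S) :
    c.covD s u x = c.covD t u x + (u x • Complex.ofRealCLM.comp (c.A t x - c.A s x)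
      + (Complex.I / 2 * u x) • Complex.ofRealCLM.comp (c.θ s x - c.θ t x)) := by
  ext w
  rw [add_apply, covD_apply, covD_apply, add_apply, smul_apply, smul_apply]
  simp only [ContinuousLinearMap.comp_apply, Complex.ofRealCLM_apply, sub_apply, smul_eq_mul]
  push_cast
  ring

theorem covQuad_covD_diff_le (c : KGCoeffs n S μ) (s t : ℝ) (u : S → ℂ) (x : S) :
    covQuad (c.g t x) (u x • Complex.ofRealCLM.comp (c.A t x - c.A s x)
      + (Complex.I / 2 * u x) • Complex.ofRealCLM.comp (c.θ s x - c.θ t x))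
    ≤ ‖u x‖ ^ 2 * c.g t x (c.A t x - c.A s x) (c.A t x - c.A s x)
      + ‖u x‖ ^ 2 * c.g t x (c.θ t x - c.θ s x) (c.θ t x - c.θ s x) := by
  rw [covQuad_ofReal_add (c.g_symm t x)]
  have h1 : c.g t x (c.θ s x - c.θ t x) (c.θ s x - c.θ t x)
      = c.g t x (c.θ t x - c.θ s x) (c.θ t x - c.θ s x) := by
    rw [← neg_sub (c.θ t x)]
    simp only [map_neg, LinearMap.neg_apply, neg_neg]
  rw [h1]
  have := mul_nonneg (sq_nonneg ‖u x‖) (c.g_nonneg t x (c.θ t x - c.θ s x))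
  linarith

/-- With Z the change of the covariant differential, ‖Z‖_t² ≤ 2J²‖v‖². The metric change costs J(2E
+ 4J²‖v‖²), and the change of differential costs J E + (1 + 1/J) 2J²‖v‖²; every term carries a
factor J. -/
theorem lintegral_dens_sub_le (hμ : IsSmoothDensity (n := n) μ)
    {dA dθ : ℝ → OneForm n S ℝ} {dg : ℝ → CoMetric n S}
    (hdA : IsFormTimeDeriv c.A dA) (hdθ : IsFormTimeDeriv c.θ dθ) (hdg : IsMetTimeDeriv c.g dg)
    {D : ℝ → ℝ} (hD : LocallyIntegrable D) (hD1 : ∀ r, 1 ≤ D r) {s t : ℝ} (hst : |t - s| ≤ 1)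
    (hbA : ∀ᵐ r ∂(volume.restrict (Icc (t - 1) (t + 1))), c.FormMulBound t (dA r) (D r))
    (hbθ : ∀ᵐ r ∂(volume.restrict (Icc (t - 1) (t + 1))), c.FormMulBound t (dθ r) (D r))
    (hbg : ∀ᵐ r ∂(volume.restrict (Icc (t - 1) (t + 1))), ∀ᵐ x ∂μ,
      ∀ ξ : TangentSpace 𝓘(ℝ, Spc n) x →L[ℝ] ℝ, |dg r x ξ ξ| ≤ D r * c.g t x ξ ξ)
    {v : Lp ℂ 2 μ} (hv : c.LinvSqrt t v ∈ c.formDom t) {J : ℝ} (hJ : J = ∫ r in Ι s t, D r) :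
    ∫⁻ x, ENNReal.ofReal |c.dens s (c.LinvSqrt t v) x - c.dens t (c.LinvSqrt t v) x| ∂μ
      ≤ ENNReal.ofReal (J * (3 * (∫ x, c.dens t (c.LinvSqrt t v) x ∂μ)
          + (4 * J ^ 2 + 2 * J + 2) * ‖v‖ ^ 2)) := by
  -- For s ≠ t the integral J is positive, since D ≥ 1, and can serve as the Young parameter.
  rcases eq_or_ne s t with rfl | hne
  · simp
  have hJ0 : 0 < J := by
    rw [hJ]
    exact lt_of_lt_of_le (abs_pos.2 (sub_ne_zero.2 hne.symm)) (abs_sub_le_setIntegral hD hD1 s t)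
  have hA := lintegral_form_sub_le (c := c) hμ hdA hD hD1 hst hbA v
  have hθ := lintegral_form_sub_le (c := c) hμ hdθ hD hD1 hst hbθ v
  set u := c.LinvSqrt t v
  have hwd : c.HasWD u := ((c.mem_formDom_iff t u).1 hv).1
  have hg := lintegral_metric_sub_le (c := c) hμ hdg hD (fun r => zero_le_one.trans (hD1 r)) hst
    hbg (c.measForm_covD hμ s hwd)
  rw [← hJ] at hA hθ hg
  have hE := c.lintegral_dens_eq t hv
  set E := ∫ x, c.dens t u x ∂μ
  have hE0 : 0 ≤ E := integral_nonneg (c.dens_nonneg t u)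
  let Z : OneForm n S ℂ := fun x => u x • Complex.ofRealCLM.comp (c.A t x - c.A s x)
      + (Complex.I / 2 * u x) • Complex.ofRealCLM.comp (c.θ s x - c.θ t x)
  have hZm : AEMeasurable (fun x => ENNReal.ofReal (covQuad (c.g t x) (Z x))) μ := by
    have h1 : MeasForm Z := by
      have h2 : Z = fun x => c.covD s u x + (-1 : ℂ) • c.covD t u x := by
        funext x
        rw [c.covD_eq_add s t]
        simp only [Z, neg_smul, one_smul]
        abel
      rw [h2]
      exact (c.measForm_covD hμ s hwd).add
        ((c.measForm_covD hμ t hwd).smul hμ aestronglyMeasurable_const)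
    exact (hμ.aestronglyMeasurable_covQuad (c.g_meas t) h1).aemeasurable.ennreal_ofReal
  have hdm : AEMeasurable (fun x => ENNReal.ofReal (c.dens t u x)) μ :=
    (c.aestronglyMeasurable_dens hμ t hwd).aemeasurable.ennreal_ofReal
  have hXm : AEMeasurable (fun x => ENNReal.ofReal
      |covQuad (c.g s x) (c.covD s u x) - covQuad (c.g t x) (c.covD s u x)|) μ :=
    ((hμ.aestronglyMeasurable_covQuad (c.g_meas s) (c.measForm_covD hμ s hwd)).sub
      (hμ.aestronglyMeasurable_covQuad (c.g_meas t)
        (c.measForm_covD hμ s hwd))).norm.aemeasurable.ennreal_ofReal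
  have hAm : AEMeasurable (fun x => ENNReal.ofReal (‖u x‖ ^ 2 *
      c.g t x (c.A t x - c.A s x) (c.A t x - c.A s x))) μ := by
    have h1 : MeasForm (fun x => c.A t x - c.A s x) := (c.A_locL2 t).measForm.sub
      (c.A_locL2 s).measForm
    have h2 : AEStronglyMeasurable (fun x => c.g t x (c.A t x - c.A s x) (c.A t x - c.A s x)) μ :=
      hμ.aestronglyMeasurable_bilin (c.g_meas t) h1 h1
    exact (((Lp.aestronglyMeasurable u).norm.pow 2).mul h2).aemeasurable.ennreal_ofReal
  have hZ : ∫⁻ x, ENNReal.ofReal (covQuad (c.g t x) (Z x)) ∂μ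
      ≤ ENNReal.ofReal (2 * (J ^ 2 * ‖v‖ ^ 2)) := by
    calc _ ≤ ∫⁻ x, (ENNReal.ofReal (‖u x‖ ^ 2 * c.g t x (c.A t x - c.A s x) (c.A t x - c.A s x))
          + ENNReal.ofReal (‖u x‖ ^ 2 * c.g t x (c.θ t x - c.θ s x) (c.θ t x - c.θ s x))) ∂μ :=
          lintegral_mono fun x => (ENNReal.ofReal_le_ofReal (c.covQuad_covD_diff_le s t u x)).trans
            ENNReal.ofReal_add_le
      _ ≤ ENNReal.ofReal (J ^ 2 * ‖v‖ ^ 2) + ENNReal.ofReal (J ^ 2 * ‖v‖ ^ 2) := by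
          rw [lintegral_add_left' hAm]
          exact add_le_add hA hθ
      _ = _ := by rw [← ENNReal.ofReal_add (by positivity) (by positivity), two_mul]
  have hX : ∫⁻ x, ENNReal.ofReal (covQuad (c.g t x) (c.covD s u x)) ∂μ
      ≤ ENNReal.ofReal (2 * E + 2 * (2 * (J ^ 2 * ‖v‖ ^ 2))) := by
    calc _ ≤ ∫⁻ x, (ENNReal.ofReal 2 * ENNReal.ofReal (c.dens t u x)
          + ENNReal.ofReal 2 * ENNReal.ofReal (covQuad (c.g t x) (Z x))) ∂μ := by
          refine lintegral_mono fun x => ?_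
          rw [c.covD_eq_add s t, ← ENNReal.ofReal_mul zero_le_two, ← ENNReal.ofReal_mul zero_le_two]
          exact (ENNReal.ofReal_le_ofReal (covQuad_add_le (c.g_symm t x) (c.g_nonneg t x) _ _)).trans
            ENNReal.ofReal_add_le
      _ ≤ ENNReal.ofReal 2 * ENNReal.ofReal E
          + ENNReal.ofReal 2 * ENNReal.ofReal (2 * (J ^ 2 * ‖v‖ ^ 2)) := by
          rw [lintegral_add_left' (hdm.const_mul _),
            lintegral_const_mul' _ _ ENNReal.ofReal_ne_top,
            lintegral_const_mul' _ _ ENNReal.ofReal_ne_top, hE]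
          gcongr
      _ = _ := by
          rw [← ENNReal.ofReal_mul zero_le_two, ← ENNReal.ofReal_mul zero_le_two,
            ← ENNReal.ofReal_add (by positivity) (by positivity)]
  have hr : 0 ≤ 1 + J⁻¹ := by positivity
  -- The intermediate term is the differential at time s measured with the metric at time t. Young's
  -- parameter J balances the cross term, because ‖Z‖_t is itself of order J.
  calc _ ≤ ∫⁻ x, (ENNReal.ofReal
            |covQuad (c.g s x) (c.covD s u x) - covQuad (c.g t x) (c.covD s u x)|
          + (ENNReal.ofReal J * ENNReal.ofReal (c.dens t u x)
          + ENNReal.ofReal (1 + J⁻¹) * ENNReal.ofReal (covQuad (c.g t x) (Z x)))) ∂μ := by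
        refine lintegral_mono fun x => ?_
        rw [← ENNReal.ofReal_mul hJ0.le, ← ENNReal.ofReal_mul hr,
          ← ENNReal.ofReal_add (mul_nonneg hJ0.le (c.dens_nonneg t u x))
            (mul_nonneg hr (covQuad_nonneg (c.g_nonneg t x) _)),
          ← ENNReal.ofReal_add (abs_nonneg _) (add_nonneg
            (mul_nonneg hJ0.le (c.dens_nonneg t u x))
            (mul_nonneg hr (covQuad_nonneg (c.g_nonneg t x) _)))]
        refine ENNReal.ofReal_le_ofReal ?_
        have h1 := abs_covQuad_add_sub_le (c.g_symm t x) (c.g_nonneg t x) hJ0 (c.covD t u x) (Z x)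
        rw [← c.covD_eq_add s t] at h1
        refine (abs_sub_le _ (covQuad (c.g t x) (c.covD s u x)) _).trans ?_
        exact add_le_add le_rfl h1
    _ ≤ ENNReal.ofReal J * ENNReal.ofReal (2 * E + 2 * (2 * (J ^ 2 * ‖v‖ ^ 2)))
          + (ENNReal.ofReal J * ENNReal.ofReal E
          + ENNReal.ofReal (1 + J⁻¹) * ENNReal.ofReal (2 * (J ^ 2 * ‖v‖ ^ 2))) := by
        rw [lintegral_add_left' hXm, lintegral_add_left' (hdm.const_mul _),
            lintegral_const_mul' _ _ ENNReal.ofReal_ne_top,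
            lintegral_const_mul' _ _ ENNReal.ofReal_ne_top, hE]
        gcongr
        exact hg.trans (by gcongr)
    _ = _ := by
        rw [← ENNReal.ofReal_mul hJ0.le, ← ENNReal.ofReal_mul hJ0.le, ← ENNReal.ofReal_mul hr,
          ← ENNReal.ofReal_add (by positivity) (by positivity),
          ← ENNReal.ofReal_add (by positivity) (by positivity)]
        congr 1
        field_simp
        ring

end KGCoeffs

end

/-! ### Increment of the potential and of the full form -/

section

open scoped Interval


theorem exists_subseq_tendsto_ae {X : Type*} [MeasurableSpace X] {μ : Measure X}
    {u : ℕ → Lp ℂ 2 μ} {u' : Lp ℂ 2 μ} (h : Filter.Tendsto u Filter.atTop (nhds u')) :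
    ∃ ns : ℕ → ℕ, StrictMono ns ∧ ∀ᵐ x ∂μ,
      Filter.Tendsto (fun i => u (ns i) x) Filter.atTop (nhds (u' x)) :=
  (tendstoInMeasure_of_tendsto_Lp h).exists_seq_tendsto_ae

variable {n : ℕ} {S : Type*} [TopologicalSpace S] [ChartedSpace (Spc n) S]
  [MeasurableSpace S] [BorelSpace S] [SecondCountableTopology S] {μ : Measure S}
  [IsManifold 𝓘(ℝ, Spc n) ∞ S]

namespace KGCoeffs

variable {c : KGCoeffs n S μ}

/-- The bounds on the time derivatives of the coefficients of `L`, relative to `L(t)`, with a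
common rate `D ≥ 1`. -/
structure HasRate (c : KGCoeffs n S μ) (dY : ℝ → S → ℝ) (dA dθ : ℝ → OneForm n S ℝ)
    (dg : ℝ → CoMetric n S) (D : ℝ → ℝ) (t : ℝ) : Prop where
  dense : Dense (c.potDom dY t)
  pot : ∀ v ∈ c.potDom dY t, ∀ᵐ s ∂(volume.restrict (Icc (t - 1) (t + 1))),
    ‖∫ x, (starRingEnd ℂ) (c.LinvSqrt t v x) * (dY s x : ℂ) * c.LinvSqrt t v x ∂μ‖
      ≤ D s * ‖v‖ * ‖v‖
  formA : ∀ᵐ s ∂(volume.restrict (Icc (t - 1) (t + 1))), c.FormMulBound t (dA s) (D s)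
  formθ : ∀ᵐ s ∂(volume.restrict (Icc (t - 1) (t + 1))), c.FormMulBound t (dθ s) (D s)
  metric : ∀ᵐ s ∂(volume.restrict (Icc (t - 1) (t + 1))), ∀ᵐ x ∂μ,
    ∀ ξ : TangentSpace 𝓘(ℝ, Spc n) x →L[ℝ] ℝ, |dg s x ξ ξ| ≤ D s * c.g t x ξ ξ

/-- The time derivatives of the coefficients of `L`. -/
structure HasCoeffDeriv (c : KGCoeffs n S μ) (dY : ℝ → S → ℝ) (dA dθ : ℝ → OneForm n S ℝ)
    (dg : ℝ → CoMetric n S) : Prop where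
  pot : IsTimeDeriv μ c.Y dY
  formA : IsFormTimeDeriv c.A dA
  formθ : IsFormTimeDeriv c.θ dθ
  metric : IsMetTimeDeriv c.g dg

variable {dY : ℝ → S → ℝ} {dA dθ : ℝ → OneForm n S ℝ} {dg : ℝ → CoMetric n S} {D : ℝ → ℝ}

/-- Joint integrability on `potDom` permits Fubini: the increment becomes the time integral of the
quadratic forms of ∂Ỹ, each bounded by D‖v‖². -/
theorem pot_sub_le (hμ : IsSmoothDensity (n := n) μ) (hdY : IsTimeDeriv μ c.Y dY)
    (hD : LocallyIntegrable D) {s t : ℝ} (hst : |t - s| ≤ 1) (h : c.HasRate dY dA dθ dg D t)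
    {v : Lp ℂ 2 μ} (hv : v ∈ c.potDom dY t)
    (hY : Integrable (fun x => c.Y t x * ‖c.LinvSqrt t v x‖ ^ 2) μ) :
    Integrable (fun x => c.Y s x * ‖c.LinvSqrt t v x‖ ^ 2) μ ∧
    |∫ x, c.Y t x * ‖c.LinvSqrt t v x‖ ^ 2 ∂μ - ∫ x, c.Y s x * ‖c.LinvSqrt t v x‖ ^ 2 ∂μ|
      ≤ (∫ r in Ι s t, D r) * ‖v‖ ^ 2 := by
  have := hμ.sfinite
  have hDi := LocallyIntegrable.integrableOn_uIoc hD s t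
  have hpot := h.pot v hv
  have hv' : Integrable (fun p : ℝ × S => dY p.1 p.2 * ‖c.LinvSqrt t v p.2‖ ^ 2)
    ((volume.restrict (Icc (t - 1) (t + 1))).prod μ) := hv
  set u := c.LinvSqrt t v
  have hsub := uIoc_subset_Icc_of_abs_sub_le hst
  have hF : Integrable (fun p : ℝ × S => dY p.1 p.2 * ‖u p.2‖ ^ 2)
      ((volume.restrict (Ι s t)).prod μ) :=
    hv'.mono_measure (Measure.prod_mono (Measure.restrict_mono hsub le_rfl) le_rfl)
  set G : S → ℝ := fun x => ∫ r in Ι s t, dY r x * ‖u x‖ ^ 2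
  have hG : Integrable G μ := hF.integral_prod_right
  -- The sign of the oriented integral from s to t relative to the unoriented one.
  set σ : ℝ := if s ≤ t then 1 else -1
  have hσ : |σ| = 1 := by simp only [σ]; split_ifs <;> simp
  have hdiff : ∀ᵐ x ∂μ, c.Y t x * ‖u x‖ ^ 2 - σ * G x = c.Y s x * ‖u x‖ ^ 2 := by
    filter_upwards [hdY.2 s t] with x hx
    have h1 : σ * G x = (∫ r in s..t, dY r x) * ‖u x‖ ^ 2 := by
      rw [← intervalIntegral.integral_mul_const,
        intervalIntegral.intervalIntegral_eq_integral_uIoc, smul_eq_mul]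
    rw [h1, ← hx.2]
    ring
  have hs : Integrable (fun x => c.Y s x * ‖u x‖ ^ 2) μ :=
    (hY.sub (hG.const_mul σ)).congr hdiff
  refine ⟨hs, ?_⟩
  have h1 : ∫ x, c.Y t x * ‖u x‖ ^ 2 ∂μ - ∫ x, c.Y s x * ‖u x‖ ^ 2 ∂μ = σ * ∫ x, G x ∂μ := by
    rw [← integral_congr_ae hdiff, integral_sub hY (hG.const_mul σ), integral_const_mul]
    ring
  have h2 : ∫ x, G x ∂μ = ∫ r in Ι s t, ∫ x, dY r x * ‖u x‖ ^ 2 ∂μ :=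
    (integral_integral_swap (f := fun r x => dY r x * ‖u x‖ ^ 2) hF).symm
  rw [h1, abs_mul, hσ, one_mul, h2, ← integral_mul_const, ← Real.norm_eq_abs]
  refine norm_integral_le_of_norm_le (hDi.mul_const _) ?_
  filter_upwards [ae_restrict_of_ae_restrict_of_subset hsub hpot] with r hr
  have h3 : ∫ x, (starRingEnd ℂ) (u x) * (dY r x : ℂ) * u x ∂μ
      = ((∫ x, dY r x * ‖u x‖ ^ 2 ∂μ : ℝ) : ℂ) := by
    rw [← integral_complex_ofReal]
    refine integral_congr_ae (Filter.Eventually.of_forall fun x => ?_)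
    simp only
    push_cast
    rw [← Complex.conj_mul']
    ring
  rw [h3, Complex.norm_real] at hr
  exact hr.trans (le_of_eq (by ring))

theorem dens_sub_le (hμ : IsSmoothDensity (n := n) μ) (hd : c.HasCoeffDeriv dY dA dθ dg)
    (hD : LocallyIntegrable D) (hD1 : ∀ r, 1 ≤ D r) {s t : ℝ} (hst : |t - s| ≤ 1)
    (h : c.HasRate dY dA dθ dg D t) {v : Lp ℂ 2 μ} (hv : c.LinvSqrt t v ∈ c.formDom t)
    {J : ℝ} (hJ : J = ∫ r in Ι s t, D r) :
    Integrable (c.dens s (c.LinvSqrt t v)) μ ∧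
    |∫ x, c.dens t (c.LinvSqrt t v) x ∂μ - ∫ x, c.dens s (c.LinvSqrt t v) x ∂μ|
      ≤ J * (3 * (∫ x, c.dens t (c.LinvSqrt t v) x ∂μ) + (4 * J ^ 2 + 2 * J + 2) * ‖v‖ ^ 2) := by
  have hl := lintegral_dens_sub_le hμ hd.formA hd.formθ hd.metric hD hD1 hst h.formA h.formθ
    h.metric hv hJ
  have hJ0 : 0 ≤ J := hJ ▸ (abs_nonneg _).trans (abs_sub_le_setIntegral hD hD1 s t)
  set u := c.LinvSqrt t v
  have hu := (c.mem_formDom_iff t u).1 hv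
  have hE0 : 0 ≤ ∫ x, c.dens t u x ∂μ := integral_nonneg (c.dens_nonneg t u)
  have hm : Integrable (fun x => c.dens s u x - c.dens t u x) μ := by
    refine ⟨(c.aestronglyMeasurable_dens hμ s hu.1).sub hu.2.1.1, ?_⟩
    rw [hasFiniteIntegral_iff_norm]
    exact hl.trans_lt ENNReal.ofReal_lt_top
  have hs : Integrable (c.dens s u) μ := by
    refine (hm.add hu.2.1).congr (Filter.Eventually.of_forall fun x => ?_)
    simp
  refine ⟨hs, ?_⟩
  rw [abs_sub_comm, ← integral_sub hs hu.2.1]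
  refine (abs_integral_le_integral_abs).trans ?_
  rw [integral_eq_lintegral_of_nonneg_ae (Filter.Eventually.of_forall fun x => abs_nonneg _)
    hm.1.norm]
  exact ENNReal.toReal_le_of_le_ofReal (by positivity) hl

theorem integral_Y_le (t : ℝ) {u : Lp ℂ 2 μ} (hu : u ∈ c.formDom t) :
    ∫ x, c.Y t x * ‖u x‖ ^ 2 ∂μ ≤ (c.form t u u).re := by
  rw [c.form_self_re t hu]
  exact le_add_of_nonneg_left (integral_nonneg (c.dens_nonneg t u))

/-- On the dense set the bound follows from l_t(u,u) ≤ ‖v‖² and the potential increment. The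
integrand is non-negative after adding K, so Fatou along an approximating sequence extends the bound
to every v. -/
theorem lintegral_Y_le_of_dense (hμ : IsSmoothDensity (n := n) μ)
    (hd : c.HasCoeffDeriv dY dA dθ dg) (hD : LocallyIntegrable D) {s t : ℝ} (hst : |t - s| ≤ 1)
    (hLt : c.PositiveInvertible t) (h : c.HasRate dY dA dθ dg D t) (v : Lp ℂ 2 μ) :
    ∫⁻ x, ENNReal.ofReal ((c.Y s x + c.lowerK s) * ‖c.LinvSqrt t v x‖ ^ 2) ∂μ
      ≤ ENNReal.ofReal ((1 + (∫ r in Ι s t, D r) + c.lowerK s * ‖c.LinvSqrt t‖ ^ 2) * ‖v‖ ^ 2) := by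
  set C := 1 + (∫ r in Ι s t, D r) + c.lowerK s * ‖c.LinvSqrt t‖ ^ 2
  have hpot : ∀ w ∈ c.potDom dY t,
      ∫⁻ x, ENNReal.ofReal ((c.Y s x + c.lowerK s) * ‖c.LinvSqrt t w x‖ ^ 2) ∂μ
        ≤ ENNReal.ofReal (C * ‖w‖ ^ 2) := by
    intro w hw
    have h1 := (hLt.range_LinvSqrt hμ).1 w
    have h2 := pot_sub_le hμ hd.pot hD hst h hw ((c.mem_formDom_iff t _).1 h1.1).2.2
    have h3 := (c.integral_Y_le t h1.1).trans h1.2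
    have h4 := (integrable_norm_sq (c.LinvSqrt t w)).const_mul (c.lowerK s)
    have h5 : Integrable (fun x => (c.Y s x + c.lowerK s) * ‖c.LinvSqrt t w x‖ ^ 2) μ := by
      simp only [add_mul]
      exact h2.1.add h4
    rw [← ofReal_integral_eq_lintegral_ofReal h5 (by
      filter_upwards [c.lowerK_spec s] with x hx using mul_nonneg hx (sq_nonneg _))]
    refine ENNReal.ofReal_le_ofReal ?_
    simp only [add_mul]
    rw [integral_add h2.1 h4, integral_const_mul, ← norm_sq_eq_integral]
    have h6 : ‖c.LinvSqrt t w‖ ^ 2 ≤ ‖c.LinvSqrt t‖ ^ 2 * ‖w‖ ^ 2 := by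
      rw [← mul_pow]
      gcongr
      exact (c.LinvSqrt t).le_opNorm w
    have h7 := mul_le_mul_of_nonneg_left h6 (c.lowerK_nonneg s)
    have h8 := (abs_le.1 h2.2).1
    simp only [C, add_mul]
    linarith
  obtain ⟨w, hw, hwv⟩ := mem_closure_iff_seq_limit.1 (h.dense v)
  obtain ⟨ns, hns, hae⟩ := exists_subseq_tendsto_ae
    (((c.LinvSqrt t).continuous.tendsto v).comp hwv)
  -- The bounds along the sequence only converge to the claimed one, so an arbitrary larger value is
  -- used instead.
  refine le_of_forall_gt_imp_ge_of_dense fun a ha => ?_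
  refine lintegral_ofReal_le_of_tendsto
    (f := fun k x => (c.Y s x + c.lowerK s) * ‖c.LinvSqrt t (w (ns k)) x‖ ^ 2) ?_ ?_ ?_
  · intro k
    exact ((c.aestronglyMeasurable_Y s).add_const _).mul ((Lp.aestronglyMeasurable _).norm.pow 2)
  · filter_upwards [hae] with x hx
    exact (hx.norm.pow 2).const_mul _
  · have h1 : Filter.Tendsto (fun k => ENNReal.ofReal (C * ‖w (ns k)‖ ^ 2)) Filter.atTop
        (nhds (ENNReal.ofReal (C * ‖v‖ ^ 2))) :=
      (ENNReal.continuous_ofReal.tendsto _).comp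
        (((hwv.comp hns.tendsto_atTop).norm.pow 2).const_mul C)
    filter_upwards [h1.eventually_lt_const ha] with k hk
    exact (hpot _ (hw _)).trans hk.le

theorem LinvSqrt_mem_formDom (hμ : IsSmoothDensity (n := n) μ)
    (hd : c.HasCoeffDeriv dY dA dθ dg) (hD : LocallyIntegrable D) (hD1 : ∀ r, 1 ≤ D r)
    {s t : ℝ} (hst : |t - s| ≤ 1)
    (hLt : c.PositiveInvertible t) (h : c.HasRate dY dA dθ dg D t) (v : Lp ℂ 2 μ) :
    c.LinvSqrt t v ∈ c.formDom s ∧ ∫ x, c.Y s x * ‖c.LinvSqrt t v x‖ ^ 2 ∂μ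
      ≤ (1 + (∫ r in Ι s t, D r) + c.lowerK s * ‖c.LinvSqrt t‖ ^ 2) * ‖v‖ ^ 2 := by
  have hv := ((hLt.range_LinvSqrt hμ).1 v).1
  have hl := lintegral_Y_le_of_dense hμ hd hD hst hLt h v
  have hJ0 : 0 ≤ ∫ r in Ι s t, D r := (abs_nonneg _).trans (abs_sub_le_setIntegral hD hD1 s t)
  have hdens := (dens_sub_le hμ hd hD hD1 hst h hv rfl).1
  set u := c.LinvSqrt t v
  have hK := c.lowerK_nonneg s
  have h0 : 0 ≤ᵐ[μ] fun x => (c.Y s x + c.lowerK s) * ‖u x‖ ^ 2 := by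
    filter_upwards [c.lowerK_spec s] with x hx using mul_nonneg hx (sq_nonneg _)
  have hm : AEStronglyMeasurable (fun x => (c.Y s x + c.lowerK s) * ‖u x‖ ^ 2) μ :=
    ((c.aestronglyMeasurable_Y s).add_const _).mul ((Lp.aestronglyMeasurable u).norm.pow 2)
  have h4 := (integrable_norm_sq u).const_mul (c.lowerK s)
  have h5 : Integrable (fun x => (c.Y s x + c.lowerK s) * ‖u x‖ ^ 2) μ := by
    refine ⟨hm, ?_⟩
    rw [hasFiniteIntegral_iff_ofReal h0]
    exact hl.trans_lt ENNReal.ofReal_lt_top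
  have h6 : Integrable (fun x => c.Y s x * ‖u x‖ ^ 2) μ := by
    refine (h5.sub h4).congr (Filter.Eventually.of_forall fun x => ?_)
    simp only [Pi.sub_apply]
    ring
  refine ⟨(c.mem_formDom_iff s u).2 ⟨((c.mem_formDom_iff t u).1 hv).1, hdens, h6⟩, ?_⟩
  have h7 : ∫ x, c.Y s x * ‖u x‖ ^ 2 ∂μ ≤ ∫ x, (c.Y s x + c.lowerK s) * ‖u x‖ ^ 2 ∂μ :=
    integral_mono h6 h5 fun x => by
      simp only [add_mul]
      exact le_add_of_nonneg_right (mul_nonneg hK (sq_nonneg _))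
  refine h7.trans ?_
  rw [integral_eq_lintegral_of_nonneg_ae h0 hm]
  exact ENNReal.toReal_le_of_le_ofReal (by positivity) hl

theorem form_self_eq_re (t : ℝ) (u : Lp ℂ 2 μ) : c.form t u u = ((c.form t u u).re : ℂ) :=
  (Complex.conj_eq_iff_re.1 (c.form_conj_symm t u u)).symm

/-- The operator must exist before the sharp estimate can be extended from `potDom` by continuity,
so boundedness is first proved with a crude constant. -/
theorem exists_form_sub (hμ : IsSmoothDensity (n := n) μ)
    (hd : c.HasCoeffDeriv dY dA dθ dg) (hD : LocallyIntegrable D) (hD1 : ∀ r, 1 ≤ D r)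
    {s t : ℝ} (hst : |t - s| ≤ 1)
    (hLt : c.PositiveInvertible t) (h : c.HasRate dY dA dθ dg D t) {M J : ℝ}
    (hM : ∀ v, ∫ x, c.dens t (c.LinvSqrt t v) x ∂μ ≤ M * ‖v‖ ^ 2)
    (hJ : J = ∫ r in Ι s t, D r) :
    ∃ T : Lp ℂ 2 μ →L[ℂ] Lp ℂ 2 μ,
      (∀ v w, inner ℂ v (T w) = c.form t (c.LinvSqrt t v) (c.LinvSqrt t w)
        - c.form s (c.LinvSqrt t v) (c.LinvSqrt t w)) ∧
      ∀ v, ‖inner ℂ v (T v)‖ ≤ J * (3 * M + 4 * J ^ 2 + 2 * J + 3) * ‖v‖ ^ 2 := by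
  have hJ0 : 0 ≤ J := hJ ▸ (abs_nonneg _).trans (abs_sub_le_setIntegral hD hD1 s t)
  have ht := fun v => ((hLt.range_LinvSqrt hμ).1 v).1
  have hs := fun v => (LinvSqrt_mem_formDom hμ hd hD hD1 hst hLt h v).1
  have hct := c.isClosedForm hμ t
  have hcs := c.isClosedForm hμ s
  have hE : ∀ v, |∫ x, c.dens t (c.LinvSqrt t v) x ∂μ - ∫ x, c.dens s (c.LinvSqrt t v) x ∂μ|
      ≤ J * (3 * M + 4 * J ^ 2 + 2 * J + 2) * ‖v‖ ^ 2 := by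
    intro v
    refine (dens_sub_le hμ hd hD hD1 hst h (ht v) hJ).2.trans ?_
    rw [mul_assoc]
    refine mul_le_mul_of_nonneg_left ?_ hJ0
    nlinarith [hM v]
  have hself : ∀ v, c.form t (c.LinvSqrt t v) (c.LinvSqrt t v)
      - c.form s (c.LinvSqrt t v) (c.LinvSqrt t v)
      = (((c.form t (c.LinvSqrt t v) (c.LinvSqrt t v)).re
        - (c.form s (c.LinvSqrt t v) (c.LinvSqrt t v)).re : ℝ) : ℂ) := by
    intro v
    rw [c.form_self_eq_re t, c.form_self_eq_re s]
    push_cast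
    rfl
  have hcrude : ∃ R : ℝ, ∀ v, ‖c.form t (c.LinvSqrt t v) (c.LinvSqrt t v)
      - c.form s (c.LinvSqrt t v) (c.LinvSqrt t v)‖ ≤ R * ‖v‖ ^ 2 := by
    -- Each form is bounded separately: l_t from above by ‖v‖², both from below by -K‖u‖², and l_s
    -- from above through its energy and potential parts.
    refine ⟨(1 + c.lowerK t * ‖c.LinvSqrt t‖ ^ 2 + c.lowerK s * ‖c.LinvSqrt t‖ ^ 2)
      + ((1 + J + c.lowerK s * ‖c.LinvSqrt t‖ ^ 2) + M
        + J * (3 * M + 4 * J ^ 2 + 2 * J + 2)), fun v => ?_⟩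
    rw [hself, Complex.norm_real, Real.norm_eq_abs]
    have h1 := ((hLt.range_LinvSqrt hμ).1 v).2
    have h2 := c.form_self_add_nonneg t (ht v)
    have h3 := c.form_self_add_nonneg s (hs v)
    have h4 := (LinvSqrt_mem_formDom hμ hd hD hD1 hst hLt h v).2
    have h5 := c.form_self_re s (hs v)
    have h6 := (abs_le.1 (hE v)).1
    have h7 := hM v
    have h8 : ‖c.LinvSqrt t v‖ ^ 2 ≤ ‖c.LinvSqrt t‖ ^ 2 * ‖v‖ ^ 2 := by
      rw [← mul_pow]
      gcongr
      exact (c.LinvSqrt t).le_opNorm v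
    have h9 := mul_le_mul_of_nonneg_left h8 (c.lowerK_nonneg t)
    have h10 := mul_le_mul_of_nonneg_left h8 (c.lowerK_nonneg s)
    have h11 : 0 ≤ M * ‖v‖ ^ 2 := (integral_nonneg (c.dens_nonneg t _)).trans h7
    have h12 : 0 ≤ J * ‖v‖ ^ 2 := by positivity
    have h13 : 0 ≤ c.lowerK t * (‖c.LinvSqrt t‖ ^ 2 * ‖v‖ ^ 2) :=
      mul_nonneg (c.lowerK_nonneg t) (by positivity)
    have h14 : 0 ≤ c.lowerK s * (‖c.LinvSqrt t‖ ^ 2 * ‖v‖ ^ 2) :=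
      mul_nonneg (c.lowerK_nonneg s) (by positivity)
    have h15 : 0 ≤ J * (3 * M + 4 * J ^ 2 + 2 * J + 2) * ‖v‖ ^ 2 := (abs_nonneg _).trans (hE v)
    have h16 : 0 ≤ ‖v‖ ^ 2 := sq_nonneg _
    rw [← hJ] at h4
    simp only [add_mul _ _ (‖v‖ ^ 2), one_mul, mul_assoc (c.lowerK _)] at h4 ⊢
    rw [abs_le]
    constructor <;> linarith
  obtain ⟨R, hR⟩ := hcrude
  obtain ⟨T, hT⟩ := exists_clm_of_quad
    (b := fun v w => c.form t (c.LinvSqrt t v) (c.LinvSqrt t w)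
        - c.form s (c.LinvSqrt t v) (c.LinvSqrt t w)) (M := R)
    (fun u v w => by
      simp only [map_add]
      rw [hct.add_left (ht u) (ht v) (ht w), hcs.add_left (hs u) (hs v) (hs w)]
      ring)
    (fun u v w => by
      simp only [map_add]
      rw [hct.add_right _ (ht u) _ (ht v) _ (ht w), hcs.add_right _ (hs u) _ (hs v) _ (hs w)]
      ring)
    (fun z v w => by
      simp only [map_smul]
      rw [hct.smul_left z (ht v) (ht w), hcs.smul_left z (hs v) (hs w)]
      ring)
    (fun z v w => by
      simp only [map_smul]
      rw [hct.smul_right z _ (ht v) _ (ht w), hcs.smul_right z _ (hs v) _ (hs w)]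
      ring) hR
  refine ⟨T, hT, ?_⟩
  -- Both sides are now continuous in v, so it suffices to check the sharp bound on the dense set.
  -- The potential raises the last constant from 2 to 3.
  have hclosed : IsClosed {v | ‖inner ℂ v (T v)‖ ≤ J * (3 * M + 4 * J ^ 2 + 2 * J + 3) * ‖v‖ ^ 2} :=
    isClosed_le (by fun_prop) (by fun_prop)
  have hpot : c.potDom dY t ⊆
      {v | ‖inner ℂ v (T v)‖ ≤ J * (3 * M + 4 * J ^ 2 + 2 * J + 3) * ‖v‖ ^ 2} := by
    intro v hv
    change ‖inner ℂ v (T v)‖ ≤ _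
    rw [hT, hself, Complex.norm_real, Real.norm_eq_abs, c.form_self_re t (ht v),
      c.form_self_re s (hs v), add_sub_add_comm]
    refine (abs_add_le _ _).trans ?_
    have h1 := (pot_sub_le hμ hd.pot hD hst h hv ((c.mem_formDom_iff t _).1 (ht v)).2.2).2
    rw [← hJ] at h1
    have h2 := hE v
    calc _ ≤ J * (3 * M + 4 * J ^ 2 + 2 * J + 2) * ‖v‖ ^ 2 + J * ‖v‖ ^ 2 := add_le_add h2 h1
      _ = _ := by ring
  intro v
  exact hclosed.closure_subset_iff.2 hpot (h.dense v)

end KGCoeffs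

end

/-! ### Locally uniform energy constants and the conclusion -/

section

open scoped Interval


section LocallyIntegrableReal

theorem exists_nat_subset_Icc {K : Set ℝ} (hK : IsCompact K) :
    ∃ N : ℕ, K ⊆ Icc (-N : ℝ) N := by
  obtain ⟨R, hR⟩ := hK.isBounded.exists_norm_le
  obtain ⟨N, hN⟩ := exists_nat_ge R
  exact ⟨N, fun r hr => abs_le.1 ((hR r hr).trans hN)⟩

theorem locallyIntegrable_of_memLp_two {f : ℝ → ℝ}
    (hf : ∀ a b : ℝ, MemLp f 2 (volume.restrict (Icc a b))) : LocallyIntegrable f := by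
  rw [locallyIntegrable_iff]
  intro K hK
  obtain ⟨N, hN⟩ := exists_nat_subset_Icc hK
  exact IntegrableOn.mono_set ((hf (-N) N).integrable one_le_two) hN

theorem LocallyIntegrable.mul_monotone_ceil {D : ℝ → ℝ} (hD : LocallyIntegrable D) {Q : ℕ → ℝ}
    (hQ : Monotone Q) (hQ0 : ∀ N, 0 ≤ Q N) :
    LocallyIntegrable fun r => Q (⌈|r|⌉₊ + 1) * D r := by
  rw [locallyIntegrable_iff]
  intro K hK
  obtain ⟨N, hN⟩ := exists_nat_subset_Icc hK
  refine IntegrableOn.mono_set (t := Icc (-N : ℝ) N) ?_ hN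
  refine Integrable.bdd_mul (c := Q (N + 1)) (hD.integrableOn_isCompact isCompact_Icc) ?_ ?_
  · have h1 : Measurable fun r : ℝ => ⌈|r|⌉₊ + 1 :=
      (Nat.measurable_ceil.comp measurable_norm).add_const 1
    exact ((measurable_of_countable Q).comp h1).aestronglyMeasurable
  · refine (ae_restrict_mem measurableSet_Icc).mono fun r hr => ?_
    rw [Real.norm_of_nonneg (hQ0 _)]
    exact hQ (Nat.add_le_add_right (Nat.ceil_le.2 (abs_le.2 hr)) 1)

theorem tendsto_setIntegral_uIoc {D : ℝ → ℝ} (hD : LocallyIntegrable D) (hD1 : ∀ r, 1 ≤ D r)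
    (t : ℝ) : Filter.Tendsto (fun s => ∫ r in Ι s t, D r) (nhds t) (nhds 0) := by
  have h1 : Continuous fun s => ∫ r in t..s, D r :=
    intervalIntegral.continuous_primitive
      (fun a b => ⟨(hD.integrableOn_isCompact isCompact_Icc).mono_set Ioc_subset_Icc_self,
        (hD.integrableOn_isCompact isCompact_Icc).mono_set Ioc_subset_Icc_self⟩) t
  have h2 := h1.abs.tendsto t
  simp only [intervalIntegral.integral_same, abs_zero] at h2
  refine h2.congr fun s => ?_
  rw [intervalIntegral.abs_intervalIntegral_eq, uIoc_comm, abs_of_nonneg]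
  exact integral_nonneg fun r => zero_le_one.trans (hD1 r)

end LocallyIntegrableReal

variable {n : ℕ} {S : Type*} [TopologicalSpace S] [ChartedSpace (Spc n) S]
  [MeasurableSpace S] [BorelSpace S] [SecondCountableTopology S] {μ : Measure S}
  [IsManifold 𝓘(ℝ, Spc n) ∞ S]

namespace KGCoeffs

variable {c : KGCoeffs n S μ}

/-- `M` bounds the energy of `L(t)^{-1/2} v` relative to `‖v‖²`. -/
def EnergyBound (c : KGCoeffs n S μ) (t M : ℝ) : Prop :=
  ∀ v, ∫ x, c.dens t (c.LinvSqrt t v) x ∂μ ≤ M * ‖v‖ ^ 2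

theorem EnergyBound.mono {t M M' : ℝ} (h : c.EnergyBound t M) (hM : M ≤ M') :
    c.EnergyBound t M' := fun v => (h v).trans (by gcongr)

/-- The energy is at most l_t(u,u) + K‖u‖², with l_t(u,u) ≤ ‖v‖². The constant depends on t in an
uncontrolled way. -/
theorem exists_energyBound (hμ : IsSmoothDensity (n := n) μ) {t : ℝ}
    (hLt : c.PositiveInvertible t) : ∃ M, 0 ≤ M ∧ c.EnergyBound t M := by
  refine ⟨1 + c.lowerK t * ‖c.LinvSqrt t‖ ^ 2,
    add_nonneg zero_le_one (mul_nonneg (c.lowerK_nonneg t) (sq_nonneg _)), fun v => ?_⟩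
  obtain ⟨h1, h2⟩ := (hLt.range_LinvSqrt hμ).1 v
  refine (c.integral_dens_le t h1).trans ?_
  have h3 : ‖c.LinvSqrt t v‖ ^ 2 ≤ ‖c.LinvSqrt t‖ ^ 2 * ‖v‖ ^ 2 := by
    rw [← mul_pow]
    gcongr
    exact (c.LinvSqrt t).le_opNorm v
  have h4 := mul_le_mul_of_nonneg_left h3 (c.lowerK_nonneg t)
  rw [add_mul, one_mul, mul_assoc]
  exact add_le_add h2 h4

variable {dY : ℝ → S → ℝ} {dA dθ : ℝ → OneForm n S ℝ} {dg : ℝ → CoMetric n S} {D : ℝ → ℝ}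

/-- A vector u = L(s)^{-1/2} v lies in dom l_t, hence u = L(t)^{-1/2} v' with ‖v'‖² ≤ l_t(u,u). When
J is small relative to M, the form estimate at t gives ‖v'‖² ≤ 2‖v‖², and the energy of u changes by
at most ‖v'‖²/2. -/
theorem energyBound_near (hμ : IsSmoothDensity (n := n) μ)
    (hd : c.HasCoeffDeriv dY dA dθ dg) (hD : LocallyIntegrable D) (hD1 : ∀ r, 1 ≤ D r)
    (hL : ∀ t, c.PositiveInvertible t) (h : ∀ t, c.HasRate dY dA dθ dg D t)
    {s t M : ℝ} (hst : |t - s| ≤ 1) (hM0 : 0 ≤ M) (hM : c.EnergyBound t M)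
    (hJ1 : ∫ r in Ι s t, D r ≤ 1) (hJM : (∫ r in Ι s t, D r) * (3 * M + 9) ≤ 1 / 2) :
    c.EnergyBound s (2 * (M + 1)) := by
  intro v
  obtain ⟨h1, h2⟩ := ((hL s).range_LinvSqrt hμ).1 v
  have h3 := (LinvSqrt_mem_formDom hμ hd hD hD1 (abs_sub_comm t s ▸ hst) (hL s) (h s) v).1
  set u := c.LinvSqrt s v
  obtain ⟨v', hv', hv'n⟩ := ((hL t).range_LinvSqrt hμ).2 u h3
  obtain ⟨T, hT, hTn⟩ := exists_form_sub hμ hd hD hD1 hst (hL t) (h t) hM rfl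
  have h4 := hTn v'
  have h5 := (dens_sub_le hμ hd hD hD1 hst (h t) (hv' ▸ h3) rfl).2
  have h6 := hM v'
  rw [hT, c.form_self_eq_re t, c.form_self_eq_re s, ← Complex.ofReal_sub, Complex.norm_real,
    Real.norm_eq_abs] at h4
  have hJ0 : 0 ≤ ∫ r in Ι s t, D r := (abs_nonneg _).trans (abs_sub_le_setIntegral hD hD1 s t)
  rw [hv'] at h4 h5 h6
  set J := ∫ r in Ι s t, D r
  have hJ2 : J ^ 2 ≤ 1 := pow_le_one₀ hJ0 hJ1
  have hv0 : 0 ≤ ‖v'‖ ^ 2 := sq_nonneg _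
  -- Since J ≤ 1, the polynomial 4J² + 2J + 3 is at most 9.
  have hR : J * (3 * M + 4 * J ^ 2 + 2 * J + 3) ≤ 1 / 2 :=
    (mul_le_mul_of_nonneg_left (by linarith) hJ0).trans hJM
  -- From ‖v'‖² ≤ l_t(u,u) ≤ l_s(u,u) + ‖v'‖²/2 ≤ ‖v‖² + ‖v'‖²/2.
  have h7 : ‖v'‖ ^ 2 ≤ 2 * ‖v‖ ^ 2 := by
    have h8 := (abs_le.1 (h4.trans (mul_le_mul_of_nonneg_right hR hv0))).2
    linarith
  have h9 : J * (3 * (∫ x, c.dens t u x ∂μ) + (4 * J ^ 2 + 2 * J + 2) * ‖v'‖ ^ 2)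
      ≤ 1 / 2 * ‖v'‖ ^ 2 := by
    calc _ ≤ J * ((3 * M + 9) * ‖v'‖ ^ 2) := by
          refine mul_le_mul_of_nonneg_left ?_ hJ0
          nlinarith
      _ = J * (3 * M + 9) * ‖v'‖ ^ 2 := by ring
      _ ≤ _ := mul_le_mul_of_nonneg_right hJM hv0
  have h10 := (abs_le.1 (h5.trans h9)).1
  calc ∫ x, c.dens s u x ∂μ ≤ (M + 1) * ‖v'‖ ^ 2 := by linarith
    _ ≤ (M + 1) * (2 * ‖v‖ ^ 2) := by gcongr
    _ = _ := by ring

/-- Each t has a neighbourhood with a common constant because J → 0 as s → t; compactness patches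
finitely many of them. -/
theorem exists_energyBound_Icc (hμ : IsSmoothDensity (n := n) μ)
    (hd : c.HasCoeffDeriv dY dA dθ dg) (hD : LocallyIntegrable D) (hD1 : ∀ r, 1 ≤ D r)
    (hL : ∀ t, c.PositiveInvertible t) (h : ∀ t, c.HasRate dY dA dθ dg D t) (a b : ℝ) :
    ∃ M, 0 ≤ M ∧ ∀ t ∈ Icc a b, c.EnergyBound t M := by
  refine (isCompact_Icc (a := a) (b := b)).induction_on
    (p := fun K => ∃ M, 0 ≤ M ∧ ∀ t ∈ K, c.EnergyBound t M) ⟨0, le_rfl, by simp⟩ ?_ ?_ ?_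
  · rintro K K' hK ⟨M, hM0, hM⟩
    exact ⟨M, hM0, fun t ht => hM t (hK ht)⟩
  · rintro K K' ⟨M, hM0, hM⟩ ⟨M', hM0', hM'⟩
    refine ⟨max M M', hM0.trans (le_max_left _ _), ?_⟩
    rintro t (ht | ht)
    · exact (hM t ht).mono (le_max_left _ _)
    · exact (hM' t ht).mono (le_max_right _ _)
  · intro t _
    obtain ⟨M, hM0, hM⟩ := exists_energyBound hμ (hL t)
    have h1 := tendsto_setIntegral_uIoc hD hD1 t
    have h2 := h1.mul_const (3 * M + 9)
    rw [zero_mul] at h2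
    have h3 : ∀ᶠ s in nhds t, |t - s| < 1 := by
      have : Filter.Tendsto (fun s => |t - s|) (nhds t) (nhds 0) := by
        have := ((continuous_const (y := t)).sub continuous_id).abs.tendsto t
        simpa using this
      exact this.eventually_lt_const one_pos
    refine ⟨_, mem_nhdsWithin_of_mem_nhds ((h3.and ((h1.eventually_lt_const one_pos).and
      (h2.eventually_lt_const (one_half_pos (α := ℝ)))))), 2 * (M + 1), by positivity, ?_⟩
    rintro s ⟨hs1, hs2, hs3⟩
    exact energyBound_near hμ hd hD hD1 hL h hs1.le hM0 hM hs2.le hs3.le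

theorem exists_norm_form_sub_le (hμ : IsSmoothDensity (n := n) μ)
    (hd : c.HasCoeffDeriv dY dA dθ dg) (hD : LocallyIntegrable D) (hD1 : ∀ r, 1 ≤ D r)
    (hL : ∀ t, c.PositiveInvertible t) (h : ∀ t, c.HasRate dY dA dθ dg D t) (N : ℕ) :
    ∃ Q, 0 ≤ Q ∧ ∀ t s : ℝ, |t - s| ≤ 1 → |t| ≤ N → ∃ T : Lp ℂ 2 μ →L[ℂ] Lp ℂ 2 μ,
      (∀ v w, inner ℂ v (T w) = c.form t (c.LinvSqrt t v) (c.LinvSqrt t w)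
        - c.form s (c.LinvSqrt t v) (c.LinvSqrt t w)) ∧ ‖T‖ ≤ Q * ∫ r in Ι s t, D r := by
  obtain ⟨M, hM0, hM⟩ := exists_energyBound_Icc hμ hd hD hD1 hL h (-N) N
  have hD0 : ∀ r, 0 ≤ D r := fun r => zero_le_one.trans (hD1 r)
  set P := ∫ r in Icc (-N - 1 : ℝ) (N + 1), D r
  have hP : 0 ≤ P := integral_nonneg hD0
  -- P bounds every J that occurs, since t and s lie in [-N - 1, N + 1]; the leading 2 is the
  -- polarization loss.
  refine ⟨2 * (3 * M + 4 * P ^ 2 + 2 * P + 3), by positivity, fun t s hst ht => ?_⟩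
  obtain ⟨T, hT, hTn⟩ := exists_form_sub hμ hd hD hD1 hst (hL t) (h t) (hM t (abs_le.1 ht)) rfl
  have hJ0 : 0 ≤ ∫ r in Ι s t, D r := integral_nonneg hD0
  have hJP : ∫ r in Ι s t, D r ≤ P := by
    refine setIntegral_mono_set (hD.integrableOn_isCompact isCompact_Icc)
      (Filter.Eventually.of_forall hD0) (LE.le.eventuallyLE ?_)
    refine (uIoc_subset_Icc_of_abs_sub_le hst).trans (Icc_subset_Icc ?_ ?_)
    · linarith [(abs_le.1 ht).1]
    · linarith [(abs_le.1 ht).2]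
  refine ⟨T, hT, (opNorm_le_of_quad (by positivity) hTn).trans ?_⟩
  set J := ∫ r in Ι s t, D r
  calc 2 * (J * (3 * M + 4 * J ^ 2 + 2 * J + 3)) ≤ 2 * (J * (3 * M + 4 * P ^ 2 + 2 * P + 3)) := by
        gcongr
    _ = _ := by ring

theorem lwGrowthLoc_of_hasRate (hμ : IsSmoothDensity (n := n) μ)
    (hd : c.HasCoeffDeriv dY dA dθ dg) (hD : LocallyIntegrable D) (hD1 : ∀ r, 1 ≤ D r)
    (hL : ∀ t, c.PositiveInvertible t) (h : ∀ t, c.HasRate dY dA dθ dg D t)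
    {dβ : ℝ → VecField n S} (hdβ : IsVecTimeDeriv c.β dβ)
    {dw : ℝ → S → ℂ} (hdw : IsTimeDeriv μ c.wCoeff dw)
    (hW : ∀ t, ∀ᵐ r ∂(volume.restrict (Icc (t - 1) (t + 1))), ∃ B : Lp ℂ 2 μ →L[ℂ] Lp ℂ 2 μ,
      (∀ v, (B v : S → ℂ) =ᵐ[μ] firstOrder (dβ r) (dw r) (c.LinvSqrt t v)) ∧ ‖B‖ ≤ D r) :
    c.LWGrowthLoc := by
  choose Q hQ0 hQ using exists_norm_form_sub_le hμ hd hD hD1 hL h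
  have hD0 : ∀ r, 0 < D r := fun r => zero_lt_one.trans_le (hD1 r)
  -- Partial sums make the constants monotone in N, and the extra 2 accounts for 2‖B‖.
  set Q' : ℕ → ℝ := fun N => 2 + ∑ k ∈ Finset.range (N + 1), Q k
  have hmono : Monotone Q' := fun N N' hN => by
    refine add_le_add le_rfl (Finset.sum_le_sum_of_subset_of_nonneg ?_ fun k _ _ => hQ0 k)
    exact Finset.range_mono (Nat.add_le_add_right hN 1)
  have hQ'0 : ∀ N, 0 < Q' N := fun N =>
    add_pos_of_pos_of_nonneg two_pos (Finset.sum_nonneg fun k _ => hQ0 k)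
  have hQQ' : ∀ N, Q N + 2 ≤ Q' N := fun N => by
    rw [add_comm]
    exact add_le_add le_rfl
      (Finset.single_le_sum (fun k _ => hQ0 k) (Finset.self_mem_range_succ N))
  have hC := LocallyIntegrable.mul_monotone_ceil hD hmono fun N => (hQ'0 N).le
  refine ⟨_, hC, fun r => mul_pos (hQ'0 _) (hD0 r), fun t s hst => ⟨fun v =>
    ⟨(((hL t).range_LinvSqrt hμ).1 v).1,
      (LinvSqrt_mem_formDom hμ hd hD hD1 hst (hL t) (h t) v).1⟩, ?_⟩⟩
  obtain ⟨T, hT, hTn⟩ := hQ ⌈|t|⌉₊ t s hst (Nat.le_ceil _)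
  obtain ⟨B, hB, hBn⟩ := exists_W_sub hμ (hL t) hdβ hdw hD hD1 hst (hW t)
  refine ⟨T, B, hT, hB, ?_⟩
  rw [intervalIntegral.abs_intervalIntegral_eq, abs_of_nonneg
    (integral_nonneg fun r => (mul_pos (hQ'0 _) (hD0 r)).le)]
  calc ‖T‖ + 2 * ‖B‖ ≤ (Q ⌈|t|⌉₊ + 2) * ∫ r in Ι s t, D r := by rw [add_mul]; gcongr
    _ = ∫ r in Ι s t, (Q ⌈|t|⌉₊ + 2) * D r := (integral_const_mul _ _).symm
    _ ≤ ∫ r in Ι s t, Q' (⌈|r|⌉₊ + 1) * D r := by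
      refine setIntegral_mono_on ((LocallyIntegrable.integrableOn_uIoc hD s t).const_mul _)
        (LocallyIntegrable.integrableOn_uIoc hC s t) measurableSet_uIoc fun r hr => ?_
      refine mul_le_mul_of_nonneg_right ((hQQ' _).trans (hmono ?_)) (hD0 r).le
      have h1 := uIoc_subset_Icc_of_abs_sub_le hst hr
      -- Since |t - r| ≤ 1, the factor at r, with its argument shifted by one, dominates the
      -- constant belonging to t.
      have h2 : |t| ≤ |r| + 1 := by
        have h3 : |t - r| ≤ 1 := abs_le.2 ⟨by linarith [h1.2], by linarith [h1.1]⟩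
        linarith [abs_sub_abs_le_abs_sub t r]
      refine Nat.ceil_le.2 ?_
      push_cast
      linarith [Nat.le_ceil |r|]

end KGCoeffs

end

end

theorem mainTheorem11 {n : ℕ} {S : Type*} [TopologicalSpace S] [T2Space S]
    [SecondCountableTopology S] [ChartedSpace (Spc n) S] [IsManifold 𝓘(ℝ, Spc n) ∞ S]
    [MeasurableSpace S] [BorelSpace S] (μ : Measure S) (hμ : IsSmoothDensity (n := n) μ)
    (c : KGCoeffs n S μ) (hL : ∀ t, c.PositiveInvertible t)
    -- the time derivatives of `Ỹ`, of the coefficients of `W`, of `A`, `γ⁻¹ dγ` and `g̃`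
    (dY : ℝ → S → ℝ) (hdY : IsTimeDeriv μ c.Y dY)
    (dβ : ℝ → VecField n S) (hdβ : IsVecTimeDeriv c.β dβ)
    (dw : ℝ → S → ℂ) (hdw : IsTimeDeriv μ c.wCoeff dw)
    (dA : ℝ → OneForm n S ℝ) (hdA : IsFormTimeDeriv c.A dA)
    (dθ : ℝ → OneForm n S ℝ) (hdθ : IsFormTimeDeriv c.θ dθ)
    (dg : ℝ → CoMetric n S) (hdg : IsMetTimeDeriv c.g dg)
    (CY Cg CW CA Cγ : ℝ → ℝ)
    (hCY : LocallyIntegrable CY) (hCg : LocallyIntegrable Cg) (hCW : LocallyIntegrable CW)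
    (hCA : ∀ a b : ℝ, MemLp CA 2 (volume.restrict (Icc a b)))
    (hCγ : ∀ a b : ℝ, MemLp Cγ 2 (volume.restrict (Icc a b)))
    (hCY0 : ∀ r, 0 ≤ CY r) (hCg0 : ∀ r, 0 ≤ Cg r) (hCW0 : ∀ r, 0 ≤ CW r)
    (hCA0 : ∀ r, 0 ≤ CA r) (hCγ0 : ∀ r, 0 ≤ Cγ r)
    -- `‖L(t)^{-1/2} ∂ₛỸ(s) L(t)^{-1/2}‖ ≤ C_Y(s)`, a densely defined bounded form
    (hYdense : ∀ t, Dense (c.potDom dY t))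
    (hY : ∀ t, ∀ v ∈ c.potDom dY t, ∀ w ∈ c.potDom dY t,
      ∀ᵐ s ∂(volume.restrict (Icc (t - 1) (t + 1))),
        ‖∫ x, (starRingEnd ℂ) (c.LinvSqrt t v x) * (dY s x : ℂ) * c.LinvSqrt t w x ∂μ‖
          ≤ CY s * ‖v‖ * ‖w‖)
    -- `‖∂ₛW(s) L(t)^{-1/2}‖ ≤ C_W(s)`
    (hW : ∀ t, ∀ᵐ s ∂(volume.restrict (Icc (t - 1) (t + 1))),
      ∃ B : Lp ℂ 2 μ →L[ℂ] Lp ℂ 2 μ,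
        (∀ v, (B v : S → ℂ) =ᵐ[μ] KGCoeffs.firstOrder (dβ s) (dw s) (c.LinvSqrt t v)) ∧
        ‖B‖ ≤ CW s)
    -- `‖∂ₛA(s) L(t)^{-1/2}‖_t ≤ C_A(s)`
    (hA : ∀ t, ∀ᵐ s ∂(volume.restrict (Icc (t - 1) (t + 1))), c.FormMulBound t (dA s) (CA s))
    -- `‖∂ₛ(γ(s)⁻¹ dγ(s)) L(t)^{-1/2}‖_t ≤ C_γ(s)`
    (hγ : ∀ t, ∀ᵐ s ∂(volume.restrict (Icc (t - 1) (t + 1))), c.FormMulBound t (dθ s) (Cγ s))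
    -- `|∂ₛg̃ⁱʲ(s) Xᵢ Xⱼ| ≤ C_g(s) g̃ⁱʲ(t) Xᵢ Xⱼ`
    (hg : ∀ t, ∀ᵐ s ∂(volume.restrict (Icc (t - 1) (t + 1))), ∀ᵐ x ∂μ,
      ∀ ξ : TangentSpace 𝓘(ℝ, Spc n) x →L[ℝ] ℝ, |dg s x ξ ξ| ≤ Cg s * c.g t x ξ ξ) :
    c.LWGrowthLoc := by
  -- The summand 1 gives D ≥ 1, so D can be divided by in the weights. The rates C_A and C_γ enter
  -- only through their local integrability, because Minkowski bounds the increments of A and γ⁻¹dγ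
  -- linearly in them.
  have hD : LocallyIntegrable fun r => 1 + CY r + Cg r + CW r + CA r + Cγ r :=
    ((((locallyIntegrable_const 1).add hCY).add hCg).add hCW).add
      (locallyIntegrable_of_memLp_two hCA) |>.add (locallyIntegrable_of_memLp_two hCγ)
  refine KGCoeffs.lwGrowthLoc_of_hasRate (D := fun r => 1 + CY r + Cg r + CW r + CA r + Cγ r)
    hμ (dY := dY) (dA := dA) (dθ := dθ) (dg := dg) ⟨hdY, hdA, hdθ, hdg⟩ hD
    (fun r => by linarith [hCY0 r, hCg0 r, hCW0 r, hCA0 r, hCγ0 r]) hL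
    (fun t => ⟨hYdense t, fun v hv => ?_, ?_, ?_, ?_⟩) hdβ hdw fun t => ?_
  · filter_upwards [hY t v hv v hv] with s hs
    refine hs.trans ?_
    gcongr
    linarith [hCY0 s, hCg0 s, hCW0 s, hCA0 s, hCγ0 s]
  · filter_upwards [hA t] with s hs
    exact hs.mono (by linarith [hCY0 s, hCg0 s, hCW0 s, hCA0 s, hCγ0 s])
  · filter_upwards [hγ t] with s hs
    exact hs.mono (by linarith [hCY0 s, hCg0 s, hCW0 s, hCA0 s, hCγ0 s])
  · filter_upwards [hg t] with s hs
    filter_upwards [hs] with x hx ξ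
    refine (hx ξ).trans (mul_le_mul_of_nonneg_right ?_ (c.g_nonneg t x ξ))
    linarith [hCY0 s, hCg0 s, hCW0 s, hCA0 s, hCγ0 s]
  · filter_upwards [hW t] with s hs
    obtain ⟨B, hB, hBn⟩ := hs
    exact ⟨B, hB, hBn.trans (by linarith [hCY0 s, hCg0 s, hCW0 s, hCA0 s, hCγ0 s])⟩
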